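/- Let $\tilde\Lambda$ be the double Kronecker fringed quiver: it has internal vertices $v_1,v_2,v_3$, arrows $e_2,f_2:v_1\to v_2$ and $e_3,f_3:v_2\to v_3$, fringe arrows $e_1,f_1$ ending at $v_1$ and $e_4,f_4$ starting at $v_3$ (each with its own fringe vertex), and relations $e_if_{i+1}$, $f_ie_{i+1}$ for $i=1,2,3$. A *string* is a walk in the arrows and their formal inverses containing no relation, no inverse of a relation and no factor $\alpha\alpha^{-1}$ or $\alpha^{-1}\alpha$. A *route* is a maximal string, up to inversion; it is *straight* if it is an oriented walk, and *bending* otherwise. A *band* is a string $B$ of positive length such that $BB$ is a string and $B$ is not a proper power of a string, up to cyclic rotation and inversion. A *trail* is a route or a band; the substrings of a band are the factors of its powers. Two trails $p,q$ *kiss* if, for $(s,t)=(p,q)$ or $(s,t)=(q,p)$, there are a (possibly lazy) string $\sigma$ and arrows $\alpha,\beta,\gamma,\delta$ such that $\alpha^{-1}\sigma\beta$ is a substring of $s^{\pm1}$ and $\gamma\sigma\delta^{-1}$ is a substring of $t^{\pm1}$ (at the same vertex if $\sigma$ is lazy); otherwise they are *compatible*. A trail is *self-compatible* if it is compatible with itself.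 A *bundle* is a set of pairwise compatible self-compatible trails; it is *reduced* if it contains no straight route; a *maximal reduced bundle* is one that is maximal under inclusion among reduced bundles. A *clique* is a bundle consisting of routes; it is *maximal* if it is maximal under inclusion among cliques. A band is *$K$-compatible* if it is compatible with every route of the clique $K$. A clique $K$ is *band-stable* if for every clique $K'\supsetneq K$ some band is $K$-compatible but not $K'$-compatible. $K_{\mathrm{red}}$ is the set of bending routes of $K$. The *indicator vector* $\mathcal I(p)$ of a trail counts the occurrences of each arrow (with either sign) in $p$. The *g-vector* $\mathfrak g(p)\in\mathbb Z^3$ of a route $p$ has as $v$-th coordinate the number of times that the lazy string at the internal vertex $v$ occurs in $p$ as $\alpha^{-1}\beta$ (top) minus the number of times that it occurs as $\alpha\beta^{-1}$ (bottom), where $\alpha,\beta$ are arrows. The *g-vector fan* is the collection of the cones of nonnegative combinations of $\{\mathfrak g(p):p\in K_{\mathrm{red}}\}$, for $K$ a maximal clique, and its complement is the complement in $\mathbb R^3$ of the union of these cones. Write $F_{(a,b,c,d)}$ for the vector with value $a,b,c,d$ at both $e_i$ and $f_i$, for $i=1,2,3,4$ respectively. By convention, $0$ is coprime to $1$ and to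 no other nonnegative integer. **Theorem.** There are bands $B_{(b,c)}$ and routes $l_{(b,c)},r_{(b,c)}$ of $\tilde\Lambda$ such that the following hold. 1. For coprime nonnegative integers $(b,c)$, $B_{(b,c)}$ is a self-compatible band with $\mathcal I(B_{(b,c)})=F_{(0,b,c,0)}$, and these are all the self-compatible bands. 2. If $(b,c)$ are coprime nonnegative integers, or $b\ge1$ and $c=-1$, then $l_{(b,c)}$ is a self-compatible bending route with $\mathcal I(l_{(b,c)})=F_{(1,b,c+1,0)}$ if $(b,c)\ne(0,1)$, and $\mathcal I(l_{(0,1)})=F_{(1,0,0,0)}$. If $(b,c)$ are coprime nonnegative integers, or $c\ge1$ and $b=-1$, then $r_{(b,c)}$ is a self-compatible bending route with $\mathcal I(r_{(b,c)})=F_{(0,b+1,c,1)}$ if $(b,c)\neq(1,0)$, and $\mathcal I(r_{(1,0)})=F_{(0,0,0,1)}$. These are all the self-compatible bending routes. The straight routes are self-compatible as well. 3. The maximal reduced bundles that contain a band are exactly $\{l_{(b,c)},B_{(b,c)}\}$ and $\{r_{(b,c)},B_{(b,c)}\}$ for coprime nonnegative integers $(b,c)$. 4. Let $S$ be the set of straight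 routes. The band-stable cliques that are not maximal cliques are exactly $S\cup\{l_{(b,c)}\}$ and $S\cup\{r_{(b,c)}\}$, for coprime nonnegative integers $(b,c)$, and $S$. Equivalently, the sets $K_{\mathrm{red}}$, for $K$ a band-stable clique that is not a maximal clique, are exactly $\{l_{(b,c)}\}$, $\{r_{(b,c)}\}$ and $\emptyset$. 5. The complement of the g-vector fan is $$\bigcup_{(b,c)}\mathbf l_{\ge0}(b,c)\ \cup\ \bigcup_{(b,c)}\mathbf r_{\ge0}(b,c)\ \cup\ \{(x,y-x,-y): x,y\in\mathbb R_{\ge0},\ (x,y)\ne(0,0)\},$$ where $(b,c)$ runs over the pairs of coprime nonnegative integers and $$\mathbf l_{\ge0}(b,c)=\{x(b-1,c+1-b,-c-1)+y(b,c-b,-c):x\ge0,\ y>0\}\quad\text{for }(b,c)\ne(0,1),$$ $$\mathbf l_{\ge0}(0,1)=\{x(-1,0,0)+y(0,1,-1):x\ge0,\ y>0\},$$ $$\mathbf r_{\ge0}(b,c)=\{x(b+1,c-b-1,1-c)+y(b,c-b,-c):x\ge0,\ y>0\}\quad\text{for }(b,c)\ne(1,0),$$ $$\mathbf r_{\ge0}(1,0)=\{x(0,0,1)+y(1,-1,0):x\ge0,\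 y>0\}.$$ -/

import Mathlib

/-!  Fringed quivers, their strings, routes and bands, compatibility, bundles, cliques, g-vectors. -/

/-- The data of a fringed quiver: internal vertices `V`, fringe vertices `W`, arrows `E` with their
tails and heads, and the length-two monomial relations: `rel α β` means that the path `αβ`
(first `α`, then `β`) lies in the ideal. -/
structure FringedQuiver (V W E : Type) where
  tail : E → V ⊕ W
  head : E → V ⊕ W
  rel : E → E → Prop

/-- Signed arrows: `(α, true)` is `α` and `(α, false)` is the formal inverse `α⁻¹`. -/
abbrev SArrow (E : Type) := E × Bool

/-- The inverse of a walk: reverse the order and invert every signed arrow. -/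
def invWalk {E : Type} (w : List (SArrow E)) : List (SArrow E) :=
  (w.map fun x => (x.1, !x.2)).reverse

theorem invWalk_invWalk {E : Type} (w : List (SArrow E)) : invWalk (invWalk w) = w := by
  simp [invWalk, Function.comp_def]

theorem invWalk_append {E : Type} (u v : List (SArrow E)) :
    invWalk (u ++ v) = invWalk v ++ invWalk u := by
  simp [invWalk]

namespace FringedQuiver

variable {V W E : Type} (Q : FringedQuiver V W E)

/-- The start point of a signed arrow. -/
def start (x : SArrow E) : V ⊕ W := if x.2 then Q.tail x.1 else Q.head x.1

/-- The end point of a signed arrow. -/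
def finish (x : SArrow E) : V ⊕ W := if x.2 then Q.head x.1 else Q.tail x.1

/-- `xy` is a string of length two: the signed arrows are composable, `xy` is neither a relation
`βγ` nor an inverse relation `γ⁻¹β⁻¹`, and it is not of the form `αα⁻¹` or `α⁻¹α`. -/
def Step (x y : SArrow E) : Prop :=
  Q.finish x = Q.start y ∧
  (x.2 = true → y.2 = true → ¬ Q.rel x.1 y.1) ∧
  (x.2 = false → y.2 = false → ¬ Q.rel y.1 x.1) ∧
  (x.2 ≠ y.2 → x.1 ≠ y.1)

/-- Strings of positive length (all conditions on a string concern consecutive letters). -/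
def IsString (w : List (SArrow E)) : Prop := w ≠ [] ∧ w.IsChain Q.Step

/-- A route (as a word) is a maximal string. -/
def IsRoute (w : List (SArrow E)) : Prop :=
  Q.IsString w ∧ ∀ x, ¬ Q.IsString (x :: w) ∧ ¬ Q.IsString (w ++ [x])

/-- A band (as a word): a string that may be composed with itself and that is not a proper power
of a smaller string. -/
def IsBand (w : List (SArrow E)) : Prop :=
  Q.IsString w ∧ Q.IsString (w ++ w) ∧
  ∀ (u : List (SArrow E)) (n : ℕ), 2 ≤ n → w ≠ (List.replicate n u).flatten

/-- The routes, as words. -/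
abbrev RouteWord := {w : List (SArrow E) // Q.IsRoute w}

/-- The bands, as words. -/
abbrev BandWord := {w : List (SArrow E) // Q.IsBand w}

/-- Two routes are equivalent if they are equal or inverse to each other. -/
instance routeSetoid : Setoid Q.RouteWord where
  r p q := p.1 = q.1 ∨ p.1 = invWalk q.1
  iseqv :=
    { refl := fun _ => Or.inl rfl
      symm := by
        rintro p q (h | h)
        · exact Or.inl h.symm
        · right; rw [h, invWalk_invWalk]
      trans := by
        rintro p q r (h | h) (h' | h')
        · left; rw [h, h']
        · right; rw [h, h']
        · right; rw [h, h']
        · left; rw [h, h', invWalk_invWalk] }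

theorem isRotated_invWalk {u v : List (SArrow E)} (h : u ~r v) : invWalk u ~r invWalk v :=
  (h.map _).reverse

/-- Two bands are equivalent if they agree up to cyclic rotation and inversion. -/
instance bandSetoid : Setoid Q.BandWord where
  r p q := p.1 ~r q.1 ∨ p.1 ~r invWalk q.1
  iseqv :=
    { refl := fun _ => Or.inl (List.IsRotated.refl _)
      symm := by
        rintro p q (h | h)
        · exact Or.inl h.symm
        · right
          have := isRotated_invWalk h
          rw [invWalk_invWalk] at this
          exact this.symm
      trans := by
        rintro p q r (h | h) (h' | h')
        · exact Or.inl (h.trans h')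
        · exact Or.inr (h.trans h')
        · exact Or.inr (h.trans (isRotated_invWalk h'))
        · left
          have := isRotated_invWalk h'
          rw [invWalk_invWalk] at this
          exact h.trans this }

/-- Routes up to equivalence. -/
abbrev Route := Quotient Q.routeSetoid

/-- Bands up to equivalence. -/
abbrev Band := Quotient Q.bandSetoid

/-- The substrings of positive length of a route `p` or of its inverse. -/
def routeFactors (w : List (SArrow E)) : Set (List (SArrow E)) :=
  {u | u <:+: w ∨ u <:+: invWalk w}

/-- The substrings of positive length of a band or of its inverse: factors of arbitrary powers. -/
def bandFactors (w : List (SArrow E)) : Set (List (SArrow E)) :=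
  {u | ∃ n : ℕ, u <:+: (List.replicate n w).flatten ∨ u <:+: (List.replicate n (invWalk w)).flatten}

end FringedQuiver

theorem rotate_flatten_infix {α : Type} {u v : List α} (h : u ~r v) (n : ℕ) :
    (List.replicate n u).flatten <:+: (List.replicate (n + 1) v).flatten := by
  obtain ⟨a, b, rfl, rfl⟩ : ∃ a b, u = a ++ b ∧ v = b ++ a := by
    obtain ⟨k, hk, rfl⟩ := List.isRotated_iff_mod.1 h
    exact ⟨u.take k, u.drop k, (List.take_append_drop k u).symm, by
      rw [List.rotate_eq_drop_append_take hk]⟩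
  refine ⟨b, a, ?_⟩
  induction n with
  | zero => simp
  | succ n ih =>
    rw [List.replicate_succ, List.replicate_succ, List.flatten_cons, List.flatten_cons, ← ih]
    simp

namespace FringedQuiver

variable {V W E : Type} (Q : FringedQuiver V W E)

theorem bandFactors_subset {w w' : List (SArrow E)} (h : w ~r w') :
    bandFactors w ⊆ bandFactors w' := by
  rintro u ⟨n, hu | hu⟩
  · exact ⟨n + 1, Or.inl (hu.trans (rotate_flatten_infix h n))⟩
  · exact ⟨n + 1, Or.inr (hu.trans (rotate_flatten_infix (isRotated_invWalk h) n))⟩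

theorem bandFactors_invWalk (w : List (SArrow E)) :
    bandFactors (invWalk w) = bandFactors w := by
  ext u
  simp only [bandFactors, Set.mem_ofPred_eq, invWalk_invWalk]
  exact ⟨fun ⟨n, h⟩ => ⟨n, h.symm⟩, fun ⟨n, h⟩ => ⟨n, h.symm⟩⟩

theorem routeFactors_invWalk (w : List (SArrow E)) :
    routeFactors (invWalk w) = routeFactors w := by
  ext u
  simp only [routeFactors, Set.mem_ofPred_eq, invWalk_invWalk]
  exact or_comm

/-- A trail is a route or a band, up to equivalence. -/
inductive Trail
  | route (p : Q.Route) : Trail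
  | band (B : Q.Band) : Trail

/-- The set of substrings of positive length of `p` and `p⁻¹`, for a route `p`. -/
def Route.factors (p : Q.Route) : Set (List (SArrow E)) :=
  Quotient.lift (fun w : Q.RouteWord => routeFactors w.1) (by
    rintro a b (h | h)
    · show routeFactors a.1 = routeFactors b.1
      rw [h]
    · show routeFactors a.1 = routeFactors b.1
      rw [h, routeFactors_invWalk]) p

/-- The set of substrings of positive length of `B` and `B⁻¹`, for a band `B`. -/
def Band.factors (B : Q.Band) : Set (List (SArrow E)) :=
  Quotient.lift (fun w : Q.BandWord => bandFactors w.1) (by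
    rintro a b (h | h)
    · exact (bandFactors_subset h).antisymm (bandFactors_subset h.symm)
    · show bandFactors a.1 = bandFactors b.1
      rw [← bandFactors_invWalk b.1]
      exact (bandFactors_subset h).antisymm (bandFactors_subset h.symm)) B

/-- The set of substrings of positive length of `t` and `t⁻¹`, for a trail `t`. -/
def Trail.factors : Q.Trail → Set (List (SArrow E))
  | .route p => Route.factors Q p
  | .band B => Band.factors Q B

/-- There is a (possibly lazy) string `σ` which is a top substring of `s^{±1}` and a bottom
substring of `t^{±1}`: `s^{±1}` passes through `a⁻¹ σ b` and `t^{±1}` passes through `c σ d⁻¹`.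
The equation between vertices says that the two occurrences of `σ` are at the same vertex when `σ`
is lazy, and is automatic otherwise. -/
def TopBottom (s t : Q.Trail) : Prop :=
  ∃ (σ : List (SArrow E)) (a b c d : E),
    (a, false) :: (σ ++ [(b, true)]) ∈ Trail.factors Q s ∧
    (c, true) :: (σ ++ [(d, false)]) ∈ Trail.factors Q t ∧
    Q.tail a = Q.head c

/-- Two trails are compatible if they do not kiss. -/
def Compatible (s t : Q.Trail) : Prop := ¬ Q.TopBottom s t ∧ ¬ Q.TopBottom t s

/-- Self-compatible routes. -/
def SelfCompatibleRoute (p : Q.Route) : Prop := Q.Compatible (.route p) (.route p)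

/-- Self-compatible bands. -/
def SelfCompatibleBand (B : Q.Band) : Prop := Q.Compatible (.band B) (.band B)

/-- A word is straight if it, or its inverse, is an oriented walk. -/
def StraightWord (w : List (SArrow E)) : Prop :=
  (∀ x ∈ w, x.2 = true) ∨ (∀ x ∈ w, x.2 = false)

/-- A route is straight if it is an oriented walk, and bending otherwise. -/
def StraightRoute (p : Q.Route) : Prop := ∃ w : Q.RouteWord, ⟦w⟧ = p ∧ StraightWord w.1

/-- The straight trails are the straight routes. -/
def StraightTrail : Q.Trail → Prop
  | .route p => Q.StraightRoute p
  | .band _ => False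

/-- A bundle is a set of pairwise compatible (in particular self-compatible) trails. -/
def IsBundle (K : Set Q.Trail) : Prop := ∀ s ∈ K, ∀ t ∈ K, Q.Compatible s t

/-- A bundle is reduced if it contains no straight trails. -/
def IsReducedBundle (K : Set Q.Trail) : Prop := Q.IsBundle K ∧ ∀ s ∈ K, ¬ Q.StraightTrail s

/-- Maximal reduced bundles, with respect to inclusion. -/
def IsMaximalReducedBundle (K : Set Q.Trail) : Prop := Maximal Q.IsReducedBundle K

/-- A clique is a set of pairwise compatible (in particular self-compatible) routes. -/
def IsClique (K : Set Q.Route) : Prop :=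
  ∀ p ∈ K, ∀ q ∈ K, Q.Compatible (.route p) (.route q)

/-- Maximal cliques, with respect to inclusion. -/
def IsMaximalClique (K : Set Q.Route) : Prop := Maximal Q.IsClique K

/-- The reduction `K_red` of a clique: its set of bending routes. -/
def bendingPart (K : Set Q.Route) : Set Q.Route := {p ∈ K | ¬ Q.StraightRoute p}

/-- The band `B` is `K`-compatible: it is compatible with every route of `K`. -/
def BandCompatible (K : Set Q.Route) (B : Q.Band) : Prop :=
  ∀ p ∈ K, Q.Compatible (.route p) (.band B)

/-- A clique `K` is band-stable if for every clique `K'` properly containing `K` there is a band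
which is `K`-compatible but not `K'`-compatible. -/
def IsBandStable (K : Set Q.Route) : Prop :=
  Q.IsClique K ∧ ∀ K' : Set Q.Route, Q.IsClique K' → K ⊂ K' →
    ∃ B : Q.Band, Q.BandCompatible K B ∧ ¬ Q.BandCompatible K' B

/-- The number of occurrences of `α^{±1}` in a word. -/
def arrowCount [DecidableEq E] (w : List (SArrow E)) (α : E) : ℤ :=
  (w.countP fun x => decide (x.1 = α) : ℕ)

theorem arrowCount_perm [DecidableEq E] {u v : List (SArrow E)} (h : u.Perm v) :
    arrowCount u = arrowCount v := by
  funext α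
  simp only [arrowCount, h.countP_eq]

theorem arrowCount_invWalk [DecidableEq E] (w : List (SArrow E)) :
    arrowCount (invWalk w) = arrowCount w := by
  funext α
  simp [arrowCount, invWalk, List.countP_map, Function.comp_def]

/-- The indicator vector of a route. -/
def Route.indicator [DecidableEq E] (p : Q.Route) : E → ℤ :=
  Quotient.lift (fun w : Q.RouteWord => arrowCount w.1) (by
    rintro a b (h | h)
    · show arrowCount a.1 = arrowCount b.1
      rw [h]
    · show arrowCount a.1 = arrowCount b.1
      rw [h, arrowCount_invWalk]) p

/-- The indicator vector of a band. -/
def Band.indicator [DecidableEq E] (B : Q.Band) : E → ℤ :=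
  Quotient.lift (fun w : Q.BandWord => arrowCount w.1) (by
    rintro a b (h | h)
    · exact arrowCount_perm h.perm
    · exact (arrowCount_perm h.perm).trans (arrowCount_invWalk b.1)) B

/-- The contribution of two consecutive signed arrows `x`, `y` to the `v`-th coordinate of a
g-vector, where `v` is an internal vertex: `1` if the lazy string between `x` and `y` is a top
substring at `v`, `-1` if it is a bottom substring at `v`, and `0` otherwise. -/
def turn [DecidableEq V] [DecidableEq W] (v : V) (x y : SArrow E) : ℤ :=
  if Q.finish x = Sum.inl v then
    (if x.2 = false ∧ y.2 = true then 1 else if x.2 = true ∧ y.2 = false then -1 else 0)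
  else 0

/-- The g-vector of a word: at each internal vertex `v`, the number of times that the lazy string
at `v` is a top substring minus the number of times that it is a bottom substring. -/
def wordG [DecidableEq V] [DecidableEq W] (v : V) : List (SArrow E) → ℤ
  | [] => 0
  | [_] => 0
  | x :: y :: w => Q.turn v x y + wordG v (y :: w)

theorem wordG_append [DecidableEq V] [DecidableEq W] (v : V) (x y : SArrow E) :
    ∀ w : List (SArrow E), Q.wordG v (w ++ [x, y]) = Q.wordG v (w ++ [x]) + Q.turn v x y
  | [] => by simp [wordG]
  | [a] => by simp [wordG]
  | a :: b :: w => by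
    have := wordG_append v x y (b :: w)
    simp only [List.cons_append, wordG] at this ⊢
    rw [this, add_assoc]

theorem turn_inv [DecidableEq V] [DecidableEq W] (v : V) {x y : SArrow E} (h : Q.Step x y) :
    Q.turn v (y.1, !y.2) (x.1, !x.2) = Q.turn v x y := by
  have h1 : Q.finish (y.1, !y.2) = Q.finish x := by
    rw [h.1]
    obtain ⟨α, _ | _⟩ := y <;> simp [finish, start]
  obtain ⟨α, ε⟩ := x
  obtain ⟨β, δ⟩ := y
  simp only [turn, h1]
  cases ε <;> cases δ <;> simp

theorem wordG_invWalk [DecidableEq V] [DecidableEq W] (v : V) :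
    ∀ w : List (SArrow E), w.IsChain Q.Step → Q.wordG v (invWalk w) = Q.wordG v w
  | [], _ => rfl
  | [a], _ => rfl
  | x :: y :: w, h => by
    have hw := (List.isChain_cons_cons.1 h).2
    have hs := (List.isChain_cons_cons.1 h).1
    have e : invWalk (x :: y :: w) = invWalk w ++ [(y.1, !y.2), (x.1, !x.2)] := by
      simp [invWalk]
    have e' : invWalk (y :: w) = invWalk w ++ [(y.1, !y.2)] := by simp [invWalk]
    rw [e, wordG_append, ← e', wordG_invWalk v (y :: w) hw, Q.turn_inv v hs, wordG, add_comm]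

/-- The g-vector of a route. -/
def Route.g [DecidableEq V] [DecidableEq W] (p : Q.Route) : V → ℤ :=
  Quotient.lift (fun (w : Q.RouteWord) (v : V) => Q.wordG v w.1) (by
    rintro a b (h | h)
    · funext v
      show Q.wordG v a.1 = Q.wordG v b.1
      rw [h]
    · funext v
      show Q.wordG v a.1 = Q.wordG v b.1
      rw [h, Q.wordG_invWalk v b.1 b.2.1.2]) p

/-- The g-cone of a clique: all finite nonnegative combinations of the g-vectors of its bending
routes. -/
def gCone [DecidableEq V] [DecidableEq W] (K : Set Q.Route) : Set (V → ℝ) :=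
  {z | ∃ (s : Finset Q.Route) (a : Q.Route → ℝ),
    (∀ p ∈ s, p ∈ Q.bendingPart K) ∧ (∀ p ∈ s, 0 ≤ a p) ∧
    z = ∑ p ∈ s, a p • fun v => (Route.g Q p v : ℝ)}

/-- The g-vector fan: the collection of the g-cones of the maximal cliques. -/
def gFan [DecidableEq V] [DecidableEq W] : Set (Set (V → ℝ)) :=
  {C | ∃ K : Set Q.Route, Q.IsMaximalClique K ∧ C = Q.gCone K}

end FringedQuiver

/-- The arrows of the double Kronecker fringed quiver. -/
inductive DKArrow
  | e1 | e2 | e3 | e4 | f1 | f2 | f3 | f4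
  deriving DecidableEq

open DKArrow in
/-- The double Kronecker fringed quiver. The internal vertices are `0, 1, 2`; the arrows `e2, f2`
go from `0` to `1` and the arrows `e3, f3` go from `1` to `2`. The fringe arrows `e1, f1` end at
`0` and the fringe arrows `e4, f4` start at `2`, and each of these four arrows has a fringe vertex
of its own. The relations are all the paths of length two that mix the letters `e` and `f`. -/
def doubleKronecker : FringedQuiver (Fin 3) (Fin 4) DKArrow where
  tail
    | e1 => .inr 0
    | f1 => .inr 1
    | e2 | f2 => .inl 0
    | e3 | f3 => .inl 1
    | e4 | f4 => .inl 2
  head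
    | e1 | f1 => .inl 0
    | e2 | f2 => .inl 1
    | e3 | f3 => .inl 2
    | e4 => .inr 2
    | f4 => .inr 3
  rel
    | e1, f2 | e2, f3 | e3, f4 | f1, e2 | f2, e3 | f3, e4 => True
    | _, _ => False

namespace doubleKronecker

open DKArrow in
/-- The flow `F_(a,b,c,d)`. -/
def flow (a b c d : ℤ) : DKArrow → ℤ
  | e1 | f1 => a
  | e2 | f2 => b
  | e3 | f3 => c
  | e4 | f4 => d

/-- The index set of the routes `l_(b,c)`. -/
def LIndex (b c : ℤ) : Prop := (0 ≤ b ∧ 0 ≤ c ∧ Int.gcd b c = 1) ∨ (1 ≤ b ∧ c = -1)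

/-- The index set of the routes `r_(b,c)`. -/
def RIndex (b c : ℤ) : Prop := (0 ≤ b ∧ 0 ≤ c ∧ Int.gcd b c = 1) ∨ (1 ≤ c ∧ b = -1)

/-- The cone `l_{≥0}(b,c)`. -/
def lCone (b c : ℕ) : Set (Fin 3 → ℝ) :=
  {z | ∃ x y : ℝ, 0 ≤ x ∧ 0 < y ∧
    z = if (b, c) = (0, 1) then x • ![-1, 0, 0] + y • ![0, 1, -1]
      else x • ![(b : ℝ) - 1, c + 1 - b, -c - 1] + y • ![(b : ℝ), c - b, -c]}

/-- The cone `r_{≥0}(b,c)`. -/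
def rCone (b c : ℕ) : Set (Fin 3 → ℝ) :=
  {z | ∃ x y : ℝ, 0 ≤ x ∧ 0 < y ∧
    z = if (b, c) = (1, 0) then x • ![0, 0, 1] + y • ![1, -1, 0]
      else x • ![(b : ℝ) + 1, c - b - 1, 1 - c] + y • ![(b : ℝ), c - b, -c]}

end doubleKronecker

namespace DoubleKronecker

open FringedQuiver DKArrow

/-! The relations and the ban on `αα⁻¹` and `α⁻¹α` force consecutive letters of a string to agree on
whether they are of the form `eᵢ` or `fᵢ⁻¹`. So every trail has, up to inversion, a representative
with all letters of this form. Once at the middle vertex, such a word returns there every second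
letter until it leaves through a fringe. Cut at these visits it becomes a word in the passages `a =
f₂⁻¹e₂` and `b = e₃f₃⁻¹`, framed for a route by an initial and a final passage; only the caps
`e₁f₁⁻¹` and `f₄⁻¹e₄` miss the middle vertex. With the order left fringe < `a` < `b` < right fringe,
a kiss is a common factor of two passage words such that one word has the larger passage on both
sides of it.

A passage word is recorded by its height function, the number of letters `b` so far. When two words
are aligned, the difference of heights changes by at most one per letter, common factors are
stretches of constant difference, and a kiss is such a stretch entered and left by a rise. A
discrete intermediate value argument (`kissFun_of_rise`) therefore produces kisses, while bounds on
the distance from a line exclude them.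

A self-compatible band is a balanced periodic word, so up to rotation its height function is
`⌈pc/n⌉` with `n = b + c` (`exists_linearB_of_windows`), and bands of different slopes kiss. A route
from the left fringe to itself is self-compatible only if its height function hugs a line of coprime
slope from above (`linearL_of_not_kissFun`), and two such routes are compatible exactly when their
indices have determinant at most 1 in absolute value (`not_kissFun_l_l`, `kissFun_l_l`). Routes
joining the two fringes are straight or kiss themselves. Routes at the right fringe are mirror
images of those at the left, and a left and a right route are compatible only if one is a cap and
the other has last index `-1`. The bending routes compatible with a band are the two of the same
slope, and these two kiss; the statements on bundles and band-stable cliques follow.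

For the fan, coordinates `(β, γ, A)` are chosen in which the left route of index `(b, c)` has
g-vector `(b, c, 1)` and its mirror image `(c, b, -1)`. Euclid's algorithm on bases of the lattice
covers everything outside the claimed complement (`mem_gFan_or_leftGap_of_basis`). Conversely, a
line through `(b₀, c₀)` with all indices of a clique on one side shows that `t(b₀, c₀)` costs total
weight at least `t` (`le_sum_of_ray`), whereas the complement asks for `A < t`; cliques using both
fringes stay in half-spaces that the complement avoids. -/

instance : Fintype DKArrow where
  elems := {e1, e2, e3, e4, f1, f2, f3, f4}
  complete x := by cases x <;> decide

instance (x y : DKArrow) : Decidable (doubleKronecker.rel x y) := by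
  cases x <;> cases y <;> first | exact isTrue trivial | exact isFalse id

instance (x y : SArrow DKArrow) : Decidable (doubleKronecker.Step x y) :=
  inferInstanceAs (Decidable (_ ∧ _ ∧ _ ∧ _))

/-! ### Orientation of strings. -/

/-- The signed arrows `eᵢ` and `fᵢ⁻¹`. -/
def Forward : SArrow DKArrow → Bool
  | (e1, s) | (e2, s) | (e3, s) | (e4, s) => s
  | (f1, s) | (f2, s) | (f3, s) | (f4, s) => !s

/-- Without change of direction the relations forbid mixing `e` and `f`; at a change of direction
the two arrows must differ, so the letter changes together with the sign. -/
theorem forward_eq_of_step : ∀ {x y : SArrow DKArrow},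
    doubleKronecker.Step x y → Forward x = Forward y := by
  decide

theorem forward_inv : ∀ x : SArrow DKArrow, Forward (x.1, !x.2) = !Forward x := by
  decide

/-- All the letters of the word are of the form `eᵢ` or `fᵢ⁻¹`. -/
def IsForward (w : List (SArrow DKArrow)) : Prop := ∀ x ∈ w, Forward x = true

theorem forward_const_of_isChain : ∀ {w : List (SArrow DKArrow)} {x : SArrow DKArrow},
    (x :: w).IsChain doubleKronecker.Step → ∀ y ∈ x :: w, Forward y = Forward x
  | [], x, _, y, hy => by simp_all
  | z :: w, x, h, y, hy => by
    rcases List.mem_cons.1 hy with rfl | hy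
    · rfl
    · rw [List.isChain_cons_cons] at h
      rw [forward_const_of_isChain h.2 y hy, forward_eq_of_step h.1]

theorem isForward_invWalk_of_not {w : List (SArrow DKArrow)}
    (h : ∀ x ∈ w, Forward x = false) : IsForward (invWalk w) := by
  intro x hx
  simp only [invWalk, List.mem_reverse, List.mem_map] at hx
  obtain ⟨y, hy, rfl⟩ := hx
  rw [forward_inv, h y hy]; rfl

theorem not_forward_of_mem_invWalk {w : List (SArrow DKArrow)} (h : IsForward w) :
    ∀ x ∈ invWalk w, Forward x = false := by
  intro x hx
  simp only [invWalk, List.mem_reverse, List.mem_map] at hx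
  obtain ⟨y, hy, rfl⟩ := hx
  rw [forward_inv, h y hy]; rfl

theorem isForward_or_invWalk {w : List (SArrow DKArrow)}
    (h : w.IsChain doubleKronecker.Step) : IsForward w ∨ IsForward (invWalk w) := by
  rcases w with _ | ⟨x, w⟩
  · left; intro x hx; simp at hx
  · cases hx : Forward x
    · right
      exact isForward_invWalk_of_not fun y hy => (forward_const_of_isChain h y hy).trans hx
    · left
      exact fun y hy => (forward_const_of_isChain h y hy).trans hx

end DoubleKronecker

namespace FringedQuiver

variable {V W E : Type} (Q : FringedQuiver V W E)

theorem step_inv {x y : SArrow E} (h : Q.Step x y) : Q.Step (y.1, !y.2) (x.1, !x.2) := by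
  obtain ⟨x, s⟩ := x
  obtain ⟨y, t⟩ := y
  obtain ⟨h1, h2, h3, h4⟩ := h
  refine ⟨?_, ?_, ?_, ?_⟩
  · cases s <;> cases t <;> simp_all [finish, start]
  · cases s <;> cases t <;> simp_all
  · cases s <;> cases t <;> simp_all
  · cases s <;> cases t <;> simp_all [eq_comm]

theorem isChain_invWalk {w : List (SArrow E)} (h : w.IsChain Q.Step) :
    (invWalk w).IsChain Q.Step := by
  rw [invWalk, List.isChain_reverse, List.isChain_map]
  exact h.imp fun _ _ => Q.step_inv

theorem infix_invWalk {u w : List (SArrow E)} (h : u <:+: w) : invWalk u <:+: invWalk w :=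
  (h.map _).reverse

theorem infix_invWalk_iff {u w : List (SArrow E)} : u <:+: invWalk w ↔ invWalk u <:+: w := by
  constructor <;> intro h <;> simpa [invWalk_invWalk] using infix_invWalk h

theorem invWalk_replicate_flatten (w : List (SArrow E)) (n : ℕ) :
    (List.replicate n (invWalk w)).flatten = invWalk (List.replicate n w).flatten := by
  induction n with
  | zero => rfl
  | succ n ih =>
    rw [List.replicate_succ, List.flatten_cons, ih, List.replicate_succ', List.flatten_append,
      invWalk_append]
    simp

/-- The words `w` and `w'` contain a common factor `σ` which is a top substring in `w` and a
bottom substring in `w'`. -/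
def WordTopBottom (w w' : List (SArrow E)) : Prop :=
  ∃ (σ : List (SArrow E)) (a b c d : E),
    (a, false) :: (σ ++ [(b, true)]) <:+: w ∧ (c, true) :: (σ ++ [(d, false)]) <:+: w' ∧
    Q.tail a = Q.head c

end FringedQuiver

/-! ### Kisses between forward words. -/

namespace DoubleKronecker

open FringedQuiver DKArrow

/-- The words representing a trail: the word itself for a route, its powers for a band. -/
def RepWords (t : doubleKronecker.Trail) (F : Set (List (SArrow DKArrow))) : Prop :=
  (∀ w ∈ F, IsForward w ∧ w.IsChain doubleKronecker.Step) ∧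
  Trail.factors doubleKronecker t = {u | ∃ w ∈ F, u <:+: w ∨ u <:+: invWalk w}

/-- A nonlazy `σ` has an orientation, so both trails are read in the same direction, and inverting
both restores the chosen words. A lazy `σ` may be read in opposite directions, but then inverting
one side only exchanges its two arrows. -/
theorem wordTopBottom_of_infix {w w' σ : List (SArrow DKArrow)} {a b c d : DKArrow}
    (hw : IsForward w ∧ w.IsChain doubleKronecker.Step)
    (hw' : IsForward w' ∧ w'.IsChain doubleKronecker.Step)
    (h1 : (a, false) :: (σ ++ [(b, true)]) <:+: w ∨ (a, false) :: (σ ++ [(b, true)]) <:+: invWalk w)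
    (h2 : (c, true) :: (σ ++ [(d, false)]) <:+: w' ∨
      (c, true) :: (σ ++ [(d, false)]) <:+: invWalk w')
    (hv : doubleKronecker.tail a = doubleKronecker.head c) :
    doubleKronecker.WordTopBottom w w' := by
  have c1 : ((a, false) :: (σ ++ [(b, true)])).IsChain doubleKronecker.Step :=
    h1.elim hw.2.infix (doubleKronecker.isChain_invWalk hw.2).infix
  have c2 : ((c, true) :: (σ ++ [(d, false)])).IsChain doubleKronecker.Step :=
    h2.elim hw'.2.infix (doubleKronecker.isChain_invWalk hw'.2).infix
  have e1 : σ = [] → doubleKronecker.tail a = doubleKronecker.tail b := by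
    rintro rfl
    simp only [List.nil_append, List.isChain_cons_cons] at c1
    simpa [start, finish] using c1.1.1
  have e2 : σ = [] → doubleKronecker.head c = doubleKronecker.head d := by
    rintro rfl
    simp only [List.nil_append, List.isChain_cons_cons] at c2
    simpa [start, finish] using c2.1.1
  rcases h1 with h1 | h1 <;> rcases h2 with h2 | h2
  · exact ⟨σ, a, b, c, d, h1, h2, hv⟩
  -- A letter of `σ` would be forward because of `w` and not forward because of `invWalk w'`.
  · have : σ = [] := by
      rcases σ with _ | ⟨x, σ⟩
      · rfl
      · have p := hw.1 x (h1.subset (by simp))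
        have q := not_forward_of_mem_invWalk hw'.1 x (h2.subset (by simp))
        simp [p] at q
    refine ⟨[], a, b, d, c, by simpa [this] using h1, ?_, hv.trans (e2 this)⟩
    rw [infix_invWalk_iff] at h2
    simpa [this, invWalk] using h2
  · have : σ = [] := by
      rcases σ with _ | ⟨x, σ⟩
      · rfl
      · have p := hw'.1 x (h2.subset (by simp))
        have q := not_forward_of_mem_invWalk hw.1 x (h1.subset (by simp))
        simp [p] at q
    refine ⟨[], b, a, c, d, ?_, by simpa [this] using h2, (e1 this).symm.trans hv⟩
    rw [infix_invWalk_iff] at h1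
    simpa [this, invWalk] using h1
  · rw [infix_invWalk_iff] at h1 h2
    refine ⟨invWalk σ, b, a, d, c, by simpa [invWalk] using h1, by simpa [invWalk] using h2, ?_⟩
    rcases List.eq_nil_or_concat σ with h | ⟨τ, z, rfl⟩
    · exact ((e1 h).symm.trans hv).trans (e2 h)
    · rw [List.concat_eq_append] at c1 c2
      have s1 : doubleKronecker.Step z (b, true) := by
        have : ([z, (b, true)] : List (SArrow DKArrow)).IsChain doubleKronecker.Step :=
          c1.infix ⟨(a, false) :: τ, [], by simp⟩
        simpa using this
      have s2 : doubleKronecker.Step z (d, false) := by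
        have : ([z, (d, false)] : List (SArrow DKArrow)).IsChain doubleKronecker.Step :=
          c2.infix ⟨(c, true) :: τ, [], by simp⟩
        simpa using this
      have := s1.1.symm.trans s2.1
      simpa [start] using this

theorem topBottom_iff {s t : doubleKronecker.Trail} {F G : Set (List (SArrow DKArrow))}
    (hs : RepWords s F) (ht : RepWords t G) :
    doubleKronecker.TopBottom s t ↔ ∃ w ∈ F, ∃ w' ∈ G, doubleKronecker.WordTopBottom w w' := by
  constructor
  · rintro ⟨σ, a, b, c, d, h1, h2, hv⟩
    rw [hs.2] at h1
    rw [ht.2] at h2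
    obtain ⟨w, hw, h1⟩ := h1
    obtain ⟨w', hw', h2⟩ := h2
    exact ⟨w, hw, w', hw', wordTopBottom_of_infix (hs.1 w hw) (ht.1 w' hw') h1 h2 hv⟩
  · rintro ⟨w, hw, w', hw', σ, a, b, c, d, h1, h2, hv⟩
    refine ⟨σ, a, b, c, d, ?_, ?_, hv⟩
    · rw [hs.2]; exact ⟨w, hw, Or.inl h1⟩
    · rw [ht.2]; exact ⟨w', hw', Or.inl h2⟩

theorem repWords_route (w : doubleKronecker.RouteWord) (hw : IsForward w.1) :
    RepWords (.route ⟦w⟧) {w.1} := by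
  refine ⟨?_, ?_⟩
  · rintro _ rfl
    exact ⟨hw, w.2.1.2⟩
  · show routeFactors w.1 = _
    ext u
    simp [routeFactors]

theorem isChain_replicate_flatten {w : List (SArrow DKArrow)}
    (h : (w ++ w).IsChain doubleKronecker.Step) (n : ℕ) :
    (List.replicate n w).flatten.IsChain doubleKronecker.Step := by
  induction n with
  | zero => simp
  | succ n ih =>
    rw [List.replicate_succ, List.flatten_cons]
    rw [List.isChain_append] at h ⊢
    refine ⟨h.1, ih, ?_⟩
    intro x hx y hy
    refine h.2.2 x hx y ?_
    rcases n with _ | n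
    · simp at hy
    · rw [List.replicate_succ, List.flatten_cons] at hy
      rcases w with _ | ⟨z, w⟩
      · simp at hx
      · simpa using hy

theorem repWords_band (w : doubleKronecker.BandWord) (hw : IsForward w.1) :
    RepWords (.band ⟦w⟧) {v | ∃ n : ℕ, v = (List.replicate n w.1).flatten} := by
  refine ⟨?_, ?_⟩
  · rintro _ ⟨n, rfl⟩
    refine ⟨?_, isChain_replicate_flatten w.2.2.1.2 n⟩
    intro x hx
    simp only [List.mem_flatten, List.mem_replicate] at hx
    obtain ⟨_, ⟨_, rfl⟩, hx⟩ := hx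
    exact hw x hx
  · show bandFactors w.1 = _
    ext u
    simp only [bandFactors, invWalk_replicate_flatten]
    simp

/-- Trades the common factor for its two positions and its length, so that passing between arrows
and passages becomes arithmetic of indices. -/
theorem exists_common_factor_iff {α : Type} {w w' : List α} {x y x' y' : α} :
    (∃ σ, x :: (σ ++ [y]) <:+: w ∧ x' :: (σ ++ [y']) <:+: w') ↔
    ∃ i j m, w[i]? = some x ∧ w[i + m + 1]? = some y ∧ w'[j]? = some x' ∧
      w'[j + m + 1]? = some y' ∧ ∀ k < m, w[i + 1 + k]? = w'[j + 1 + k]? := by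
  have key : ∀ (σ : List α) (w : List α) (x y : α), x :: (σ ++ [y]) <:+: w ↔
      ∃ i, w[i]? = some x ∧ w[i + σ.length + 1]? = some y ∧
        ∀ k (h : k < σ.length), w[i + 1 + k]? = some σ[k] := by
    intro σ w x y
    rw [List.infix_iff_getElem?]
    constructor
    · rintro ⟨i, hi, h⟩
      simp only [List.length_cons, List.length_append, List.length_nil] at hi h
      refine ⟨i, ?_, ?_, ?_⟩
      · simpa using h 0 (by omega)
      · have := h (σ.length + 1) (by omega)
        rw [show i + σ.length + 1 = σ.length + 1 + i by omega]
        simpa using this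
      · intro k hk
        have := h (k + 1) (by omega)
        rw [show i + 1 + k = k + 1 + i by omega]
        simpa [List.getElem_append, hk] using this
    · rintro ⟨i, h1, h2, h3⟩
      have := (List.getElem?_eq_some_iff.1 h2).1
      refine ⟨i, by simp; omega, ?_⟩
      rintro (_ | k) hk
      · simpa using h1
      · simp only [List.length_cons, List.length_append, List.length_nil] at hk
        rw [show k + 1 + i = i + 1 + k by omega]
        by_cases hk' : k < σ.length
        · simpa [List.getElem_append, hk'] using h3 k hk'
        · obtain rfl : k = σ.length := by omega
          rw [show i + 1 + σ.length = i + σ.length + 1 by omega]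
          simpa using h2
  constructor
  · rintro ⟨σ, h1, h2⟩
    obtain ⟨i, a1, a2, a3⟩ := (key _ _ _ _).1 h1
    obtain ⟨j, b1, b2, b3⟩ := (key _ _ _ _).1 h2
    exact ⟨i, j, σ.length, a1, a2, b1, b2, fun k hk => (a3 k hk).trans (b3 k hk).symm⟩
  · rintro ⟨i, j, m, a1, a2, b1, b2, h⟩
    have hl := (List.getElem?_eq_some_iff.1 a2).1
    have e : ((w.drop (i + 1)).take m).length = m := by simp; omega
    have e' : ∀ k (h : k < ((w.drop (i + 1)).take m).length),
        w[i + 1 + k]? = some ((w.drop (i + 1)).take m)[k] := by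
      intro k hk
      have : i + 1 + k < w.length := by omega
      simp [this]
    refine ⟨(w.drop (i + 1)).take m, (key _ _ _ _).2 ⟨i, a1, by rw [e]; exact a2, e'⟩,
      (key _ _ _ _).2 ⟨j, b1, by rw [e]; exact b2, ?_⟩⟩
    intro k hk
    rw [← h k (by omega)]
    exact e' k hk

/-! ### Passages and their kisses. -/

/-- The passages of a trail between consecutive visits of the middle vertex: two passages `a` and
`b` that return to the middle vertex, two initial and two final ones. -/
inductive Letter
  | startL | startR | a | b | endL | endR
  deriving DecidableEq

namespace Letter

instance : Fintype Letter where
  elems := {startL, startR, a, b, endL, endR}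
  complete x := by cases x <;> decide

/-- The first signed arrow of a passage. -/
def fst : Letter → SArrow DKArrow
  | startL => (e1, true)
  | startR => (f4, false)
  | a => (f2, false)
  | b => (e3, true)
  | endL => (f2, false)
  | endR => (e3, true)

/-- The second signed arrow of a passage. -/
def snd : Letter → SArrow DKArrow
  | startL => (e2, true)
  | startR => (f3, false)
  | a => (e2, true)
  | b => (f3, false)
  | endL => (f1, false)
  | endR => (e4, true)

/-- The order of the passages: from the left fringe, `a`, `b`, from the right fringe. -/
def val : Letter → ℤ
  | startL | endL => 0
  | a => 1
  | b => 2
  | startR | endR => 3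

/-- The initial passages. -/
def isStart : Letter → Bool
  | startL | startR => true
  | _ => false

/-- The final passages. -/
def isEnd : Letter → Bool
  | endL | endR => true
  | _ => false

end Letter

/-- The word of signed arrows spelled by a list of passages. -/
def spell (C : List Letter) : List (SArrow DKArrow) := C.flatMap fun x => [x.fst, x.snd]

theorem spell_append (C D : List Letter) : spell (C ++ D) = spell C ++ spell D := by
  simp [spell]

theorem spell_getElem?_even : ∀ (C : List Letter) (q : ℕ),
    (spell C)[2 * q]? = C[q]?.map Letter.fst
  | [], q => by simp [spell]
  | x :: C, 0 => by simp [spell]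
  | x :: C, q + 1 => by
    have := spell_getElem?_even C q
    rw [show spell (x :: C) = x.fst :: x.snd :: spell C from rfl,
      show 2 * (q + 1) = 2 * q + 1 + 1 by ring]
    simpa using this

theorem spell_getElem?_odd : ∀ (C : List Letter) (q : ℕ),
    (spell C)[2 * q + 1]? = C[q]?.map Letter.snd
  | [], q => by simp [spell]
  | x :: C, 0 => by simp [spell]
  | x :: C, q + 1 => by
    have := spell_getElem?_odd C q
    rw [show spell (x :: C) = x.fst :: x.snd :: spell C from rfl,
      show 2 * (q + 1) + 1 = 2 * q + 1 + 1 + 1 by ring]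
    simpa using this

/-- Initial passages occur only at the start of the list, final ones only at the end. -/
def WellPlaced (C : List Letter) : Prop :=
  ∀ q x, C[q]? = some x → (x.isStart = true → q = 0) ∧ (x.isEnd = true → q + 1 = C.length)

/-- `C` runs above `C'` just before and just after some common part. -/
def Kiss (C C' : List Letter) : Prop :=
  ∃ (i j m : ℕ) (x y x' y' : Letter), C[i]? = some x ∧ C[i + m + 1]? = some y ∧
    C'[j]? = some x' ∧ C'[j + m + 1]? = some y' ∧ (∀ k < m, C[i + 1 + k]? = C'[j + 1 + k]?) ∧
    x'.val < x.val ∧ y'.val < y.val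

theorem Letter.eq_of_halves : ∀ {x y : Option Letter}, x.map Letter.fst = y.map Letter.fst →
    x.map Letter.snd = y.map Letter.snd → x = y := by
  decide

/-- This finite check and the next ones are the dictionary between the signs of the arrows bounding
a common factor and the order of the passages containing them. A bounding arrow is either the outer
half of a passage whose other half belongs to the factor, or the half adjacent to a visit of the
middle vertex. -/
theorem Letter.val_lt_of_snd : ∀ {x y : Letter}, x.isEnd = false → y.isEnd = false →
    x.snd.2 = false → y.snd.2 = true → y.val < x.val := by
  decide

theorem Letter.val_lt_of_fst : ∀ {x y : Letter}, x.isEnd = false → y.isEnd = false →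
    x.fst.2 = false → y.fst.2 = true →
    doubleKronecker.tail x.fst.1 = doubleKronecker.head y.fst.1 → x.snd = y.snd →
    y.val < x.val := by
  decide

/-- In the interior of a passage only `a` has a top and only `b` has a bottom, at different
vertices; hence no lazy kiss occurs there. -/
theorem Letter.no_kiss_at_odd : ∀ {x y : Letter}, x.fst.2 = false → y.fst.2 = true →
    doubleKronecker.tail x.fst.1 = doubleKronecker.head y.fst.1 → x.snd.2 = true →
    y.snd.2 = false → False := by
  decide

theorem Letter.parity_fst_snd : ∀ {x y : Letter}, x.fst.2 = false → y.snd.2 = true →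
    doubleKronecker.tail x.fst.1 ≠ doubleKronecker.head y.snd.1 := by
  decide

theorem Letter.parity_snd_fst : ∀ {x y : Letter}, x.snd.2 = false → y.fst.2 = true →
    doubleKronecker.tail x.snd.1 ≠ doubleKronecker.head y.fst.1 := by
  decide

theorem Letter.val_lt_of_fst' : ∀ {x y : Letter}, x.isStart = false → y.isStart = false →
    x.fst.2 = true → y.fst.2 = false → y.val < x.val := by
  decide

theorem Letter.val_lt_of_snd' : ∀ {x y : Letter}, x.isStart = false → y.isStart = false →
    x.snd.2 = true → y.snd.2 = false → x.fst = y.fst → y.val < x.val := by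
  decide

theorem Letter.left_of_val_lt : ∀ {x y : Letter}, x.isEnd = false → y.isEnd = false →
    y.val < x.val →
    (x.snd.2 = false ∧ y.snd.2 = true ∧
      doubleKronecker.tail x.snd.1 = doubleKronecker.head y.snd.1) ∨
    (x.fst.2 = false ∧ y.fst.2 = true ∧
      doubleKronecker.tail x.fst.1 = doubleKronecker.head y.fst.1 ∧ x.snd = y.snd) := by
  decide

theorem Letter.right_of_val_lt : ∀ {x y : Letter}, x.isStart = false → y.isStart = false →
    y.val < x.val →
    (x.fst.2 = true ∧ y.fst.2 = false) ∨ (x.snd.2 = true ∧ y.snd.2 = false ∧ x.fst = y.fst) := by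
  decide

theorem WellPlaced.isEnd_eq_false {C : List Letter} (h : WellPlaced C) {q r : ℕ} {x y : Letter}
    (hx : C[q]? = some x) (hy : C[r]? = some y) (hqr : q < r) : x.isEnd = false := by
  by_contra hc
  have := (h q x hx).2 (by simpa using hc)
  have := (List.getElem?_eq_some_iff.1 hy).1
  omega

theorem WellPlaced.isStart_eq_false {C : List Letter} (h : WellPlaced C) {q : ℕ} {x : Letter}
    (hx : C[q]? = some x) (hq : 0 < q) : x.isStart = false := by
  by_contra hc
  have := (h q x hx).1 (by simpa using hc)
  omega

/-- The two bounding arrows on each side sit at positions of equal parity, since halves of different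
kind meet the factor at different vertices. Each is then replaced by its passage, and the passages
strictly between agree. -/
theorem kiss_of_wordTopBottom {C C' : List Letter} (hC : WellPlaced C) (hC' : WellPlaced C')
    (h : doubleKronecker.WordTopBottom (spell C) (spell C')) : Kiss C C' := by
  obtain ⟨σ, a, b, c, d, h1, h2, hv⟩ := h
  obtain ⟨i, j, m, a1, a2, b1, b2, hm⟩ := exists_common_factor_iff.1 ⟨σ, h1, h2⟩
  clear h1 h2
  -- The comparison of values is stated conditionally: that `x` and `x'` are not final passages is
  -- known only once a later passage has been found.
  have left : ∃ q q' x x', C[q]? = some x ∧ C'[q']? = some x' ∧ ((i = 2 * q ∧ j = 2 * q' ∧ m ≠ 0) ∨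
      (i = 2 * q + 1 ∧ j = 2 * q' + 1)) ∧
      (x.isEnd = false → x'.isEnd = false → x'.val < x.val) := by
    rcases Nat.even_or_odd' i with ⟨q, rfl | rfl⟩ <;> rcases Nat.even_or_odd' j with ⟨q', rfl | rfl⟩
    all_goals
      simp only [spell_getElem?_even, spell_getElem?_odd, Option.map_eq_some_iff] at a1 b1
      obtain ⟨x, hx, ex⟩ := a1
      obtain ⟨x', hx', ex'⟩ := b1
    · rcases Nat.eq_zero_or_pos m with rfl | hm0
      · rw [add_zero, spell_getElem?_odd, hx] at a2
        rw [add_zero, spell_getElem?_odd, hx'] at b2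
        simp only [Option.map_some, Option.some.injEq] at a2 b2
        exact (Letter.no_kiss_at_odd (x := x) (y := x') (by rw [ex]) (by rw [ex'])
          (by rw [ex, ex']; exact hv) (by rw [a2]) (by rw [b2])).elim
      · refine ⟨q, q', x, x', hx, hx', Or.inl ⟨rfl, rfl, hm0.ne'⟩, fun hE hE' => ?_⟩
        have := hm 0 hm0
        rw [add_zero, add_zero, spell_getElem?_odd, spell_getElem?_odd, hx, hx'] at this
        exact Letter.val_lt_of_fst hE hE' (by rw [ex]) (by rw [ex']) (by rw [ex, ex']; exact hv)
          (by simpa using this)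
    · exact (Letter.parity_fst_snd (x := x) (y := x') (by rw [ex]) (by rw [ex'])
        (by rw [ex, ex']; exact hv)).elim
    · exact (Letter.parity_snd_fst (x := x) (y := x') (by rw [ex]) (by rw [ex'])
        (by rw [ex, ex']; exact hv)).elim
    · exact ⟨q, q', x, x', hx, hx', Or.inr ⟨rfl, rfl⟩, fun hE hE' =>
        Letter.val_lt_of_snd hE hE' (by rw [ex]) (by rw [ex'])⟩
  obtain ⟨q, q', x, x', hx, hx', hij, hval⟩ := left
  have right : ∃ r r' y y', C[r]? = some y ∧ C'[r']? = some y' ∧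
      ((i + m + 1 = 2 * r ∧ j + m + 1 = 2 * r') ∨ (i + m + 1 = 2 * r + 1 ∧ j + m + 1 = 2 * r' + 1)) ∧
      (y.isStart = false → y'.isStart = false → y'.val < y.val) := by
    rcases Nat.even_or_odd' (i + m + 1) with ⟨r, hr | hr⟩ <;>
      rcases Nat.even_or_odd' (j + m + 1) with ⟨r', hr' | hr'⟩
    · rw [hr, spell_getElem?_even, Option.map_eq_some_iff] at a2
      rw [hr', spell_getElem?_even, Option.map_eq_some_iff] at b2
      obtain ⟨y, hy, ey⟩ := a2
      obtain ⟨y', hy', ey'⟩ := b2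
      exact ⟨r, r', y, y', hy, hy', Or.inl ⟨hr, hr'⟩, fun hE hE' =>
        Letter.val_lt_of_fst' hE hE' (by rw [ey]) (by rw [ey'])⟩
    · omega
    · omega
    · rw [hr, spell_getElem?_odd, Option.map_eq_some_iff] at a2
      rw [hr', spell_getElem?_odd, Option.map_eq_some_iff] at b2
      obtain ⟨y, hy, ey⟩ := a2
      obtain ⟨y', hy', ey'⟩ := b2
      refine ⟨r, r', y, y', hy, hy', Or.inr ⟨hr, hr'⟩, fun hE hE' =>
        Letter.val_lt_of_snd' hE hE' (by rw [ey]) (by rw [ey']) ?_⟩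
      have := hm (m - 1) (by omega)
      rw [show i + 1 + (m - 1) = 2 * r by omega, show j + 1 + (m - 1) = 2 * r' by omega,
        spell_getElem?_even, spell_getElem?_even, hy, hy'] at this
      simpa using this
  obtain ⟨r, r', y, y', hy, hy', hrr, hval'⟩ := right
  refine ⟨q, q', r - q - 1, x, y, x', y', hx, ?_, hx', ?_, ?_, ?_, ?_⟩
  · rw [show q + (r - q - 1) + 1 = r by omega]; exact hy
  · rw [show q' + (r - q - 1) + 1 = r' by omega]; exact hy'
  · intro k hk
    refine Letter.eq_of_halves ?_ ?_
    · rw [← spell_getElem?_even, ← spell_getElem?_even]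
      have := hm (2 * (q + 1 + k) - (i + 1)) (by omega)
      rwa [show i + 1 + (2 * (q + 1 + k) - (i + 1)) = 2 * (q + 1 + k) by omega,
        show j + 1 + (2 * (q + 1 + k) - (i + 1)) = 2 * (q' + 1 + k) by omega] at this
    · rw [← spell_getElem?_odd, ← spell_getElem?_odd]
      have := hm (2 * (q + 1 + k) + 1 - (i + 1)) (by omega)
      rwa [show i + 1 + (2 * (q + 1 + k) + 1 - (i + 1)) = 2 * (q + 1 + k) + 1 by omega,
        show j + 1 + (2 * (q + 1 + k) + 1 - (i + 1)) = 2 * (q' + 1 + k) + 1 by omega] at this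
  · exact hval (hC.isEnd_eq_false hx hy (by omega)) (hC'.isEnd_eq_false hx' hy' (by omega))
  · exact hval' (hC.isStart_eq_false hy (by omega)) (hC'.isStart_eq_false hy' (by omega))

theorem wordTopBottom_of_kiss {C C' : List Letter} (hC : WellPlaced C) (hC' : WellPlaced C')
    (h : Kiss C C') : doubleKronecker.WordTopBottom (spell C) (spell C') := by
  obtain ⟨q, q', m, x, y, x', y', hx, hy, hx', hy', hm, hl, hr⟩ := h
  have left : ∃ (i j : ℕ) (a c : DKArrow), (spell C)[i]? = some (a, false) ∧
      (spell C')[j]? = some (c, true) ∧ doubleKronecker.tail a = doubleKronecker.head c ∧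
      ((i = 2 * q + 1 ∧ j = 2 * q' + 1) ∨ (i = 2 * q ∧ j = 2 * q' ∧ x.snd = x'.snd)) := by
    rcases Letter.left_of_val_lt (hC.isEnd_eq_false hx hy (by omega))
      (hC'.isEnd_eq_false hx' hy' (by omega)) hl with ⟨h1, h2, h3⟩ | ⟨h1, h2, h3, h4⟩
    · refine ⟨2 * q + 1, 2 * q' + 1, x.snd.1, x'.snd.1, ?_, ?_, h3, Or.inl ⟨rfl, rfl⟩⟩
      · rw [spell_getElem?_odd, hx, ← h1]; rfl
      · rw [spell_getElem?_odd, hx', ← h2]; rfl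
    · refine ⟨2 * q, 2 * q', x.fst.1, x'.fst.1, ?_, ?_, h3, Or.inr ⟨rfl, rfl, h4⟩⟩
      · rw [spell_getElem?_even, hx, ← h1]; rfl
      · rw [spell_getElem?_even, hx', ← h2]; rfl
  have right : ∃ (i j : ℕ) (b d : DKArrow), (spell C)[i]? = some (b, true) ∧
      (spell C')[j]? = some (d, false) ∧
      ((i = 2 * (q + m + 1) ∧ j = 2 * (q' + m + 1)) ∨
        (i = 2 * (q + m + 1) + 1 ∧ j = 2 * (q' + m + 1) + 1 ∧ y.fst = y'.fst)) := by
    rcases Letter.right_of_val_lt (hC.isStart_eq_false hy (by omega))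
      (hC'.isStart_eq_false hy' (by omega)) hr with ⟨h1, h2⟩ | ⟨h1, h2, h4⟩
    · refine ⟨2 * (q + m + 1), 2 * (q' + m + 1), y.fst.1, y'.fst.1, ?_, ?_, Or.inl ⟨rfl, rfl⟩⟩
      · rw [spell_getElem?_even, hy, ← h1]; rfl
      · rw [spell_getElem?_even, hy', ← h2]; rfl
    · refine ⟨2 * (q + m + 1) + 1, 2 * (q' + m + 1) + 1, y.snd.1, y'.snd.1, ?_, ?_,
        Or.inr ⟨rfl, rfl, h4⟩⟩
      · rw [spell_getElem?_odd, hy, ← h1]; rfl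
      · rw [spell_getElem?_odd, hy', ← h2]; rfl
  obtain ⟨i, j, a, c, ha, hc, hv, hij⟩ := left
  obtain ⟨i', j', b, d, hb, hd, hij'⟩ := right
  have : ∃ σ, (a, false) :: (σ ++ [(b, true)]) <:+: spell C ∧
      (c, true) :: (σ ++ [(d, false)]) <:+: spell C' := by
    refine exists_common_factor_iff.2 ⟨i, j, i' - i - 1, ha, ?_, hc, ?_, ?_⟩
    · rwa [show i + (i' - i - 1) + 1 = i' by omega]
    · rwa [show j + (i' - i - 1) + 1 = j' by omega]
    · intro k hk
      have hpar : ∃ s ρ, ρ < 2 ∧ i + 1 + k = 2 * s + ρ :=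
        ⟨(i + 1 + k) / 2, (i + 1 + k) % 2, Nat.mod_lt _ (by norm_num),
          (Nat.div_add_mod _ 2).symm⟩
      obtain ⟨s, ρ, hρ, hs⟩ := hpar
      rw [hs, show j + 1 + k = 2 * (s + q' - q) + ρ by omega]
      -- Of the two boundary passages at most the inner half belongs to the factor, and there the
      -- halves agree by `hij` and `hij'`; the passages in between agree by `hm`.
      by_cases h1 : s = q
      · obtain rfl : ρ = 1 := by omega
        rw [h1, show q + q' - q = q' by omega, spell_getElem?_odd, spell_getElem?_odd, hx, hx']
        rcases hij with hij | hij
        · omega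
        · simp [hij.2.2]
      · by_cases h2 : s = q + m + 1
        · obtain rfl : ρ = 0 := by omega
          rw [h2, show q + m + 1 + q' - q = q' + m + 1 by omega, add_zero, add_zero,
            spell_getElem?_even, spell_getElem?_even, hy, hy']
          rcases hij' with hij' | hij'
          · omega
          · simp [hij'.2.2]
        · have := hm (s - q - 1) (by omega)
          rw [show q + 1 + (s - q - 1) = s by omega,
            show q' + 1 + (s - q - 1) = s + q' - q by omega] at this
          obtain rfl | rfl : ρ = 0 ∨ ρ = 1 := by omega
          · rw [add_zero, add_zero, spell_getElem?_even, spell_getElem?_even, this]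
          · rw [spell_getElem?_odd, spell_getElem?_odd, this]
  obtain ⟨σ, h1, h2⟩ := this
  exact ⟨σ, a, b, c, d, h1, h2, hv⟩

theorem wordTopBottom_spell_iff {C C' : List Letter} (hC : WellPlaced C) (hC' : WellPlaced C') :
    doubleKronecker.WordTopBottom (spell C) (spell C') ↔ Kiss C C' :=
  ⟨kiss_of_wordTopBottom hC hC', wordTopBottom_of_kiss hC hC'⟩

/-! ### Routes and bands spelled by passages. -/

/-- The passages `b` and `a`. -/
def ab (x : Bool) : Letter := if x then .b else .a

/-- The word spelled by a list of returning passages. -/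
def word (u : List Bool) : List (SArrow DKArrow) := spell (u.map ab)

/-- The passages of a route with initial and final passages given by `x` and `y`. -/
def routeCode (x y : Bool) (u : List Bool) : List Letter :=
  (if x then Letter.startR else .startL) :: (u.map ab ++ [if y then Letter.endR else .endL])

theorem word_append (u v : List Bool) : word (u ++ v) = word u ++ word v := by
  simp [word, spell_append]

theorem word_cons (x : Bool) (u : List Bool) :
    word (x :: u) = [(ab x).fst, (ab x).snd] ++ word u := by
  simp [word, spell]

theorem word_length (u : List Bool) : (word u).length = 2 * u.length := by
  induction u with
  | nil => rfl
  | cons x u ih => rw [word_cons, List.length_append, ih]; simp; ring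

theorem word_replicate (u : List Bool) (n : ℕ) :
    word (List.replicate n u).flatten = (List.replicate n (word u)).flatten := by
  induction n with
  | zero => rfl
  | succ n ih => rw [List.replicate_succ, List.flatten_cons, word_append, ih]; simp [List.replicate_succ]

theorem spell_routeCode (x y : Bool) (u : List Bool) :
    spell (routeCode x y u) =
      (if x then [(f4, false), (f3, false)] else [(e1, true), (e2, true)]) ++ word u ++
      (if y then [(e3, true), (e4, true)] else [(f2, false), (f1, false)]) := by
  rw [routeCode, ← List.singleton_append, spell_append, spell_append, List.append_assoc]
  cases x <;> cases y <;> rfl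

theorem step_fst_snd : ∀ x : Letter, doubleKronecker.Step x.fst x.snd := by decide

theorem step_snd_fst : ∀ {x y : Letter}, x.isEnd = false → y.isStart = false →
    doubleKronecker.Step x.snd y.fst := by decide

theorem forward_fst : ∀ x : Letter, Forward x.fst = true := by decide

theorem forward_snd : ∀ x : Letter, Forward x.snd = true := by decide

theorem isForward_spell (C : List Letter) : IsForward (spell C) := by
  intro x hx
  simp only [spell, List.mem_flatMap, List.mem_cons, List.not_mem_nil, or_false] at hx
  obtain ⟨y, _, rfl | rfl⟩ := hx
  · exact forward_fst y
  · exact forward_snd y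

theorem isChain_spell : ∀ {C : List Letter},
    C.IsChain (fun x y => x.isEnd = false ∧ y.isStart = false) →
    (spell C).IsChain doubleKronecker.Step
  | [], _ => by simp [spell]
  | [x], _ => by simpa [spell] using step_fst_snd x
  | x :: y :: C, h => by
    have ih := isChain_spell (List.isChain_cons_cons.1 h).2
    have hxy := (List.isChain_cons_cons.1 h).1
    show (x.fst :: x.snd :: y.fst :: y.snd :: spell C).IsChain doubleKronecker.Step
    rw [List.isChain_cons_cons, List.isChain_cons_cons]
    exact ⟨step_fst_snd x, step_snd_fst hxy.1 hxy.2, ih⟩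

theorem isEnd_ab (x : Bool) : (ab x).isEnd = false := by cases x <;> rfl

theorem isStart_ab (x : Bool) : (ab x).isStart = false := by cases x <;> rfl

theorem isChain_map_ab (u : List Bool) :
    (u.map ab).IsChain (fun x y => x.isEnd = false ∧ y.isStart = false) := by
  rw [List.isChain_map]
  exact List.isChain_of_isChain_map (S := fun _ _ => True) (fun _ => ())
    (fun x y _ => ⟨isEnd_ab x, isStart_ab y⟩) (by
      rw [List.isChain_map]
      induction u with
      | nil => simp
      | cons x u ih => cases u <;> simp_all)

theorem isChain_routeCode (x y : Bool) (u : List Bool) :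
    (routeCode x y u).IsChain (fun x y => x.isEnd = false ∧ y.isStart = false) := by
  rw [routeCode, List.isChain_cons, List.isChain_append]
  refine ⟨?_, isChain_map_ab u, by simp, ?_⟩
  · intro z hz
    refine ⟨by cases x <;> rfl, ?_⟩
    rcases u with _ | ⟨t, u⟩
    · simp at hz; subst hz; cases y <;> rfl
    · simp at hz; subst hz; exact isStart_ab t
  · intro z hz t ht
    simp at ht
    subst ht
    refine ⟨?_, by cases y <;> rfl⟩
    have := List.mem_of_mem_getLast? hz
    simp only [List.mem_map] at this
    obtain ⟨s, _, rfl⟩ := this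
    exact isEnd_ab s

theorem isRoute_of_ends {x y : SArrow DKArrow} {w v : List (SArrow DKArrow)}
    (hw : w.IsChain doubleKronecker.Step) (h1 : ∃ t, w = x :: t) (h2 : w = v ++ [y])
    (hx : ∀ z, ¬ doubleKronecker.Step z x) (hy : ∀ z, ¬ doubleKronecker.Step y z) :
    doubleKronecker.IsRoute w := by
  obtain ⟨t, rfl⟩ := h1
  refine ⟨⟨by simp, hw⟩, fun z => ⟨fun h => ?_, fun h => ?_⟩⟩
  · exact hx z (List.isChain_cons_cons.1 h.2).1
  · rw [h2] at h
    have : ([y, z] : List (SArrow DKArrow)).IsChain doubleKronecker.Step :=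
      h.2.infix ⟨v, [], by simp⟩
    exact hy z (by simpa using this)

theorem isRoute_spell (x y : Bool) (u : List Bool) :
    doubleKronecker.IsRoute (spell (routeCode x y u)) := by
  have hc := isChain_spell (isChain_routeCode x y u)
  rw [spell_routeCode] at hc ⊢
  cases x <;> cases y
  · exact isRoute_of_ends (x := (e1, true)) (y := (f1, false))
      (v := [(e1, true), (e2, true)] ++ word u ++ [(f2, false)]) hc ⟨_, rfl⟩ (by simp)
      (by decide) (by decide)
  · exact isRoute_of_ends (x := (e1, true)) (y := (e4, true))
      (v := [(e1, true), (e2, true)] ++ word u ++ [(e3, true)]) hc ⟨_, rfl⟩ (by simp)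
      (by decide) (by decide)
  · exact isRoute_of_ends (x := (f4, false)) (y := (f1, false))
      (v := [(f4, false), (f3, false)] ++ word u ++ [(f2, false)]) hc ⟨_, rfl⟩ (by simp)
      (by decide) (by decide)
  · exact isRoute_of_ends (x := (f4, false)) (y := (e4, true))
      (v := [(f4, false), (f3, false)] ++ word u ++ [(e3, true)]) hc ⟨_, rfl⟩ (by simp)
      (by decide) (by decide)

/-- The route with given initial, final and returning passages. -/
def route (x y : Bool) (u : List Bool) : doubleKronecker.Route :=
  ⟦⟨spell (routeCode x y u), isRoute_spell x y u⟩⟧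

theorem isRoute_capL : doubleKronecker.IsRoute [(e1, true), (f1, false)] :=
  isRoute_of_ends (x := (e1, true)) (y := (f1, false)) (v := [(e1, true)]) (by decide)
    ⟨_, rfl⟩ rfl (by decide) (by decide)

theorem isRoute_capR : doubleKronecker.IsRoute [(f4, false), (e4, true)] :=
  isRoute_of_ends (x := (f4, false)) (y := (e4, true)) (v := [(f4, false)]) (by decide)
    ⟨_, rfl⟩ rfl (by decide) (by decide)

/-- The route `e₁f₁⁻¹`. -/
def capL : doubleKronecker.Route := ⟦⟨[(e1, true), (f1, false)], isRoute_capL⟩⟧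

/-- The route `f₄⁻¹e₄`. -/
def capR : doubleKronecker.Route := ⟦⟨[(f4, false), (e4, true)], isRoute_capR⟩⟧

theorem arrowCount_append (u v : List (SArrow DKArrow)) :
    arrowCount (u ++ v) = arrowCount u + arrowCount v := by
  funext α; simp [arrowCount]

theorem arrowCount_replicate (u : List (SArrow DKArrow)) (n : ℕ) :
    arrowCount (List.replicate n u).flatten = n • arrowCount u := by
  induction n with
  | zero => funext α; simp [arrowCount]
  | succ n ih =>
    rw [List.replicate_succ, List.flatten_cons, arrowCount_append, ih, succ_nsmul, add_comm]

theorem arrowCount_word (u : List Bool) :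
    arrowCount (word u) = doubleKronecker.flow 0 (u.count false) (u.count true) 0 := by
  induction u with
  | nil => funext α; cases α <;> rfl
  | cons x u ih =>
    rw [word_cons, arrowCount_append, ih]
    funext α
    cases x <;> cases α <;> simp [arrowCount, doubleKronecker.flow, ab, Letter.fst, Letter.snd] <;>
      ring

/-- The arrow counts of an `n`-th power are multiples of `n`, so coprime counts exclude proper
powers. -/
theorem isBand_word {u : List Bool} (hu : Nat.Coprime (u.count false) (u.count true)) :
    doubleKronecker.IsBand (word u) := by
  have hne : u ≠ [] := by rintro rfl; simp at hu
  have hc : ∀ v, (word v).IsChain doubleKronecker.Step := fun v => isChain_spell (isChain_map_ab v)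
  have hw : word u ≠ [] := by
    rw [← List.length_pos_iff, word_length]
    have := List.length_pos_iff.2 hne
    omega
  refine ⟨⟨hw, hc u⟩, ⟨by simp [hw], by rw [← word_append]; exact hc _⟩, ?_⟩
  intro v n hn h
  have h1 := arrowCount_word u
  rw [h, arrowCount_replicate] at h1
  have h2 := congrFun h1 e2
  have h3 := congrFun h1 e3
  simp only [Pi.smul_apply, doubleKronecker.flow, arrowCount, nsmul_eq_mul] at h2 h3
  norm_cast at h2 h3
  have := Nat.dvd_gcd (Dvd.intro _ h2) (Dvd.intro _ h3)
  rw [hu] at this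
  have := Nat.le_of_dvd one_pos this
  omega

/-! ### Every trail is spelled by passages, up to the two caps. -/

theorem next_of_middle : ∀ {p x : SArrow DKArrow}, doubleKronecker.Step p x → Forward p = true →
    doubleKronecker.finish p = .inl 1 → x = (e3, true) ∨ x = (f2, false) := by
  have : ∀ p : SArrow DKArrow, Forward p = true → doubleKronecker.finish p = .inl 1 →
      p = (e2, true) ∨ p = (f3, false) := by
    decide
  rintro p x h h1 h2
  rcases this p h1 h2 with rfl | rfl
  · revert h; revert x; decide
  · revert h; revert x; decide

theorem next_of_e3 : ∀ {x : SArrow DKArrow}, doubleKronecker.Step (e3, true) x →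
    x = (e4, true) ∨ x = (f3, false) := by
  decide

theorem next_of_f2 : ∀ {x : SArrow DKArrow}, doubleKronecker.Step (f2, false) x →
    x = (f1, false) ∨ x = (e2, true) := by
  decide

/-- From the middle vertex only `e₃` or `f₂⁻¹` can follow, and the next letter either returns to the
middle vertex or enters the fringe and ends the string. Reading two letters at a time leaves a
remainder of length at most two. -/
theorem exists_word_of_isChain : ∀ (v : List (SArrow DKArrow)) (p : SArrow DKArrow),
    (p :: v).IsChain doubleKronecker.Step → Forward p = true →
    doubleKronecker.finish p = .inl 1 → ∃ u r, v = word u ++ r ∧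
      (r = [] ∨ r = [(e3, true)] ∨ r = [(f2, false)] ∨ r = [(e3, true), (e4, true)] ∨
        r = [(f2, false), (f1, false)])
  | [], _, _, _, _ => ⟨[], [], rfl, Or.inl rfl⟩
  | [x], p, h, hp, hf => by
    rcases next_of_middle (by simpa using h) hp hf with rfl | rfl
    · exact ⟨[], _, rfl, by simp⟩
    · exact ⟨[], _, rfl, by simp⟩
  | x :: y :: v, p, h, hp, hf => by
    simp only [List.isChain_cons_cons] at h
    obtain ⟨h1, h2, h3⟩ := h
    have none : ∀ z, (z = (e4, true) ∨ z = (f1, false)) →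
        (z :: v).IsChain doubleKronecker.Step → v = [] := by
      intro z hz hv
      rcases v with _ | ⟨t, v⟩
      · rfl
      · have := (List.isChain_cons_cons.1 hv).1
        rcases hz with rfl | rfl
        · exact ((by decide : ∀ z, ¬ doubleKronecker.Step (e4, true) z) _ this).elim
        · exact ((by decide : ∀ z, ¬ doubleKronecker.Step (f1, false) z) _ this).elim
    rcases next_of_middle h1 hp hf with rfl | rfl
    · rcases next_of_e3 h2 with rfl | rfl
      · obtain rfl := none _ (Or.inl rfl) h3
        exact ⟨[], _, rfl, by simp⟩
      · obtain ⟨u, r, rfl, hr⟩ := exists_word_of_isChain v _ h3 rfl rfl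
        exact ⟨true :: u, r, by rw [word_cons]; rfl, hr⟩
    · rcases next_of_f2 h2 with rfl | rfl
      · obtain rfl := none _ (Or.inr rfl) h3
        exact ⟨[], _, rfl, by simp⟩
      · obtain ⟨u, r, rfl, hr⟩ := exists_word_of_isChain v _ h3 rfl rfl
        exact ⟨false :: u, r, by rw [word_cons]; rfl, hr⟩

theorem no_step_to : ∀ {x : SArrow DKArrow}, Forward x = true →
    (∀ z, ¬ doubleKronecker.Step z x) → x = (e1, true) ∨ x = (f4, false) := by
  decide

theorem no_step_from : ∀ {x : SArrow DKArrow}, Forward x = true →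
    (∀ z, ¬ doubleKronecker.Step x z) → x = (e4, true) ∨ x = (f1, false) := by
  decide

theorem isRoute_invWalk {w : List (SArrow DKArrow)} (h : doubleKronecker.IsRoute w) :
    doubleKronecker.IsRoute (invWalk w) := by
  obtain ⟨⟨h1, h2⟩, h3⟩ := h
  have hinv : ∀ {v : List (SArrow DKArrow)}, doubleKronecker.IsString v →
      doubleKronecker.IsString (invWalk v) := fun {v} hv =>
    ⟨by simpa [invWalk] using hv.1, doubleKronecker.isChain_invWalk hv.2⟩
  refine ⟨hinv ⟨h1, h2⟩, fun x => ⟨fun hx => ?_, fun hx => ?_⟩⟩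
  · apply (h3 (x.1, !x.2)).2
    have := hinv hx
    rw [← List.singleton_append, invWalk_append, invWalk_invWalk] at this
    exact this
  · apply (h3 (x.1, !x.2)).1
    have := hinv hx
    rw [invWalk_append, invWalk_invWalk] at this
    exact this

theorem isRoute_forward_cases {w : List (SArrow DKArrow)} (h : doubleKronecker.IsRoute w)
    (hw : IsForward w) : w = [(e1, true), (f1, false)] ∨ w = [(f4, false), (e4, true)] ∨
      ∃ x y u, w = spell (routeCode x y u) := by
  obtain ⟨⟨h1, h2⟩, h3⟩ := h
  have hlast : ∀ v y, w = v ++ [y] → y = (e4, true) ∨ y = (f1, false) := by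
    rintro v y rfl
    refine no_step_from (hw y (by simp)) fun z hz => ?_
    apply (h3 z).2
    refine ⟨by simp, ?_⟩
    rw [List.isChain_append]
    exact ⟨h2, by simp, by simp [hz]⟩
  have hparse : ∀ (s : List (SArrow DKArrow)) (q : SArrow DKArrow) (v : List (SArrow DKArrow)),
      w = s ++ q :: v → Forward q = true → doubleKronecker.finish q = .inl 1 →
      ∃ (y : Bool) (u : List Bool), v = word u ++ (if y then [(e3, true), (e4, true)] else [(f2, false), (f1, false)]) := by
    intro s q v hsv hq hf
    have hc : (q :: v).IsChain doubleKronecker.Step := h2.infix ⟨s, [], by simp [hsv]⟩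
    -- The first three remainders contradict maximality: the last letter of a forward route must be
    -- `e₄` or `f₁⁻¹`.
    obtain ⟨u, r, rfl, rfl | rfl | rfl | rfl | rfl⟩ := exists_word_of_isChain v q hc hq hf
    · exfalso
      rcases List.eq_nil_or_concat u with rfl | ⟨u, t, rfl⟩
      · have := hlast s q (by simp [hsv, word, spell])
        rcases this with rfl | rfl <;> revert hf <;> decide
      · have := hlast (s ++ q :: (word u ++ [(ab t).fst])) (ab t).snd (by
          rw [hsv, List.concat_eq_append, word_append]; simp [word, spell])
        revert this
        cases t <;> decide
    · have := hlast (s ++ q :: word u) _ (by rw [hsv]; simp; rfl)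
      exact absurd this (by decide)
    · have := hlast (s ++ q :: word u) _ (by rw [hsv]; simp; rfl)
      exact absurd this (by decide)
    · exact ⟨true, u, rfl⟩
    · exact ⟨false, u, rfl⟩
  rcases w with _ | ⟨x, w⟩
  · simp at h1
  · have hx := no_step_to (hw x (by simp)) fun z hz => (h3 z).1
      ⟨by simp, List.isChain_cons_cons.2 ⟨hz, h2⟩⟩
    rcases w with _ | ⟨y, w⟩
    · have := hlast [] x rfl
      clear h1 h2 h3 hw hlast hparse
      rcases hx with rfl | rfl <;> exact absurd this (by decide)
    · simp only [List.isChain_cons_cons] at h2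
      have hw0 : ∀ z ∈ w.head?, doubleKronecker.Step y z := by
        have := h2.2
        rw [List.isChain_cons] at this
        exact this.1
      have nil_of : (∀ z, ¬ doubleKronecker.Step y z) → w = [] := by
        intro hy
        rcases w with _ | ⟨z, w⟩
        · rfl
        · exact (hy z (hw0 z rfl)).elim
      rcases hx with rfl | rfl
      · have : y = (f1, false) ∨ y = (e2, true) :=
          (by decide : ∀ y, doubleKronecker.Step (e1, true) y → y = (f1, false) ∨ y = (e2, true)) y h2.1
        rcases this with rfl | rfl
        · left; rw [nil_of (by decide)]
        · obtain ⟨y, u, rfl⟩ := hparse [(e1, true)] (e2, true) w rfl rfl rfl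
          exact Or.inr (Or.inr ⟨false, y, u, by rw [spell_routeCode]; simp⟩)
      · have : y = (e4, true) ∨ y = (f3, false) :=
          (by decide : ∀ y, doubleKronecker.Step (f4, false) y → y = (e4, true) ∨ y = (f3, false)) y h2.1
        rcases this with rfl | rfl
        · right; left; rw [nil_of (by decide)]
        · obtain ⟨y, u, rfl⟩ := hparse [(f4, false)] (f3, false) w rfl rfl rfl
          exact Or.inr (Or.inr ⟨true, y, u, by rw [spell_routeCode]; simp⟩)

theorem route_cases (p : doubleKronecker.Route) :
    p = capL ∨ p = capR ∨ ∃ x y u, p = route x y u := by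
  have key : ∀ w : doubleKronecker.RouteWord, IsForward w.1 →
      (⟦w⟧ : doubleKronecker.Route) = capL ∨ (⟦w⟧ : doubleKronecker.Route) = capR ∨
        ∃ x y u, (⟦w⟧ : doubleKronecker.Route) = route x y u := by
    rintro ⟨w, hw⟩ hf
    rcases isRoute_forward_cases hw hf with rfl | rfl | ⟨x, y, u, rfl⟩
    · exact Or.inl rfl
    · exact Or.inr (Or.inl rfl)
    · exact Or.inr (Or.inr ⟨x, y, u, rfl⟩)
  induction p using Quotient.inductionOn with
  | h w =>
    rcases isForward_or_invWalk w.2.1.2 with h | h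
    · exact key w h
    · have e : (⟦w⟧ : doubleKronecker.Route) = ⟦⟨invWalk w.1, isRoute_invWalk w.2⟩⟧ :=
        Quotient.sound (Or.inr (invWalk_invWalk _).symm)
      rw [e]
      exact key _ h

theorem isBand_invWalk {w : List (SArrow DKArrow)} (h : doubleKronecker.IsBand w) :
    doubleKronecker.IsBand (invWalk w) := by
  obtain ⟨h1, h2, h3⟩ := h
  refine ⟨⟨by simpa [invWalk] using h1.1, doubleKronecker.isChain_invWalk h1.2⟩,
    ⟨by simpa [invWalk] using h1.1, ?_⟩, ?_⟩
  · rw [← invWalk_append]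
    exact doubleKronecker.isChain_invWalk h2.2
  · intro u n hn h
    apply h3 (invWalk u) n hn
    rw [invWalk_replicate_flatten, ← h, invWalk_invWalk]

/-- If the rotated word is a power of `u ++ [x]`, conjugation by `x` exhibits the original one as
the same power of `x :: u`. -/
theorem isBand_rotate {x : SArrow DKArrow} {w : List (SArrow DKArrow)}
    (h : doubleKronecker.IsBand (x :: w)) : doubleKronecker.IsBand (w ++ [x]) := by
  obtain ⟨h1, h2, h3⟩ := h
  have hc : (w ++ [x] ++ (w ++ [x])).IsChain doubleKronecker.Step :=
    (isChain_replicate_flatten h2.2 3).infix ⟨[x], w, by simp [List.replicate]⟩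
  refine ⟨⟨by simp, hc.infix ⟨[], w ++ [x], by simp⟩⟩, ⟨by simp, hc⟩, ?_⟩
  intro u n hn h
  obtain ⟨n, rfl⟩ : ∃ k, n = k + 1 := ⟨n - 1, by omega⟩
  rcases List.eq_nil_or_concat u with rfl | ⟨u, y, rfl⟩
  · have := congrArg List.length h
    simp at this
  · rw [List.concat_eq_append] at h
    have hy : x = y := by
      rw [List.replicate_succ', List.flatten_append] at h
      have := congrArg List.getLast? h
      simpa using this
    subst hy
    refine h3 (x :: u) (n + 1) hn ?_
    have e : ∀ k : ℕ, x :: (List.replicate k (u ++ [x])).flatten =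
        (List.replicate k (x :: u)).flatten ++ [x] := by
      intro k
      induction k with
      | zero => rfl
      | succ k ih =>
        rw [List.replicate_succ, List.flatten_cons, List.replicate_succ, List.flatten_cons,
          List.append_assoc (x :: u), ← ih]
        simp
    have := e (n + 1)
    rw [← h, ← List.cons_append] at this
    exact List.append_cancel_right this

theorem isBand_forward_middle {x : SArrow DKArrow} {w : List (SArrow DKArrow)}
    (h : doubleKronecker.IsBand (x :: w)) (hf : IsForward (x :: w))
    (hx : x = (e3, true) ∨ x = (f2, false)) : ∃ u, x :: w = word u := by
  obtain ⟨y, t, hy⟩ : ∃ y t, x :: w = t ++ [y] := by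
    rcases List.eq_nil_or_concat (x :: w) with h | ⟨t, y, h⟩
    · simp at h
    · exact ⟨y, t, by rw [h, List.concat_eq_append]⟩
  have hyx : doubleKronecker.Step y x := by
    have h2 := h.2.1.2
    nth_rw 1 [hy] at h2
    have : ([y, x] : List (SArrow DKArrow)).IsChain doubleKronecker.Step :=
      h2.infix ⟨t, w, by simp⟩
    simpa using this
  have hchain : (y :: x :: w).IsChain doubleKronecker.Step :=
    List.isChain_cons_cons.2 ⟨hyx, h.1.2⟩
  have hyf : Forward y = true := hf y (by rw [hy]; simp)
  have hfin : doubleKronecker.finish y = .inl 1 := by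
    rw [hyx.1]
    rcases hx with rfl | rfl <;> rfl
  obtain ⟨u, r, he, rfl | rfl | rfl | rfl | rfl⟩ := exists_word_of_isChain _ y hchain hyf hfin
  · exact ⟨u, by simpa using he⟩
  all_goals
    exfalso
    have h1 := congrArg List.getLast? (hy.symm.trans he)
    simp only [List.getLast?_append, List.getLast?_singleton, Option.some_or,
      List.getLast?_cons_cons, Option.some.injEq] at h1
    subst h1
    revert hfin
    decide

/-- A forward band visits the middle vertex every second letter, so after inversion and rotation by
at most one letter it starts there. -/
theorem band_cases (X : doubleKronecker.Band) :
    ∃ (u : List Bool) (h : doubleKronecker.IsBand (word u)), X = ⟦⟨word u, h⟩⟧ := by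
  have key0 : ∀ w : doubleKronecker.BandWord, IsForward w.1 →
      (∃ x t, w.1 = x :: t ∧ (x = (e3, true) ∨ x = (f2, false))) →
      ∃ (u : List Bool) (h : doubleKronecker.IsBand (word u)),
        (⟦w⟧ : doubleKronecker.Band) = ⟦⟨word u, h⟩⟧ := by
    rintro ⟨w, hw⟩ hf ⟨x, t, rfl, hx⟩
    obtain ⟨u, hu⟩ := isBand_forward_middle hw hf hx
    exact ⟨u, hu ▸ hw, Quotient.sound (Or.inl (by show x :: t ~r word u; rw [← hu]))⟩
  have key : ∀ w : doubleKronecker.BandWord, IsForward w.1 →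
      ∃ (u : List Bool) (h : doubleKronecker.IsBand (word u)),
        (⟦w⟧ : doubleKronecker.Band) = ⟦⟨word u, h⟩⟧ := by
    rintro ⟨w, hw⟩ hf
    rcases w with _ | ⟨x, w⟩
    · exact (hw.1.1 rfl).elim
    · by_cases hx : x = (e3, true) ∨ x = (f2, false)
      · exact key0 _ hf ⟨x, w, rfl, hx⟩
      · have e : (⟦⟨x :: w, hw⟩⟧ : doubleKronecker.Band) = ⟦⟨w ++ [x], isBand_rotate hw⟩⟧ :=
          Quotient.sound (Or.inl ⟨1, by simp⟩)
        rw [e]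
        refine key0 _ (fun z hz => hf z ?_) ?_
        · simp only [List.mem_append, List.mem_singleton] at hz
          simp only [List.mem_cons]
          tauto
        · have hxf := hf x (by simp)
          obtain ⟨y, t, hy⟩ : ∃ y t, w ++ [x] = y :: t := by
            rcases w with _ | ⟨y, w⟩
            · exact ⟨x, [], rfl⟩
            · exact ⟨y, w ++ [x], rfl⟩
          refine ⟨y, t, hy, ?_⟩
          have hc : (x :: (w ++ [x] ++ w)).IsChain doubleKronecker.Step := by
            simpa using hw.2.1.2
          rw [hy] at hc
          have hxy : doubleKronecker.Step x y := (List.isChain_cons_cons.1 hc).1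
          have hpx : ∃ p, doubleKronecker.Step p x := by
            rcases List.eq_nil_or_concat w with rfl | ⟨v, p, rfl⟩
            · have := hw.2.1.2
              exact ⟨x, by simpa using this⟩
            · refine ⟨p, ?_⟩
              have : ([p, x] : List (SArrow DKArrow)).IsChain doubleKronecker.Step :=
                hw.2.1.2.infix ⟨x :: v, v ++ [p], by simp⟩
              simpa using this
          have hyz : ∃ z, doubleKronecker.Step y z := by
            rcases t with _ | ⟨z, t⟩
            · have : w = [] ∧ x = y := by
                rcases w with _ | ⟨_, w⟩ <;> simp_all
              exact ⟨y, by rw [← this.2] at hxy ⊢; exact hxy⟩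
            · simp only [List.cons_append, List.isChain_cons_cons] at hc
              exact ⟨z, hc.2.1⟩
          -- What remains is finite: a forward letter `x` that has a predecessor and does not start
          -- at the middle vertex must end there, so its successor `y` is `e₃` or `f₂⁻¹`.
          clear hc hy e key0 hf hw
          revert hx hxf hxy hpx hyz x y
          decide
  induction X using Quotient.inductionOn with
  | h w =>
    rcases isForward_or_invWalk w.2.1.2 with h | h
    · exact key w h
    · have e : (⟦w⟧ : doubleKronecker.Band) = ⟦⟨invWalk w.1, isBand_invWalk w.2⟩⟧ :=
        Quotient.sound (Or.inr (by rw [invWalk_invWalk]))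
      rw [e]
      exact key _ h

theorem band_eq_of_isRotated {u v : List Bool} (hu : doubleKronecker.IsBand (word u))
    (hv : doubleKronecker.IsBand (word v)) (h : u ~r v) :
    (⟦⟨word u, hu⟩⟧ : doubleKronecker.Band) = ⟦⟨word v, hv⟩⟧ := by
  refine Quotient.sound (Or.inl ?_)
  show word u ~r word v
  obtain ⟨k, hk, rfl⟩ := List.isRotated_iff_mod.1 h
  rw [List.rotate_eq_drop_append_take hk]
  conv_lhs => rw [← List.take_append_drop k u]
  rw [word_append, word_append]
  exact List.isRotated_append

theorem not_power_of_isBand {u : List Bool} (hu : doubleKronecker.IsBand (word u)) (v : List Bool)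
    (n : ℕ) (hn : 2 ≤ n) : u ≠ (List.replicate n v).flatten := by
  rintro rfl
  exact hu.2.2 (word v) n hn (word_replicate v n)

/-! ### The mirror symmetry. -/

/-- The action of the mirror symmetry on arrows. -/
def mirrorArrow : DKArrow → DKArrow
  | e1 => f4 | e2 => f3 | e3 => f2 | e4 => f1 | f1 => e4 | f2 => e3 | f3 => e2 | f4 => e1

/-- The mirror symmetry on signed arrows, exchanging the two fringes and reversing all arrows. -/
def mirrorStep (x : SArrow DKArrow) : SArrow DKArrow := (mirrorArrow x.1, !x.2)

/-- The action of the mirror symmetry on vertices. -/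
def mirrorVertex : Fin 3 ⊕ Fin 4 → Fin 3 ⊕ Fin 4 := Sum.map Fin.rev Fin.rev

/-- The mirror image of a word. -/
def mirrorWord (w : List (SArrow DKArrow)) : List (SArrow DKArrow) := w.map mirrorStep

theorem mirrorArrow_mirrorArrow : ∀ x, mirrorArrow (mirrorArrow x) = x := by decide

theorem mirrorStep_mirrorStep : ∀ x, mirrorStep (mirrorStep x) = x := by decide

theorem mirrorWord_mirrorWord (w : List (SArrow DKArrow)) : mirrorWord (mirrorWord w) = w := by
  simp [mirrorWord, Function.comp_def, mirrorStep_mirrorStep]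

theorem mirrorWord_append (u v : List (SArrow DKArrow)) :
    mirrorWord (u ++ v) = mirrorWord u ++ mirrorWord v := by
  simp [mirrorWord]

theorem mirrorWord_replicate (u : List (SArrow DKArrow)) (n : ℕ) :
    mirrorWord (List.replicate n u).flatten = (List.replicate n (mirrorWord u)).flatten := by
  simp [mirrorWord]

theorem mirrorWord_invWalk (w : List (SArrow DKArrow)) :
    mirrorWord (invWalk w) = invWalk (mirrorWord w) := by
  simp [mirrorWord, invWalk, mirrorStep, Function.comp_def]

theorem step_mirrorStep : ∀ {x y : SArrow DKArrow}, doubleKronecker.Step x y →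
    doubleKronecker.Step (mirrorStep x) (mirrorStep y) := by decide

theorem tail_mirrorArrow : ∀ x, doubleKronecker.tail (mirrorArrow x) =
    mirrorVertex (doubleKronecker.head x) := by decide

theorem head_mirrorArrow : ∀ x, doubleKronecker.head (mirrorArrow x) =
    mirrorVertex (doubleKronecker.tail x) := by decide

theorem isString_mirrorWord {w : List (SArrow DKArrow)} (h : doubleKronecker.IsString w) :
    doubleKronecker.IsString (mirrorWord w) := by
  refine ⟨by simpa [mirrorWord] using h.1, ?_⟩
  rw [mirrorWord, List.isChain_map]
  exact h.2.imp fun _ _ => step_mirrorStep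

theorem isRoute_mirrorWord {w : List (SArrow DKArrow)} (h : doubleKronecker.IsRoute w) :
    doubleKronecker.IsRoute (mirrorWord w) := by
  refine ⟨isString_mirrorWord h.1, fun x => ⟨fun hx => ?_, fun hx => ?_⟩⟩
  · apply (h.2 (mirrorStep x)).1
    have := isString_mirrorWord hx
    rwa [← List.singleton_append, mirrorWord_append, mirrorWord_mirrorWord] at this
  · apply (h.2 (mirrorStep x)).2
    have := isString_mirrorWord hx
    rwa [mirrorWord_append, mirrorWord_mirrorWord] at this

theorem isBand_mirrorWord {w : List (SArrow DKArrow)} (h : doubleKronecker.IsBand w) :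
    doubleKronecker.IsBand (mirrorWord w) := by
  refine ⟨isString_mirrorWord h.1, ?_, fun u n hn hu => ?_⟩
  · rw [← mirrorWord_append]
    exact isString_mirrorWord h.2.1
  · apply h.2.2 (mirrorWord u) n hn
    rw [← mirrorWord_replicate, ← hu, mirrorWord_mirrorWord]

/-- The mirror image of a route. -/
def mirrorRoute : doubleKronecker.Route → doubleKronecker.Route :=
  Quotient.map (fun w => ⟨mirrorWord w.1, isRoute_mirrorWord w.2⟩) (by
    rintro a b (h | h)
    · exact Or.inl (congrArg mirrorWord h)
    · exact Or.inr ((congrArg mirrorWord h).trans (mirrorWord_invWalk _)))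

/-- The mirror image of a band. -/
def mirrorBand : doubleKronecker.Band → doubleKronecker.Band :=
  Quotient.map (fun w => ⟨mirrorWord w.1, isBand_mirrorWord w.2⟩) (by
    rintro a b (h | h)
    · exact Or.inl (h.map _)
    · right
      show mirrorWord a.1 ~r invWalk (mirrorWord b.1)
      rw [← mirrorWord_invWalk]
      exact h.map _)

/-- The mirror image of a trail. -/
def mirrorTrail : doubleKronecker.Trail → doubleKronecker.Trail
  | .route p => .route (mirrorRoute p)
  | .band B => .band (mirrorBand B)

theorem mirrorRoute_mirrorRoute (p : doubleKronecker.Route) : mirrorRoute (mirrorRoute p) = p := by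
  induction p using Quotient.inductionOn with
  | h w => exact Quotient.sound (Or.inl (mirrorWord_mirrorWord w.1))

theorem mirrorBand_mirrorBand (X : doubleKronecker.Band) : mirrorBand (mirrorBand X) = X := by
  induction X using Quotient.inductionOn with
  | h w =>
    refine Quotient.sound (Or.inl ?_)
    show mirrorWord (mirrorWord w.1) ~r w.1
    rw [mirrorWord_mirrorWord]

theorem mirrorTrail_mirrorTrail (t : doubleKronecker.Trail) :
    mirrorTrail (mirrorTrail t) = t := by
  cases t
  · simp [mirrorTrail, mirrorRoute_mirrorRoute]
  · simp [mirrorTrail, mirrorBand_mirrorBand]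

theorem mirrorWord_mem_factors {t : doubleKronecker.Trail} {u : List (SArrow DKArrow)}
    (h : u ∈ Trail.factors doubleKronecker t) :
    mirrorWord u ∈ Trail.factors doubleKronecker (mirrorTrail t) := by
  cases t with
  | route p =>
    induction p using Quotient.inductionOn with
    | h w =>
      change u ∈ routeFactors w.1 at h
      show mirrorWord u ∈ routeFactors (mirrorWord w.1)
      rcases h with h | h
      · exact Or.inl (h.map _)
      · right
        rw [← mirrorWord_invWalk]
        exact h.map _
  | band X =>
    induction X using Quotient.inductionOn with
    | h w =>
      change u ∈ bandFactors w.1 at h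
      show mirrorWord u ∈ bandFactors (mirrorWord w.1)
      obtain ⟨n, h | h⟩ := h
      · refine ⟨n, Or.inl ?_⟩
        rw [← mirrorWord_replicate]
        exact h.map _
      · refine ⟨n, Or.inr ?_⟩
        rw [← mirrorWord_invWalk, ← mirrorWord_replicate]
        exact h.map _

/-- Reversing all arrows turns tops into bottoms, so the two trails exchange their roles. -/
theorem topBottom_mirrorTrail {s t : doubleKronecker.Trail} (h : doubleKronecker.TopBottom s t) :
    doubleKronecker.TopBottom (mirrorTrail t) (mirrorTrail s) := by
  obtain ⟨σ, a, b, c, d, h1, h2, hv⟩ := h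
  refine ⟨mirrorWord σ, mirrorArrow c, mirrorArrow d, mirrorArrow a, mirrorArrow b, ?_, ?_, ?_⟩
  · simpa [mirrorWord, mirrorStep] using mirrorWord_mem_factors h2
  · simpa [mirrorWord, mirrorStep] using mirrorWord_mem_factors h1
  · rw [tail_mirrorArrow, head_mirrorArrow, hv]

theorem compatible_mirrorTrail {s t : doubleKronecker.Trail} (h : doubleKronecker.Compatible s t) :
    doubleKronecker.Compatible (mirrorTrail s) (mirrorTrail t) := by
  refine ⟨fun hs => h.2 ?_, fun hs => h.1 ?_⟩
  · simpa only [mirrorTrail_mirrorTrail] using topBottom_mirrorTrail hs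
  · simpa only [mirrorTrail_mirrorTrail] using topBottom_mirrorTrail hs

theorem compatible_mirrorTrail_iff {s t : doubleKronecker.Trail} :
    doubleKronecker.Compatible (mirrorTrail s) (mirrorTrail t) ↔ doubleKronecker.Compatible s t :=
  ⟨fun h => by simpa only [mirrorTrail_mirrorTrail] using compatible_mirrorTrail h,
    compatible_mirrorTrail⟩

theorem compatible_symm {s t : doubleKronecker.Trail} (h : doubleKronecker.Compatible s t) :
    doubleKronecker.Compatible t s := ⟨h.2, h.1⟩

theorem straightRoute_mirrorRoute {p : doubleKronecker.Route}
    (h : doubleKronecker.StraightRoute p) : doubleKronecker.StraightRoute (mirrorRoute p) := by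
  obtain ⟨w, rfl, h⟩ := h
  refine ⟨⟨mirrorWord w.1, isRoute_mirrorWord w.2⟩, rfl, ?_⟩
  rcases h with h | h
  · right
    intro x hx
    obtain ⟨y, hy, rfl⟩ := List.mem_map.1 hx
    simp [mirrorStep, h y hy]
  · left
    intro x hx
    obtain ⟨y, hy, rfl⟩ := List.mem_map.1 hx
    simp [mirrorStep, h y hy]

theorem straightRoute_mirrorRoute_iff {p : doubleKronecker.Route} :
    doubleKronecker.StraightRoute (mirrorRoute p) ↔ doubleKronecker.StraightRoute p :=
  ⟨fun h => by simpa only [mirrorRoute_mirrorRoute] using straightRoute_mirrorRoute h,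
    straightRoute_mirrorRoute⟩

theorem mirrorWord_word (u : List Bool) : mirrorWord (word u) = word (u.map not) := by
  induction u with
  | nil => rfl
  | cons x u ih =>
    rw [word_cons, mirrorWord_append, ih, List.map_cons, word_cons]
    cases x <;> rfl

theorem mirrorRoute_route (x y : Bool) (u : List Bool) :
    mirrorRoute (route x y u) = route (!x) (!y) (u.map not) := by
  refine Quotient.sound (Or.inl ?_)
  show mirrorWord (spell _) = spell _
  rw [spell_routeCode, spell_routeCode, mirrorWord_append, mirrorWord_append, mirrorWord_word]
  cases x <;> cases y <;> rfl

theorem mirrorRoute_capL : mirrorRoute capL = capR := rfl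

theorem indicator_mirrorRoute (p : doubleKronecker.Route) (α : DKArrow) :
    Route.indicator doubleKronecker (mirrorRoute p) α =
      Route.indicator doubleKronecker p (mirrorArrow α) := by
  induction p using Quotient.inductionOn with
  | h w =>
    show arrowCount (mirrorWord w.1) α = arrowCount w.1 (mirrorArrow α)
    simp only [arrowCount, mirrorWord, List.countP_map]
    congr 2
    funext x
    have : ∀ (y : DKArrow), mirrorArrow y = α ↔ y = mirrorArrow α := fun y =>
      ⟨fun h => by rw [← h, mirrorArrow_mirrorArrow], fun h => by rw [h, mirrorArrow_mirrorArrow]⟩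
    simp [mirrorStep, this]

theorem indicator_mirrorBand (p : doubleKronecker.Band) (α : DKArrow) :
    Band.indicator doubleKronecker (mirrorBand p) α =
      Band.indicator doubleKronecker p (mirrorArrow α) := by
  induction p using Quotient.inductionOn with
  | h w =>
    show arrowCount (mirrorWord w.1) α = arrowCount w.1 (mirrorArrow α)
    simp only [arrowCount, mirrorWord, List.countP_map]
    congr 2
    funext x
    have : ∀ (y : DKArrow), mirrorArrow y = α ↔ y = mirrorArrow α := fun y =>
      ⟨fun h => by rw [← h, mirrorArrow_mirrorArrow], fun h => by rw [h, mirrorArrow_mirrorArrow]⟩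
    simp [mirrorStep, this]

theorem turn_mirrorStep (v : Fin 3) : ∀ x y : SArrow DKArrow,
    doubleKronecker.turn v (mirrorStep x) (mirrorStep y) = -doubleKronecker.turn v.rev x y := by
  revert v
  decide

theorem wordG_mirrorWord (v : Fin 3) : ∀ w : List (SArrow DKArrow),
    doubleKronecker.wordG v (mirrorWord w) = -doubleKronecker.wordG v.rev w
  | [] => rfl
  | [_] => rfl
  | x :: y :: w => by
    have := wordG_mirrorWord v (y :: w)
    simp only [mirrorWord, List.map_cons] at this ⊢
    rw [wordG, wordG, this, turn_mirrorStep]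
    ring

theorem g_mirrorRoute (p : doubleKronecker.Route) (v : Fin 3) :
    Route.g doubleKronecker (mirrorRoute p) v = -Route.g doubleKronecker p v.rev := by
  induction p using Quotient.inductionOn with
  | h w => exact wordG_mirrorWord v w.1

/-! Straight routes. -/

theorem straightWord_invWalk {w : List (SArrow DKArrow)} (h : StraightWord w) :
    StraightWord (invWalk w) := by
  rcases h with h | h
  · right
    intro x hx
    simp only [invWalk, List.mem_reverse, List.mem_map] at hx
    obtain ⟨y, hy, rfl⟩ := hx
    simp [h y hy]
  · left
    intro x hx
    simp only [invWalk, List.mem_reverse, List.mem_map] at hx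
    obtain ⟨y, hy, rfl⟩ := hx
    simp [h y hy]

theorem straightRoute_iff (w : doubleKronecker.RouteWord) :
    doubleKronecker.StraightRoute ⟦w⟧ ↔ StraightWord w.1 := by
  constructor
  · rintro ⟨v, hv, h⟩
    rcases Quotient.exact hv with e | e
    · rwa [← show v.1 = w.1 from e]
    · rw [← invWalk_invWalk w.1, ← show v.1 = invWalk w.1 from e]
      exact straightWord_invWalk h
  · exact fun h => ⟨w, rfl, h⟩

theorem straightWord_of_mem_factors {p : doubleKronecker.Route}
    (hp : doubleKronecker.StraightRoute p) {u : List (SArrow DKArrow)}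
    (hu : u ∈ Trail.factors doubleKronecker (.route p)) : StraightWord u := by
  obtain ⟨w, rfl, h⟩ := hp
  have sub : ∀ {v : List (SArrow DKArrow)}, StraightWord v → u <:+: v → StraightWord u :=
    fun hv huv => hv.imp (fun h x hx => h x (huv.subset hx)) (fun h x hx => h x (huv.subset hx))
  rcases hu with hu | hu
  · exact sub h hu
  · exact sub (straightWord_invWalk h) hu

/-- A kiss shows both signs in each of the two trails, while a straight route shows only one. -/
theorem compatible_of_straightRoute {p : doubleKronecker.Route}
    (hp : doubleKronecker.StraightRoute p) (t : doubleKronecker.Trail) :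
    doubleKronecker.Compatible (.route p) t := by
  constructor
  · rintro ⟨σ, a, b, c, d, h1, -, -⟩
    rcases straightWord_of_mem_factors hp h1 with h | h
    · have := h (a, false) (by simp); simp at this
    · have := h (b, true) (by simp); simp at this
  · rintro ⟨σ, a, b, c, d, -, h2, -⟩
    rcases straightWord_of_mem_factors hp h2 with h | h
    · have := h (d, false) (by simp); simp at this
    · have := h (c, true) (by simp); simp at this

theorem not_straightRoute_of_mem {w : doubleKronecker.RouteWord} {a b : DKArrow}
    (ha : (a, true) ∈ w.1) (hb : (b, false) ∈ w.1) : ¬ doubleKronecker.StraightRoute ⟦w⟧ := by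
  rw [straightRoute_iff]
  rintro (h | h)
  · have := h _ hb; simp at this
  · have := h _ ha; simp at this

theorem not_straightRoute_capL : ¬ doubleKronecker.StraightRoute capL :=
  not_straightRoute_of_mem (a := e1) (b := f1) (by simp) (by simp)

theorem not_straightRoute_route (x : Bool) (u : List Bool) :
    ¬ doubleKronecker.StraightRoute (route x x u) := by
  cases x
  · exact not_straightRoute_of_mem (a := e1) (b := f1) (by simp [spell_routeCode])
      (by simp [spell_routeCode])
  · exact not_straightRoute_of_mem (a := e4) (b := f4) (by simp [spell_routeCode])
      (by simp [spell_routeCode])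

theorem straightRoute_route_nil (x : Bool) : doubleKronecker.StraightRoute (route x (!x) []) := by
  rw [route, straightRoute_iff]
  show StraightWord (spell _)
  rw [spell_routeCode]
  cases x
  · left; simp [word, spell]
  · right; simp [word, spell]

/-! Trails as words indexed by integers. -/

/-- The restriction of `f` to `D` runs above the restriction of `g` to `E` just before and just
after some common part. -/
def KissFun (D : Set ℤ) (f : ℤ → Letter) (E : Set ℤ) (g : ℤ → Letter) : Prop :=
  ∃ (i j : ℤ) (m : ℕ), (∀ k : ℕ, k ≤ m + 1 → i + k ∈ D ∧ j + k ∈ E) ∧ (g j).val < (f i).val ∧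
    (∀ k : ℕ, k < m → f (i + 1 + k) = g (j + 1 + k)) ∧
    (g (j + m + 1)).val < (f (i + m + 1)).val

/-- The trail `t` passes through the letters `f i` for `i ∈ D`, in this order. -/
def Models (t : doubleKronecker.Trail) (D : Set ℤ) (f : ℤ → Letter) : Prop :=
  ∃ F : Set (List Letter), (∀ C ∈ F, WellPlaced C) ∧ RepWords t (spell '' F) ∧
    (∀ C ∈ F, ∃ o : ℤ, ∀ (q : ℕ) x, C[q]? = some x → o + q ∈ D ∧ x = f (o + q)) ∧
    ∀ (i : ℤ) (m : ℕ), (∀ k : ℕ, k ≤ m → i + k ∈ D) →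
      ∃ C ∈ F, ∃ q : ℕ, ∀ k : ℕ, k ≤ m → C[q + k]? = some (f (i + k))

/-- A kiss involves finitely many consecutive letters. The representing lists are windows of the
integer-indexed words, and every finite window occurs in one of the lists. -/
theorem Models.topBottom_iff {s t : doubleKronecker.Trail} {D E : Set ℤ} {f g : ℤ → Letter}
    (hs : Models s D f) (ht : Models t E g) :
    doubleKronecker.TopBottom s t ↔ KissFun D f E g := by
  obtain ⟨F, hF1, hF2, hF3, hF4⟩ := hs
  obtain ⟨G, hG1, hG2, hG3, hG4⟩ := ht
  rw [DoubleKronecker.topBottom_iff hF2 hG2]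
  constructor
  · rintro ⟨_, ⟨C, hC, rfl⟩, _, ⟨C', hC', rfl⟩, h⟩
    rw [wordTopBottom_spell_iff (hF1 C hC) (hG1 C' hC')] at h
    obtain ⟨i, j, m, x, y, x', y', hx, hy, hx', hy', hm, h1, h2⟩ := h
    obtain ⟨o, ho⟩ := hF3 C hC
    obtain ⟨o', ho'⟩ := hG3 C' hC'
    have l1 := (List.getElem?_eq_some_iff.1 hy).1
    have l2 := (List.getElem?_eq_some_iff.1 hy').1
    refine ⟨o + i, o' + j, m, fun k hk => ⟨?_, ?_⟩, ?_, fun k hk => ?_, ?_⟩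
    · have := (ho (i + k) _ (List.getElem?_eq_getElem (by omega))).1
      rwa [Nat.cast_add, ← add_assoc] at this
    · have := (ho' (j + k) _ (List.getElem?_eq_getElem (by omega))).1
      rwa [Nat.cast_add, ← add_assoc] at this
    · rwa [← (ho i x hx).2, ← (ho' j x' hx').2]
    · have a1 : i + 1 + k < C.length := by omega
      have := hm k hk
      rw [List.getElem?_eq_getElem a1] at this
      have e1 := (ho _ _ (List.getElem?_eq_getElem a1)).2
      have e2 := (ho' _ _ this.symm).2
      push_cast at e1 e2
      rw [show o + (i : ℤ) + 1 + k = o + (i + 1 + k) by ring,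
        show o' + (j : ℤ) + 1 + k = o' + (j + 1 + k) by ring, ← e1, ← e2]
    · have e1 := (ho _ y hy).2
      have e2 := (ho' _ y' hy').2
      push_cast at e1 e2
      rw [show o + (i : ℤ) + m + 1 = o + (i + m + 1) by ring,
        show o' + (j : ℤ) + m + 1 = o' + (j + m + 1) by ring, ← e1, ← e2]
      exact h2
  · rintro ⟨i, j, m, hD, h1, hm, h2⟩
    obtain ⟨C, hC, q, hq⟩ := hF4 i (m + 1) fun k hk => (hD k hk).1
    obtain ⟨C', hC', q', hq'⟩ := hG4 j (m + 1) fun k hk => (hD k hk).2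
    refine ⟨_, ⟨C, hC, rfl⟩, _, ⟨C', hC', rfl⟩, ?_⟩
    rw [wordTopBottom_spell_iff (hF1 C hC) (hG1 C' hC')]
    refine ⟨q, q', m, f i, f (i + m + 1), g j, g (j + m + 1), ?_, ?_, ?_, ?_, ?_, h1, h2⟩
    · simpa using hq 0 (by omega)
    · simpa [add_assoc] using hq (m + 1) le_rfl
    · simpa using hq' 0 (by omega)
    · simpa [add_assoc] using hq' (m + 1) le_rfl
    · intro k hk
      have e1 := hq (1 + k) (by omega)
      have e2 := hq' (1 + k) (by omega)
      have := hm k hk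
      rw [add_assoc, add_assoc, e1, e2]
      push_cast
      rw [← add_assoc, ← add_assoc, this]

/-- The letters of a route whose inner part has length `n`; the inner part is indexed by the
integers `0, …, n - 1`. -/
def routeFun (x y : Bool) (n : ℕ) (h : ℤ → Bool) (p : ℤ) : Letter :=
  if p < 0 then (if x then .startR else .startL)
  else if p < n then ab (h p) else (if y then .endR else .endL)

theorem routeCode_getElem? {x y : Bool} {u : List Bool} {h : ℤ → Bool}
    (hu : ∀ p (hp : p < u.length), u[p] = h p) (q : ℕ) (hq : q < u.length + 2) :
    (routeCode x y u)[q]? = some (routeFun x y u.length h (q - 1)) := by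
  rw [routeCode]
  rcases q with _ | q
  · simp [routeFun]
  · rw [List.getElem?_cons_succ]
    by_cases hq' : q < u.length
    · simp [List.getElem?_append, hq', routeFun, hu q hq']
    · obtain rfl : q = u.length := by omega
      simp [routeFun]

theorem wellPlaced_routeCode (x y : Bool) (u : List Bool) : WellPlaced (routeCode x y u) := by
  have hl : (routeCode x y u).length = u.length + 2 := by simp [routeCode]
  intro q z hz
  have hq : q < u.length + 2 := hl ▸ (List.getElem?_eq_some_iff.1 hz).1
  obtain ⟨h, hu⟩ : ∃ h : ℤ → Bool, ∀ p (hp : p < u.length), u[p] = h p :=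
    ⟨fun p => u.getD p.toNat false, fun p hp => by simp [hp]⟩
  rw [routeCode_getElem? hu q hq, Option.some.injEq] at hz
  rw [hl, ← hz, routeFun]
  by_cases h1 : q = 0
  · subst h1
    cases x <;> simp [Letter.isStart, Letter.isEnd]
  · rw [if_neg (by omega)]
    by_cases h2 : q < u.length + 1
    · rw [if_pos (by omega), isStart_ab, isEnd_ab]
      simp
    · rw [if_neg (by omega)]
      have : q = u.length + 1 := by omega
      cases y <;> simp [Letter.isStart, Letter.isEnd, this]

theorem models_route {x y : Bool} {u : List Bool} {h : ℤ → Bool}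
    (hu : ∀ p (hp : p < u.length), u[p] = h p) :
    Models (.route (route x y u)) (Set.Icc (-1) u.length) (routeFun x y u.length h) := by
  have hl : (routeCode x y u).length = u.length + 2 := by simp [routeCode]
  refine ⟨{routeCode x y u}, ?_, ?_, ?_, ?_⟩
  · rintro _ rfl
    exact wellPlaced_routeCode x y u
  · rw [Set.image_singleton]
    exact repWords_route _ (isForward_spell _)
  · rintro _ rfl
    refine ⟨-1, fun q z hz => ?_⟩
    have hq : q < u.length + 2 := hl ▸ (List.getElem?_eq_some_iff.1 hz).1
    rw [routeCode_getElem? hu q hq, Option.some.injEq] at hz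
    refine ⟨⟨by omega, by omega⟩, ?_⟩
    rw [← hz]
    congr 1
  · intro i m him
    have h0 := him 0 (by omega)
    have h1 := him m le_rfl
    simp only [Set.mem_Icc] at h0 h1
    refine ⟨_, rfl, (i + 1).toNat, fun k hk => ?_⟩
    rw [routeCode_getElem? hu _ (by omega)]
    congr 2
    omega

theorem flatten_replicate_getElem? {α : Type} (l : List α) (n q : ℕ) (hq : q < n * l.length) :
    (List.replicate n l).flatten[q]? = l[q % l.length]? := by
  induction n generalizing q with
  | zero => simp at hq
  | succ n ih =>
    rw [List.replicate_succ, List.flatten_cons, List.getElem?_append]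
    split_ifs with h
    · rw [Nat.mod_eq_of_lt h]
    · rw [ih (q - l.length) (by rw [Nat.succ_mul] at hq; omega)]
      rw [← Nat.mod_eq_sub_mod (by omega)]

theorem eq_of_periodic {α : Type} {h : ℤ → α} {n : ℕ} (hp : ∀ p, h (p + n) = h p) (p : ℤ) (k : ℤ) :
    h (p + n * k) = h p := by
  induction k using Int.induction_on with
  | zero => simp
  | succ k ih => rw [← ih, mul_add, mul_one, ← add_assoc, hp]
  | pred k ih => rw [← ih, ← hp (p + n * (-k - 1))]; congr 1; ring

theorem models_band {u : List Bool} (hb : doubleKronecker.IsBand (word u)) {h : ℤ → Bool}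
    (hp : ∀ p, h (p + u.length) = h p) (hu : ∀ p (hp : p < u.length), u[p] = h p) :
    Models (.band ⟦⟨word u, hb⟩⟧) Set.univ (fun p => ab (h p)) := by
  have hpos : 0 < u.length := by
    rw [List.length_pos_iff]
    rintro rfl
    exact hb.1.1 rfl
  have key : ∀ n q : ℕ, q < n * u.length →
      (List.replicate n (u.map ab)).flatten[q]? = some (ab (h q)) := by
    intro n q hq
    have hlt : q % u.length < u.length := Nat.mod_lt _ hpos
    rw [flatten_replicate_getElem? _ _ _ (by simpa using hq)]
    rw [List.length_map, List.getElem?_map, List.getElem?_eq_getElem hlt, hu]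
    have := eq_of_periodic hp ((q % u.length : ℕ) : ℤ) ((q / u.length : ℕ) : ℤ)
    rw [← Nat.cast_mul, ← Nat.cast_add, Nat.mod_add_div] at this
    rw [this]; rfl
  refine ⟨{C | ∃ n, C = (List.replicate n (u.map ab)).flatten}, ?_, ?_, ?_, ?_⟩
  · rintro _ ⟨n, rfl⟩ q x hx
    have hq : q < n * u.length := by simpa using (List.getElem?_eq_some_iff.1 hx).1
    rw [key n q hq, Option.some.injEq] at hx
    rw [← hx, isStart_ab, isEnd_ab]
    simp
  · have := repWords_band ⟨word u, hb⟩ (isForward_spell _)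
    convert this using 1
    ext w
    simp only [Set.mem_image, Set.mem_ofPred_eq]
    have e : ∀ n, spell (List.replicate n (u.map ab)).flatten =
        (List.replicate n (word u)).flatten := by
      intro n
      rw [← word_replicate, word, List.map_flatten, List.map_replicate]
    constructor
    · rintro ⟨_, ⟨n, rfl⟩, rfl⟩
      exact ⟨n, e n⟩
    · rintro ⟨n, rfl⟩
      exact ⟨_, ⟨n, rfl⟩, e n⟩
  · rintro _ ⟨n, rfl⟩
    refine ⟨0, fun q x hx => ⟨trivial, ?_⟩⟩
    have hq : q < n * u.length := by simpa using (List.getElem?_eq_some_iff.1 hx).1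
    rw [key n q hq, Option.some.injEq] at hx
    simpa using hx.symm
  · intro i m _
    have hpos' : (0 : ℤ) < u.length := by exact_mod_cast hpos
    have hs := Int.emod_nonneg i hpos'.ne'
    -- The window is moved to start at the residue of `i`. A copy of `u` has length at least one, so
    -- this many copies contain it.
    refine ⟨_, ⟨(i % u.length).toNat + m + 1, rfl⟩, (i % u.length).toNat, fun k hk => ?_⟩
    rw [key]
    · have := eq_of_periodic hp (i % u.length + k) (i / u.length)
      rw [show i % (u.length : ℤ) + k + u.length * (i / u.length) = i + k by
        rw [add_right_comm, Int.emod_add_mul_ediv]] at this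
      show _ = some (ab (h (i + k)))
      rw [this]
      push_cast
      rw [Int.toNat_of_nonneg hs]
    · calc _ < (i % u.length).toNat + m + 1 := by omega
        _ ≤ _ := Nat.le_mul_of_pos_right _ hpos

/-! ### Kisses in terms of height functions. -/

/-- A discrete intermediate value theorem: a sequence that climbs by at most one per step cannot
jump over level `c`. The run ends just before the first value above `c` and is extended to the left
as far as possible. `L` and `R` stand for conditions that replace a missing rise when the run
touches the boundary of the window. -/
theorem exists_run {D : ℕ → ℤ} {K : ℕ} {c : ℤ} {L R : Prop}
    (step : ∀ k < K, D (k + 1) ≤ D k + 1) (h0 : D 0 < c ∨ D 0 ≤ c ∧ L)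
    (h1 : c < D K ∨ c ≤ D K ∧ R) :
    ∃ i j, i ≤ j ∧ j ≤ K ∧ (∀ k, i ≤ k → k ≤ j → D k = c) ∧
      (i = 0 ∧ L ∨ 0 < i ∧ D (i - 1) = c - 1) ∧ (j = K ∧ R ∨ j < K ∧ D (j + 1) = c + 1) := by
  classical
  have hj : ∃ j ≤ K, (∀ k ≤ j, D k ≤ c) ∧ D j = c ∧ (j = K ∧ R ∨ j < K ∧ D (j + 1) = c + 1) := by
    by_cases h : ∃ k, k ≤ K ∧ c < D k
    · obtain ⟨hk, hk'⟩ := Nat.find_spec h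
      have hmin : ∀ k < Nat.find h, D k ≤ c := fun k hk => by
        by_contra hc
        exact Nat.find_min h hk ⟨by omega, by omega⟩
      have hpos : 0 < Nat.find h := by
        rcases Nat.eq_zero_or_pos (Nat.find h) with h' | h'
        · rw [h'] at hk'; omega
        · exact h'
      obtain ⟨j, hj⟩ : ∃ j, Nat.find h = j + 1 := ⟨Nat.find h - 1, by omega⟩
      rw [hj] at hk hk' hmin
      have := step j (by omega)
      have := hmin j (by omega)
      exact ⟨j, by omega, fun k hk => hmin k (by omega), by omega, Or.inr ⟨by omega, by omega⟩⟩
    · push Not at h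
      have := h K le_rfl
      rcases h1 with h1 | ⟨h1, hR⟩
      · omega
      · exact ⟨K, le_rfl, h, by omega, Or.inl ⟨rfl, hR⟩⟩
  obtain ⟨j, hjK, hle, hjc, hR⟩ := hj
  have hex : ∃ i, i ≤ j ∧ ∀ k, i ≤ k → k ≤ j → D k = c :=
    ⟨j, le_rfl, fun k h1 h2 => by obtain rfl : k = j := le_antisymm h2 h1; exact hjc⟩
  obtain ⟨hi, hi'⟩ := Nat.find_spec hex
  refine ⟨Nat.find hex, j, hi, hjK, hi', ?_, hR⟩
  rcases Nat.eq_zero_or_pos (Nat.find hex) with h' | h'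
  · left
    refine ⟨h', ?_⟩
    have := hi' 0 (by omega) (by omega)
    rcases h0 with h0 | h0
    · omega
    · exact h0.2
  · right
    refine ⟨h', ?_⟩
    have e : Nat.find hex - 1 + 1 = Nat.find hex := by omega
    have h2 := step (Nat.find hex - 1) (by omega)
    rw [e, hi' _ le_rfl hi] at h2
    have h3 := hle (Nat.find hex - 1) (by omega)
    have h4 : D (Nat.find hex - 1) ≠ c := by
      intro hc
      refine Nat.find_min hex (m := Nat.find hex - 1) (by omega) ⟨by omega, fun k hk hk' => ?_⟩
      rcases Nat.lt_or_ge k (Nat.find hex) with h | h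
      · obtain rfl : k = Nat.find hex - 1 := by omega
        exact hc
      · exact hi' k h hk'
    omega

/-- Whether the height function `Q` increases between `p` and `p + 1`. -/
def up (Q : ℤ → ℤ) (p : ℤ) : Bool := decide (Q (p + 1) = Q p + 1)

theorem val_ab (x : Bool) : (ab x).val = if x then 2 else 1 := by cases x <;> rfl

theorem ab_injective {x y : Bool} (h : ab x = ab y) : x = y := by
  revert h; revert x y; decide

/-- `Q` counts the letters `b` among the letters `f p`, for `p ∈ D`; the letters that are not of
the form `a` or `b` are at the ends of `D` and have value `0`. -/
structure Profile (D : Set ℤ) (f : ℤ → Letter) (Q : ℤ → ℤ) : Prop where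
  step : ∀ p, Q (p + 1) = Q p ∨ Q (p + 1) = Q p + 1
  interior : ∀ p, p - 1 ∈ D → p ∈ D → p + 1 ∈ D → f p = ab (up Q p)
  ends : ∀ p ∈ D, f p = ab (up Q p) ∨ (f p).val = 0

theorem val_ab_up {Q : ℤ → ℤ} (h : ∀ p, Q (p + 1) = Q p ∨ Q (p + 1) = Q p + 1) (p : ℤ) :
    (ab (up Q p)).val = 1 + Q (p + 1) - Q p := by
  rw [val_ab, up]
  rcases h p with h | h <;> simp [h]
  omega

theorem Profile.val_nonneg {D : Set ℤ} {f : ℤ → Letter} {Q : ℤ → ℤ} (h : Profile D f Q) {p : ℤ}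
    (hp : p ∈ D) : 0 ≤ (f p).val := by
  rcases h.ends p hp with h1 | h1
  · rw [h1, val_ab]; split_ifs <;> norm_num
  · omega

/-- The difference of heights rises in a step exactly when `f` reads `b` and `g` reads `a`, and it
is constant exactly while both read the same letter. So a run at level `c` between two rises, as
given by `exists_run`, is a kiss. At either end of the window a suitable pair of letters, possibly
from a fringe, may take the place of the rise. -/
theorem kissFun_of_rise {D E : Set ℤ} {f g : ℤ → Letter} {Qs Qt : ℤ → ℤ} (p q : ℤ) (K : ℕ) (c : ℤ)
    (hs : ∀ p, Qs (p + 1) = Qs p ∨ Qs (p + 1) = Qs p + 1)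
    (ht : ∀ p, Qt (p + 1) = Qt p ∨ Qt (p + 1) = Qt p + 1)
    (hw : ∀ k : ℕ, k < K → p + k ∈ D ∧ q + k ∈ E ∧ f (p + k) = ab (up Qs (p + k)) ∧
      g (q + k) = ab (up Qt (q + k)))
    (h0 : Qs p - Qt q < c ∨ Qs p - Qt q ≤ c ∧
      (p - 1 ∈ D ∧ q - 1 ∈ E ∧ (g (q - 1)).val < (f (p - 1)).val))
    (h1 : c < Qs (p + K) - Qt (q + K) ∨ c ≤ Qs (p + K) - Qt (q + K) ∧
      (p + K ∈ D ∧ q + K ∈ E ∧ (g (q + K)).val < (f (p + K)).val)) :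
    KissFun D f E g := by
  obtain ⟨i, j, hij, hjK, hrun, hL, hR⟩ := exists_run (D := fun k : ℕ => Qs (p + k) - Qt (q + k))
    (K := K) (c := c) (L := p - 1 ∈ D ∧ q - 1 ∈ E ∧ (g (q - 1)).val < (f (p - 1)).val)
    (R := p + K ∈ D ∧ q + K ∈ E ∧ (g (q + K)).val < (f (p + K)).val) (by
      intro k _
      have e1 := hs (p + k)
      have e2 := ht (q + k)
      push_cast
      rw [← add_assoc, ← add_assoc]
      omega) (by simpa using h0) h1
  have left : p + i - 1 ∈ D ∧ q + i - 1 ∈ E ∧ (g (q + i - 1)).val < (f (p + i - 1)).val := by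
    rcases hL with ⟨rfl, h⟩ | ⟨hi, h⟩
    · simpa using h
    · obtain ⟨a1, a2, a3, a4⟩ := hw (i - 1) (by omega)
      have h' := hrun i le_rfl hij
      have e : ((i - 1 : ℕ) : ℤ) = i - 1 := by omega
      simp only [e] at h a1 a2 a3 a4
      rw [← add_sub_assoc, ← add_sub_assoc] at h
      rw [← add_sub_assoc] at a1 a2 a3 a4
      refine ⟨a1, a2, ?_⟩
      rw [a3, a4, val_ab_up hs, val_ab_up ht, sub_add_cancel, sub_add_cancel]
      linarith
  have right : p + j ∈ D ∧ q + j ∈ E ∧ (g (q + j)).val < (f (p + j)).val := by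
    rcases hR with ⟨rfl, h⟩ | ⟨hi, h⟩
    · exact h
    · obtain ⟨a1, a2, a3, a4⟩ := hw j (by omega)
      have h' := hrun j hij le_rfl
      refine ⟨a1, a2, ?_⟩
      push_cast at h
      rw [← add_assoc, ← add_assoc] at h
      rw [a3, a4, val_ab_up hs, val_ab_up ht]
      linarith
  refine ⟨p + i - 1, q + i - 1, j - i, ?_, left.2.2, ?_, ?_⟩
  · intro k hk
    rcases Nat.eq_zero_or_pos k with rfl | hk0
    · simpa using ⟨left.1, left.2.1⟩
    · have e1 : p + i - 1 + k = p + (i + k - 1 : ℕ) := by omega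
      have e2 : q + i - 1 + k = q + (i + k - 1 : ℕ) := by omega
      rw [e1, e2]
      rcases Nat.lt_or_ge (i + k - 1) j with h | h
      · exact ⟨(hw _ (by omega)).1, (hw _ (by omega)).2.1⟩
      · obtain h : i + k - 1 = j := by omega
        rw [h]
        exact ⟨right.1, right.2.1⟩
  · intro k hk
    have e1 : p + i - 1 + 1 + k = p + (i + k : ℕ) := by push_cast; ring
    have e2 : q + i - 1 + 1 + k = q + (i + k : ℕ) := by push_cast; ring
    rw [e1, e2]
    obtain ⟨-, -, a3, a4⟩ := hw (i + k) (by omega)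
    rw [a3, a4]
    have r1 := hrun (i + k) (by omega) (by omega)
    have r2 := hrun (i + k + 1) (by omega) (by omega)
    rw [Nat.cast_succ, ← add_assoc, ← add_assoc] at r2
    congr 1
    rw [up, up, decide_eq_decide]
    omega
  · have e1 : p + i - 1 + (j - i : ℕ) + 1 = p + j := by omega
    have e2 : q + i - 1 + (j - i : ℕ) + 1 = q + j := by omega
    rw [e1, e2]
    exact right.2.2

/-- The converse reading, used to exclude kisses: the height difference is constant along the common
part and rises at both sides, unless the lower letter there is a fringe passage of value 0. -/
theorem Profile.kiss_data {D E : Set ℤ} {f g : ℤ → Letter} {Qs Qt : ℤ → ℤ}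
    (hs : Profile D f Qs) (ht : Profile E g Qt) (h : KissFun D f E g) :
    ∃ (p q : ℤ) (m : ℕ), p - 1 ∈ D ∧ q - 1 ∈ E ∧ (∀ k : ℕ, k ≤ m → p + k ∈ D ∧ q + k ∈ E) ∧
      (∀ k : ℕ, k ≤ m → Qs (p + k) - Qt (q + k) = Qs p - Qt q) ∧
      0 < (f (p - 1)).val ∧ 0 < (f (p + m)).val ∧
      ((g (q - 1)).val = 0 ∨ Qs p = Qs (p - 1) + 1 ∧ Qt q = Qt (q - 1)) ∧
      ((g (q + m)).val = 0 ∨ Qs (p + m + 1) = Qs (p + m) + 1 ∧ Qt (q + m + 1) = Qt (q + m)) := by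
  obtain ⟨i, j, m, hD, hl, hm, hr⟩ := h
  have drop : ∀ i' j', i' ∈ D → j' ∈ E → (g j').val < (f i').val →
      (g j').val = 0 ∨ Qs (i' + 1) = Qs i' + 1 ∧ Qt (j' + 1) = Qt j' := by
    intro i' j' hi' hj' hlt
    rcases ht.ends j' hj' with h1 | h1
    · right
      rcases hs.ends i' hi' with h2 | h2
      · rw [h1, h2, val_ab_up hs.step, val_ab_up ht.step] at hlt
        have := hs.step i'
        have := ht.step j'
        omega
      · have := ht.val_nonneg hj'
        omega
    · exact Or.inl h1
  have e1 := hD 0 (by omega)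
  have e2 := hD (m + 1) le_rfl
  simp only [Nat.cast_zero, add_zero] at e1
  push_cast at e2
  rw [← add_assoc, ← add_assoc] at e2
  have d1 := drop i j e1.1 e1.2 hl
  have d2 := drop _ _ e2.1 e2.2 hr
  have n1 := ht.val_nonneg e1.2
  have n2 := ht.val_nonneg e2.2
  have c1 : i + 1 - 1 = i := by ring
  have c2 : j + 1 - 1 = j := by ring
  have c3 : i + 1 + m = i + m + 1 := by ring
  have c4 : j + 1 + m = j + m + 1 := by ring
  refine ⟨i + 1, j + 1, m, ?_, ?_, ?_, ?_, ?_, ?_, ?_, ?_⟩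
  · rw [c1]; exact e1.1
  · rw [c2]; exact e1.2
  · intro k hk
    have := hD (k + 1) (by omega)
    push_cast at this
    rwa [show i + 1 + (k : ℤ) = i + (k + 1) by ring, show j + 1 + (k : ℤ) = j + (k + 1) by ring]
  · intro k hk
    induction k with
    | zero => simp
    | succ k ih =>
      have ih := ih (by omega)
      have a1 := hD k (by omega)
      have a2 := hD (k + 1) (by omega)
      have a3 := hD (k + 2) (by omega)
      push_cast at a2 a3
      have i1 := hs.interior (i + 1 + k) (by convert a1.1 using 1; ring)
        (by convert a2.1 using 1; ring) (by convert a3.1 using 1; ring)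
      have i2 := ht.interior (j + 1 + k) (by convert a1.2 using 1; ring)
        (by convert a2.2 using 1; ring) (by convert a3.2 using 1; ring)
      have := hm k (by omega)
      rw [i1, i2] at this
      have := ab_injective this
      rw [up, up, decide_eq_decide] at this
      have s1 := hs.step (i + 1 + k)
      have s2 := ht.step (j + 1 + k)
      push_cast
      rw [← add_assoc, ← add_assoc]
      omega
  · rw [c1]; omega
  · rw [c3]; omega
  · rw [c1, c2]; exact d1
  · rw [c3, c4]; exact d2

/-! ### Height functions close to a line. -/

/-- The height function of the route `l` with `n` inner passages and final height `c + 1`: its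
graph is the lowest one that runs strictly above the line of slope `c / n`. -/
structure LinearL (n : ℕ) (c : ℤ) (Q : ℤ → ℤ) : Prop where
  pos : 0 < n
  step : ∀ p, Q (p + 1) = Q p ∨ Q (p + 1) = Q p + 1
  zero : Q 0 = 0
  last : Q n = c + 1
  lower : ∀ p : ℤ, 1 ≤ p → p < n → 1 ≤ n * Q p - p * c
  upper : ∀ p : ℤ, 1 ≤ p → p < n → n * Q p - p * c ≤ n - 1

/-- The height function of the band of slope `c / n`. -/
structure LinearB (n : ℕ) (c : ℤ) (Q : ℤ → ℤ) : Prop where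
  pos : 0 < n
  step : ∀ p, Q (p + 1) = Q p ∨ Q (p + 1) = Q p + 1
  lower : ∀ p, 0 ≤ n * Q p - p * c
  upper : ∀ p, n * Q p - p * c ≤ n - 1

/-- The letters of a route from the left fringe to itself. -/
abbrev lFun (n : ℕ) (Q : ℤ → ℤ) : ℤ → Letter := routeFun false false n (up Q)

/-- The letters of a band. -/
abbrev bFun (Q : ℤ → ℤ) : ℤ → Letter := fun p => ab (up Q p)

theorem lFun_val_eq_zero_iff {n : ℕ} {Q : ℤ → ℤ} {p : ℤ} :
    (lFun n Q p).val = 0 ↔ p < 0 ∨ n ≤ p := by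
  rw [lFun, routeFun]
  split_ifs with h1 h2
  · simp_all
  · simp_all [Letter.val]
  · rw [val_ab]
    constructor
    · intro h; split_ifs at h <;> omega
    · rintro (h | h) <;> omega
  · simp_all
  · simp_all [Letter.val]

theorem profile_l {n : ℕ} {Q : ℤ → ℤ} (h : ∀ p, Q (p + 1) = Q p ∨ Q (p + 1) = Q p + 1) :
    Profile (Set.Icc (-1) n) (lFun n Q) Q := by
  have key : ∀ p : ℤ, 0 ≤ p → p < n → lFun n Q p = ab (up Q p) := by
    intro p h1 h2
    rw [lFun, routeFun, if_neg (by omega), if_pos h2]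
  refine ⟨h, fun p h1 _ h3 => key p ?_ ?_, fun p _ => ?_⟩
  · have := h1.1; omega
  · have := h3.2; omega
  · by_cases hp : p < 0 ∨ n ≤ p
    · exact Or.inr (lFun_val_eq_zero_iff.2 hp)
    · exact Or.inl (key p (by omega) (by omega))

theorem profile_b {Q : ℤ → ℤ} (h : ∀ p, Q (p + 1) = Q p ∨ Q (p + 1) = Q p + 1) :
    Profile Set.univ (bFun Q) Q :=
  ⟨h, fun _ _ _ _ => rfl, fun _ _ => Or.inl rfl⟩

theorem LinearL.nonneg {n : ℕ} {c : ℤ} {Q : ℤ → ℤ} (h : LinearL n c Q) {p : ℤ} (h0 : 0 ≤ p)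
    (h1 : p ≤ n) : 0 ≤ n * Q p - p * c := by
  rcases h0.eq_or_lt with rfl | h0
  · simp [h.zero]
  · rcases h1.eq_or_lt with rfl | h1
    · rw [h.last]; ring_nf; positivity
    · have := h.lower p (by omega) h1; omega

theorem LinearL.one_le {n : ℕ} {c : ℤ} {Q : ℤ → ℤ} (h : LinearL n c Q) {p : ℤ} (h0 : 1 ≤ p)
    (h1 : p ≤ n) : 1 ≤ n * Q p - p * c := by
  rcases h1.eq_or_lt with rfl | h1
  · have := h.pos
    rw [h.last]; ring_nf; exact_mod_cast this
  · exact h.lower p (by omega) h1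

theorem LinearL.le {n : ℕ} {c : ℤ} {Q : ℤ → ℤ} (h : LinearL n c Q) {p : ℤ} (h0 : 0 ≤ p)
    (h1 : p ≤ n) : n * Q p - p * c ≤ n := by
  rcases h0.eq_or_lt with rfl | h0
  · simp [h.zero]
  · rcases h1.eq_or_lt with rfl | h1
    · rw [h.last]; ring_nf; rfl
    · have := h.upper p (by omega) h1; omega

theorem LinearL.le_sub_one {n : ℕ} {c : ℤ} {Q : ℤ → ℤ} (h : LinearL n c Q) {p : ℤ} (h0 : 0 ≤ p)
    (h1 : p < n) : n * Q p - p * c ≤ n - 1 := by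
  rcases h0.eq_or_lt with rfl | h0
  · have := h.pos
    simp [h.zero]; omega
  · exact h.upper p (by omega) h1

/-- The quantity `H` compares the deviations of the two graphs from their lines, scaled to the
common denominator `n * n'`. Advancing by one along the common part lowers it by `δ`. The bounds on
the deviations make `H` large at the left end of a kiss and small at its right end, and for `δ ≤ 1`
the common part is too short for such a drop. -/
theorem not_kissFun_l_l {n n' : ℕ} {c c' : ℤ} {Q Q' : ℤ → ℤ} (hs : LinearL n' c' Q')
    (ht : LinearL n c Q) (hd : n * c' - c * n' ≤ 1) :
    ¬ KissFun (Set.Icc (-1) n') (lFun n' Q') (Set.Icc (-1) n) (lFun n Q) := by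
  intro h
  obtain ⟨p, q, m, hp, hq, hD, hrun, v1, v2, hL, hR⟩ :=
    (profile_l hs.step).kiss_data (profile_l ht.step) h
  have w1 : ¬ (p - 1 < 0 ∨ (n' : ℤ) ≤ p - 1) := fun h => by
    have := lFun_val_eq_zero_iff (Q := Q').2 h
    omega
  have w2 : ¬ (p + m < 0 ∨ (n' : ℤ) ≤ p + m) := fun h => by
    have := lFun_val_eq_zero_iff (Q := Q').2 h
    omega
  have hq0 := hq.1
  have hq1 := (hD m le_rfl).2.2
  set δ := n * c' - c * n' with hδ
  set H := n * (n' * Q' p - p * c') - n' * (n * Q q - q * c) with hH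
  have hn := ht.pos
  have hn' := hs.pos
  have hrm := hrun m le_rfl
  -- the two bounds at the left end of the run
  have left : (q = 0 ∧ (n : ℤ) ≤ H) ∨ (1 ≤ q ∧ (n' : ℤ) ≤ H + δ) := by
    by_cases hq' : q = 0
    · left
      refine ⟨hq', ?_⟩
      have := hs.one_le (p := p) (by omega) (by omega)
      rw [hH, hq', ht.zero]
      nlinarith
    · right
      refine ⟨by omega, ?_⟩
      rcases hL with hL | ⟨l1, l2⟩
      · rw [lFun_val_eq_zero_iff] at hL; omega
      · have a1 := hs.nonneg (p := p - 1) (by omega) (by omega)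
        have a2 := ht.le_sub_one (p := q - 1) (by omega) (by omega)
        have e : H + δ = n * n' + n * (n' * Q' (p - 1) - (p - 1) * c') -
            n' * (n * Q (q - 1) - (q - 1) * c) := by
          rw [hH, hδ, l1, l2]; ring
        rw [e]
        nlinarith
  have right : (q + m = n ∧ H - m * δ ≤ -n) ∨ (q + m < n ∧ H - (m + 1) * δ ≤ -n') := by
    by_cases hq' : q + m = n
    · left
      refine ⟨hq', ?_⟩
      have a1 := hs.le_sub_one (p := p + m) (by omega) (by omega)
      have a2 : Q (q + m) = c + 1 := by rw [hq', ht.last]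
      have e : H - m * δ = n * (n' * Q' (p + m) - (p + m) * c') -
            n' * (n * Q (q + m) - (q + m) * c) := by
        rw [hH, hδ, show Q' (p + m) = Q' p - Q q + Q (q + m) by linarith]; ring
      rw [e, a2, hq']
      nlinarith
    · right
      refine ⟨by omega, ?_⟩
      rcases hR with hR | ⟨l1, l2⟩
      · rw [lFun_val_eq_zero_iff] at hR; omega
      · have a1 := hs.le (p := p + m + 1) (by omega) (by omega)
        have a2 := ht.one_le (p := q + m + 1) (by omega) (by omega)
        have e : H - (m + 1) * δ = n * (n' * Q' (p + m + 1) - (p + m + 1) * c') -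
            n' * (n * Q (q + m + 1) - (q + m + 1) * c) - n * n' := by
          rw [l1, l2, hH, hδ, show Q' (p + m) = Q' p - Q q + Q (q + m) by linarith]; ring
        rw [e]
        nlinarith
  -- Each combination of the left and right bounds now contradicts `m ≤ n` or, when neither end is
  -- at a fringe of `Q`, `m ≤ n' - 2`.
  have hmδ : (m : ℤ) * δ ≤ m := by nlinarith
  have e : ((m : ℤ) + 1) * δ = m * δ + δ := by ring
  rw [e] at right
  omega

/-- For equal slopes the scaled difference `H` of deviations is constant along the common part; its
left end forces `0 ≤ H` and its right end `H < 0`. -/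
theorem not_kissFun_b_l {n n' : ℕ} {c c' : ℤ} {Q Q' : ℤ → ℤ} (hs : LinearB n' c' Q')
    (ht : LinearL n c Q) (hd : n * c' - c * n' = 0) :
    ¬ KissFun Set.univ (bFun Q') (Set.Icc (-1) n) (lFun n Q) := by
  intro h
  obtain ⟨p, q, m, hp, hq, hD, hrun, v1, v2, hL, hR⟩ :=
    (profile_b hs.step).kiss_data (profile_l ht.step) h
  have hq0 := hq.1
  have hq1 := (hD m le_rfl).2.2
  set H := n * (n' * Q' p - p * c') - n' * (n * Q q - q * c) with hH
  have hn := ht.pos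
  have hn' := hs.pos
  have hrm := hrun m le_rfl
  have hc : n * c' = c * n' := by linarith
  have left : 0 ≤ H := by
    by_cases hq' : q = 0
    · have := hs.lower p
      rw [hH, hq', ht.zero]
      nlinarith
    · rcases hL with hL | ⟨l1, l2⟩
      · rw [lFun_val_eq_zero_iff] at hL; omega
      · have a1 := hs.lower (p - 1)
        have a2 := ht.le_sub_one (p := q - 1) (by omega) (by omega)
        have e : H = n * n' + n * (n' * Q' (p - 1) - (p - 1) * c') -
            n' * (n * Q (q - 1) - (q - 1) * c) := by
          rw [hH, l1, l2]; linear_combination -hc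
        rw [e]
        nlinarith
  have right : H < 0 := by
    by_cases hq' : q + m = n
    · have a1 := hs.upper (p + m)
      have a2 : Q (q + m) = c + 1 := by rw [hq', ht.last]
      have e : H = n * (n' * Q' (p + m) - (p + m) * c') -
            n' * (n * Q (q + m) - (q + m) * c) := by
        rw [hH, show Q' (p + m) = Q' p - Q q + Q (q + m) by linarith]
        linear_combination m * hc
      rw [e, a2, hq']
      nlinarith
    · rcases hR with hR | ⟨l1, l2⟩
      · rw [lFun_val_eq_zero_iff] at hR; omega
      · have a1 := hs.upper (p + m + 1)
        have a2 := ht.one_le (p := q + m + 1) (by omega) (by omega)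
        have e : H = n * (n' * Q' (p + m + 1) - (p + m + 1) * c') -
            n' * (n * Q (q + m + 1) - (q + m + 1) * c) - n * n' := by
          rw [l1, l2, hH, show Q' (p + m) = Q' p - Q q + Q (q + m) by linarith]
          linear_combination (m + 1) * hc
        rw [e]
        nlinarith
  omega

/-- The same invariant with a band below. The upper word enters only through bounds at its letters
of positive value, so the lemma serves routes and bands alike. -/
theorem not_kissFun_to_b {D : Set ℤ} {f : ℤ → Letter} {n n' : ℕ} {c c' : ℤ} {Q Q' : ℤ → ℤ}
    (hf : Profile D f Q') (hn' : 0 < n') (h1 : ∀ p, p ∈ D → 0 < (f p).val →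
      0 ≤ n' * Q' p - p * c' ∧ n' * Q' (p + 1) - (p + 1) * c' ≤ n')
    (ht : LinearB n c Q) (hd : n * c' - c * n' = 0) :
    ¬ KissFun D f Set.univ (bFun Q) := by
  intro h
  obtain ⟨p, q, m, hp, hq, hD, hrun, v1, v2, hL, hR⟩ := hf.kiss_data (profile_b ht.step) h
  set H := n * (n' * Q' p - p * c') - n' * (n * Q q - q * c) with hH
  have hn := ht.pos
  have hrm := hrun m le_rfl
  have hc : n * c' = c * n' := by linarith
  have pos : ∀ x, (ab x).val ≠ 0 := by intro x; cases x <;> decide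
  rcases hL with hL | ⟨l1, l2⟩
  · exact pos _ hL
  rcases hR with hR | ⟨r1, r2⟩
  · exact pos _ hR
  have left : 0 < H := by
    have a1 := (h1 (p - 1) hp v1).1
    have a2 := ht.upper (q - 1)
    have e : H = n * n' + n * (n' * Q' (p - 1) - (p - 1) * c') -
        n' * (n * Q (q - 1) - (q - 1) * c) := by
      rw [hH, l1, l2]; linear_combination -hc
    rw [e]
    nlinarith
  have right : H ≤ 0 := by
    have a1 := (h1 (p + m) (hD m le_rfl).1 v2).2
    have a2 := ht.lower (q + m + 1)
    have e : H = n * (n' * Q' (p + m + 1) - (p + m + 1) * c') -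
        n' * (n * Q (q + m + 1) - (q + m + 1) * c) - n * n' := by
      rw [r1, r2, hH, show Q' (p + m) = Q' p - Q q + Q (q + m) by linarith]
      linear_combination (m + 1) * hc
    rw [e]
    nlinarith
  omega

theorem not_kissFun_l_b {n n' : ℕ} {c c' : ℤ} {Q Q' : ℤ → ℤ} (hs : LinearL n' c' Q')
    (ht : LinearB n c Q) (hd : n * c' - c * n' = 0) :
    ¬ KissFun (Set.Icc (-1) n') (lFun n' Q') Set.univ (bFun Q) := by
  refine not_kissFun_to_b (profile_l hs.step) hs.pos (fun p hp hv => ?_) ht hd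
  have : ¬ (p < 0 ∨ (n' : ℤ) ≤ p) := fun h => by
    have := lFun_val_eq_zero_iff (Q := Q').2 h
    omega
  exact ⟨hs.nonneg (by omega) (by omega), hs.le (by omega) (by omega)⟩

theorem not_kissFun_b_b {n n' : ℕ} {c c' : ℤ} {Q Q' : ℤ → ℤ} (hs : LinearB n' c' Q')
    (ht : LinearB n c Q) (hd : n * c' - c * n' = 0) :
    ¬ KissFun Set.univ (bFun Q') Set.univ (bFun Q) := by
  refine not_kissFun_to_b (profile_b hs.step) hs.pos (fun p _ _ => ?_) ht hd
  have := hs.upper (p + 1)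
  exact ⟨hs.lower p, by linarith⟩

theorem lFun_interior {n : ℕ} {Q : ℤ → ℤ} {p : ℤ} (h0 : 0 ≤ p) (h1 : p < n) :
    lFun n Q p = ab (up Q p) := by
  rw [lFun, routeFun, if_neg (by omega), if_pos h1]

theorem val_ab_pos (x : Bool) : 0 < (ab x).val := by cases x <;> decide

/-! ### Kisses forced by the slopes. -/

/-- The solutions of `n * C - c * N = 1` differ by multiples of `(n, c)`, which change the second
determinant by multiples of `δ`; so it can be reduced to a remainder modulo `δ`. -/
theorem exists_lattice_point {n n' c c' : ℤ} (hn : 0 < n) (hn' : 0 < n') (hco : IsCoprime n c)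
    (hco' : IsCoprime n' c') (hd : 2 ≤ n * c' - c * n') :
    ∃ N C : ℤ, n * C - c * N = 1 ∧ 1 ≤ N * c' - C * n' ∧
      N * c' - C * n' ≤ n * c' - c * n' - 1 ∧ 1 ≤ N ∧ N + 1 ≤ n + n' := by
  obtain ⟨a, b, hab⟩ := hco
  set δ := n * c' - c * n' with hδ
  set t := (-b * c' - a * n') / δ with ht
  have hmod := Int.emod_add_mul_ediv (-b * c' - a * n') δ
  have h0 := Int.emod_nonneg (-b * c' - a * n') (b := δ) (by omega)
  have h1 := Int.emod_lt_of_pos (-b * c' - a * n') (b := δ) (by omega)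
  set e := (-b * c' - a * n') % δ with he
  have hN : n * (a - t * c) - c * (-b - t * n) = 1 := by linear_combination hab
  have hE : (-b - t * n) * c' - (a - t * c) * n' = e := by
    linear_combination (-1 : ℤ) * hmod + t * hδ
  -- If the remainder vanished, `(N, C)` would be an integer multiple of the primitive vector `(n',
  -- c')`, and `δ ≥ 2` would divide 1.
  have he0 : e ≠ 0 := by
    intro h
    rw [h] at hE
    have hdvd : n' ∣ (-b - t * n) := by
      refine hco'.dvd_of_dvd_mul_right ⟨a - t * c, ?_⟩
      linear_combination hE
    obtain ⟨μ, hμ⟩ := hdvd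
    have hC : a - t * c = μ * c' := by
      rw [hμ] at hE
      have : n' * (a - t * c) = n' * (μ * c') := by linear_combination -hE
      exact mul_left_cancel₀ hn'.ne' this
    rw [hμ, hC] at hN
    have : δ * μ = 1 := by rw [hδ]; linear_combination hN
    have := Int.le_of_dvd one_pos (Dvd.intro _ this)
    omega
  have i1 : δ * (-b - t * n) = n * e + n' := by
    linear_combination n * hE + n' * hN + (-b - t * n) * hδ
  refine ⟨-b - t * n, a - t * c, hN, by omega, by omega, ?_, ?_⟩
  · by_contra hc
    have : n * e ≥ 0 := by positivity
    nlinarith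
  · by_contra hc
    have : -b - t * n ≥ n + n' := by omega
    nlinarith

/-- The graph of `Q'` is translated so that `(n', c')` lands on the lattice point `(N, C)` of
`exists_lattice_point`. Over the common part of the domains the translated graph then passes from
below to above the graph of `Q`; where `Q` begins or ends inside that range, its fringe passage is
the lower letter of the kiss. -/
theorem kissFun_l_l {n n' : ℕ} {c c' : ℤ} {Q Q' : ℤ → ℤ} (hs : LinearL n' c' Q')
    (ht : LinearL n c Q) (hco : IsCoprime (n : ℤ) c) (hco' : IsCoprime (n' : ℤ) c')
    (hd : 2 ≤ n * c' - c * n') :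
    KissFun (Set.Icc (-1) n') (lFun n' Q') (Set.Icc (-1) n) (lFun n Q) := by
  have hn : (0 : ℤ) < n := by exact_mod_cast ht.pos
  have hn' : (0 : ℤ) < n' := by exact_mod_cast hs.pos
  obtain ⟨N, C, h1, h2, h3, h4, h5⟩ := exists_lattice_point hn hn' hco hco' hd
  -- The interval from `q` to `r` is the intersection of `[0, n]` with the translated domain `[N -
  -- n', N]`.
  set q := max 0 (N - n') with hq
  set r := min (n : ℤ) N with hr
  have hqr : q ≤ r := by omega
  have hK : ((r - q).toNat : ℤ) = r - q := by omega
  refine kissFun_of_rise (q - N + n') q (r - q).toNat (c' - C) hs.step ht.step ?_ ?_ ?_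
  · intro k hk
    have hk' : (k : ℤ) < r - q := by omega
    refine ⟨⟨by omega, by omega⟩, ⟨by omega, by omega⟩, lFun_interior (by omega) (by omega),
      lFun_interior (by omega) (by omega)⟩
  · by_cases hN : N < n'
    · right
      have q0 : q = 0 := by omega
      rw [q0]
      refine ⟨?_, ⟨by omega, by omega⟩, ⟨by omega, by omega⟩, ?_⟩
      · have := hs.le_sub_one (p := 0 - N + n') (by omega) (by omega)
        rw [ht.zero]
        by_contra hc
        have : c' - C + 1 ≤ Q' (0 - N + n') := by omega
        nlinarith
      · rw [lFun_interior (Q := Q') (p := 0 - N + n' - 1) (by omega) (by omega),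
          lFun_val_eq_zero_iff.2 (Or.inl (by omega))]
        exact val_ab_pos _
    · left
      have q0 : q = N - n' := by omega
      rw [q0, show N - n' - N + (n' : ℤ) = 0 by ring, hs.zero]
      have := ht.nonneg (p := N - n') (by omega) (by omega)
      by_contra hc
      have : Q (N - n') ≤ C - c' := by omega
      nlinarith
  · rw [hK, show q - N + n' + (r - q) = r - N + n' by ring, show q + (r - q) = r by ring]
    by_cases hN : n < N
    · right
      have r0 : r = n := by omega
      rw [r0]
      refine ⟨?_, ⟨by omega, by omega⟩, ⟨by omega, by omega⟩, ?_⟩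
      · have := hs.one_le (p := n - N + n') (by omega) (by omega)
        rw [ht.last]
        by_contra hc
        have : Q' (n - N + n') ≤ c' - C + c := by omega
        nlinarith
      · rw [lFun_interior (Q := Q') (p := n - N + n') (by omega) (by omega),
          lFun_val_eq_zero_iff.2 (Or.inr (by omega))]
        exact val_ab_pos _
    · left
      have r0 : r = N := by omega
      rw [r0, show N - N + (n' : ℤ) = n' by ring, hs.last]
      have := ht.le (p := N) (by omega) (by omega)
      by_contra hc
      have : C + 1 ≤ Q N := by omega
      nlinarith

theorem kissFun_b_b {n n' : ℕ} {c c' : ℤ} {Q Q' : ℤ → ℤ} (hs : LinearB n' c' Q')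
    (ht : LinearB n c Q) (hd : 0 < n * c' - c * n') :
    KissFun Set.univ (bFun Q') Set.univ (bFun Q) := by
  have hn : (0 : ℤ) < n := by exact_mod_cast ht.pos
  have hn' : (0 : ℤ) < n' := by exact_mod_cast hs.pos
  have l1 := hs.upper 0
  have l2 := ht.lower 0
  have u1 := hs.lower (2 * n * n')
  have u2 := ht.upper (2 * n * n')
  have a1 : Q' 0 ≤ 0 := by nlinarith
  have a2 : 0 ≤ Q 0 := by nlinarith
  have a3 : 2 * n * c' ≤ Q' (2 * n * n') := by
    by_contra hc
    have : Q' (2 * n * n') ≤ 2 * n * c' - 1 := by omega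
    nlinarith
  have a4 : Q (2 * n * n') ≤ 2 * c * n' := by
    by_contra hc
    have : 2 * c * n' + 1 ≤ Q (2 * n * n') := by omega
    nlinarith
  -- Each common period `n * n'` raises the height difference by `n * c' - c * n' ≥ 1`; two of them
  -- carry it from at most 0 to at least 2, across level 1.
  refine kissFun_of_rise 0 0 (2 * n * n') 1 hs.step ht.step
    (fun k _ => ⟨trivial, trivial, rfl, rfl⟩) (Or.inl (by omega)) (Or.inl ?_)
  push_cast
  rw [zero_add]
  nlinarith

/-! ### From compatibility to linear height functions. -/

/-- The route is laid along an arbitrary window of the band. A window too high or too low compared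
with the start of the route makes the height difference rise through a level. The fringe passages of
the route lie below every letter of the band, so in full length even equality with `Q n` gives a
kiss. -/
theorem windows_of_compatible {n : ℕ} {Q Q' : ℤ → ℤ}
    (hQ : ∀ p, Q (p + 1) = Q p ∨ Q (p + 1) = Q p + 1)
    (hQ' : ∀ p, Q' (p + 1) = Q' p ∨ Q' (p + 1) = Q' p + 1) (h0 : Q 0 = 0)
    (h1 : ¬ KissFun Set.univ (bFun Q') (Set.Icc (-1) n) (lFun n Q))
    (h2 : ¬ KissFun (Set.Icc (-1) n) (lFun n Q) Set.univ (bFun Q')) (d : ℤ) :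
    (∀ k : ℕ, k ≤ n → Q k - 1 ≤ Q' (d + k) - Q' d ∧ Q' (d + k) - Q' d ≤ Q k) ∧
      Q' (d + n) - Q' d = Q n - 1 := by
  have left : d - 1 ∈ Set.univ ∧ (0 : ℤ) - 1 ∈ Set.Icc (-1) (n : ℤ) ∧
      (lFun n Q (0 - 1)).val < (bFun Q' (d - 1)).val := by
    refine ⟨trivial, ⟨by omega, by omega⟩, ?_⟩
    rw [lFun_val_eq_zero_iff.2 (Or.inl (by omega))]
    exact val_ab_pos _
  have key : ∀ k : ℕ, k ≤ n → Q k - 1 ≤ Q' (d + k) - Q' d ∧ Q' (d + k) - Q' d ≤ Q k := by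
    intro k hk
    constructor
    · by_contra hc
      refine h2 (kissFun_of_rise 0 d k (-Q' d + 1) hQ hQ' (fun j hj => ⟨⟨by omega, by omega⟩, trivial,
        lFun_interior (by omega) (by omega), rfl⟩) (Or.inl (by omega)) (Or.inl ?_))
      rw [zero_add]
      omega
    · by_contra hc
      refine h1 (kissFun_of_rise d 0 k (Q' d) hQ' hQ (fun j hj => ⟨trivial, ⟨by omega, by omega⟩,
        rfl, lFun_interior (by omega) (by omega)⟩) (Or.inr ⟨by omega, left⟩) (Or.inl ?_))
      rw [zero_add]
      omega
  refine ⟨key, ?_⟩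
  have := (key n le_rfl).1
  by_contra hc
  refine h1 (kissFun_of_rise d 0 n (Q' d) hQ' hQ (fun j hj => ⟨trivial, ⟨by omega, by omega⟩,
    rfl, lFun_interior (by omega) (by omega)⟩) (Or.inr ⟨by omega, left⟩)
    (Or.inr ⟨?_, trivial, ⟨by omega, by omega⟩, ?_⟩))
  · rw [zero_add]
    omega
  · rw [lFun_val_eq_zero_iff.2 (Or.inr (by omega))]
    exact val_ab_pos _

/-- Put `f k = n * Q k - k * c`, so `f n = n`. If `k0` is the least positive `k` with `f k ≤ 0` and
`r = n % k0`, subadditivity gives `n = f n ≤ f r`, hence `r > 0`. Almost-superadditivity then gives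
`f k0 ≥ f (k0 - r) + f r - n ≥ 1`, a contradiction. The upper bound is the lower one seen from the
other end. -/
theorem linearL_of_subadditive {n : ℕ} {Q : ℤ → ℤ} (hn : 0 < n)
    (hQ : ∀ p, Q (p + 1) = Q p ∨ Q (p + 1) = Q p + 1) (h0 : Q 0 = 0)
    (hsub : ∀ k d : ℕ, k + d ≤ n → Q (k + d : ℕ) ≤ Q k + Q d)
    (hsup : ∀ k d : ℕ, k + d ≤ n → Q k + Q d - 1 ≤ Q (k + d : ℕ))
    (hdual : ∀ d : ℕ, d ≤ n → Q d + Q (n - d : ℕ) = Q n) :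
    LinearL n (Q n - 1) Q ∧ IsCoprime (n : ℤ) (Q n - 1) := by
  classical
  set c := Q n - 1 with hc
  have hlow : ∀ k : ℕ, 1 ≤ k → k ≤ n → 1 ≤ n * Q k - k * c := by
    by_contra hcon
    push Not at hcon
    obtain ⟨a1, a2, a3⟩ := Nat.find_spec hcon
    have amin : ∀ k < Nat.find hcon, 1 ≤ k → 1 ≤ n * Q k - k * c := by
      intro k hk hk1
      by_contra h
      exact Nat.find_min hcon hk ⟨hk1, by omega, by omega⟩
    set k0 := Nat.find hcon
    have hr := Nat.mod_lt n a1
    have hsum := Nat.mod_add_div n k0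
    set r := n % k0 with hrdef
    have ind : ∀ j : ℕ, r + k0 * j ≤ n →
        n * Q (r + k0 * j : ℕ) - (r + k0 * j : ℕ) * c ≤ n * Q r - r * c := by
      intro j
      induction j with
      | zero => intro _; simp
      | succ j ih =>
        intro hj
        have e : r + k0 * (j + 1) = (r + k0 * j) + k0 := by ring
        rw [e] at hj ⊢
        have b1 := ih (by omega)
        have b2 := hsub _ _ hj
        push_cast at b1 b2 ⊢
        nlinarith
    have hfin := ind (n / k0) hsum.le
    rw [hsum] at hfin
    have e : n * Q n - n * c = n := by rw [hc]; ring
    rw [e] at hfin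
    have hrpos : 1 ≤ r := by
      rcases Nat.eq_zero_or_pos r with h | h
      · rw [h] at hfin; simp [h0] at hfin; omega
      · exact h
    have b1 := amin (k0 - r) (by omega) (by omega)
    have b2 := hsup (k0 - r) r (by omega)
    rw [show k0 - r + r = k0 by omega] at b2
    have e2 : ((k0 - r : ℕ) : ℤ) = k0 - r := by omega
    rw [e2] at b1 b2
    nlinarith
  have hup : ∀ k : ℕ, 1 ≤ k → k < n → n * Q k - k * c ≤ n - 1 := by
    intro k h1 h2
    have b1 := hlow (n - k) (by omega) (by omega)
    have b2 := hdual k h2.le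
    have e2 : ((n - k : ℕ) : ℤ) = n - k := by omega
    rw [e2] at b1 b2
    have e3 : Q (n - k) = c + 1 - Q k := by omega
    rw [e3] at b1
    linarith
  refine ⟨⟨hn, hQ, h0, by omega, ?_, ?_⟩, ?_⟩
  · intro p h1 h2
    lift p to ℕ using by omega
    exact hlow p (by omega) (by omega)
  · intro p h1 h2
    lift p to ℕ using by omega
    exact hup p (by omega) (by omega)
  -- With a common factor `g ≥ 2`, the deviation at `n / g` would be a multiple of `n` lying between
  -- 1 and `n - 1`.
  · rw [Int.isCoprime_iff_gcd_eq_one]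
    by_contra hg
    obtain ⟨n1, hn1⟩ := Int.gcd_dvd_left (n : ℤ) c
    obtain ⟨c1, hc1⟩ := Int.gcd_dvd_right (n : ℤ) c
    set g := Int.gcd (n : ℤ) c
    have hg0 : g ≠ 0 := by
      rintro h; rw [h] at hn1; simp at hn1; omega
    have hg2 : (2 : ℤ) ≤ g := by omega
    have p1 : 0 < n1 := by
      by_contra h
      have : n1 ≤ 0 := by omega
      nlinarith
    have p2 : n1 < n := by nlinarith
    lift n1 to ℕ using p1.le
    have b1 := hlow n1 (by omega) (by omega)
    have b2 := hup n1 (by omega) (by omega)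
    have e : n * Q n1 - n1 * c = n * (Q n1 - c1) := by
      rw [hc1]
      linear_combination c1 * hn1
    rw [e] at b1 b2
    have : 0 < Q n1 - c1 := by
      by_contra h
      have : Q n1 - c1 ≤ 0 := by omega
      nlinarith
    nlinarith

/-- Each failing inequality is a kiss of the route with a shifted copy of itself: `hsub` uses the
initial fringe passage as the lower left letter, `hdual'` the final one as the lower right letter,
and the third inequality no fringe at all. -/
theorem linearL_of_not_kissFun {n : ℕ} {Q : ℤ → ℤ} (hn : 0 < n)
    (hQ : ∀ p, Q (p + 1) = Q p ∨ Q (p + 1) = Q p + 1) (h0 : Q 0 = 0)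
    (h : ¬ KissFun (Set.Icc (-1) n) (lFun n Q) (Set.Icc (-1) n) (lFun n Q)) :
    LinearL n (Q n - 1) Q ∧ IsCoprime (n : ℤ) (Q n - 1) := by
  have hsub : ∀ k d : ℕ, k + d ≤ n → Q (k + d : ℕ) ≤ Q k + Q d := by
    intro k d hkd
    rcases Nat.eq_zero_or_pos d with rfl | hd
    · simp [h0]
    by_contra hc
    refine h (kissFun_of_rise d 0 k (Q d) hQ hQ (fun j hj => ⟨⟨by omega, by omega⟩,
      ⟨by omega, by omega⟩, lFun_interior (by omega) (by omega),
      lFun_interior (by omega) (by omega)⟩)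
      (Or.inr ⟨by omega, ⟨by omega, by omega⟩, ⟨by omega, by omega⟩, ?_⟩) (Or.inl ?_))
    · rw [lFun_val_eq_zero_iff.2 (Or.inl (by omega)), lFun_interior (by omega) (by omega)]
      exact val_ab_pos _
    · rw [zero_add, show (d : ℤ) + k = (k + d : ℕ) by push_cast; ring]
      omega
  have hdual' : ∀ k d : ℕ, k + d ≤ n → Q (k + d : ℕ) - Q k ≤ Q n - Q (n - d : ℕ) := by
    intro k d hkd
    rcases Nat.eq_zero_or_pos d with rfl | hd
    · simp
    by_contra hc
    refine h (kissFun_of_rise k (k + d : ℕ) (n - d - k) (Q (n - d : ℕ) - Q n) hQ hQ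
      (fun j hj => ⟨⟨by omega, by omega⟩, ⟨by omega, by omega⟩,
      lFun_interior (by omega) (by omega), lFun_interior (by omega) (by omega)⟩)
      (Or.inl (by omega)) (Or.inr ?_))
    rw [show (k : ℤ) + (n - d - k : ℕ) = (n - d : ℕ) by omega,
      show ((k + d : ℕ) : ℤ) + (n - d - k : ℕ) = n by omega]
    refine ⟨le_rfl, ⟨by omega, by omega⟩, ⟨by omega, by omega⟩, ?_⟩
    rw [lFun_val_eq_zero_iff.2 (Or.inr (by omega)), lFun_interior (by omega) (by omega)]
    exact val_ab_pos _
  refine linearL_of_subadditive hn hQ h0 hsub ?_ ?_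
  · intro k d hkd
    by_contra hc
    refine h (kissFun_of_rise 0 k d (-Q k + 1) hQ hQ (fun j hj => ⟨⟨by omega, by omega⟩,
      ⟨by omega, by omega⟩, lFun_interior (by omega) (by omega),
      lFun_interior (by omega) (by omega)⟩) (Or.inl (by omega)) (Or.inl ?_))
    rw [zero_add, show (k : ℤ) + d = (k + d : ℕ) by push_cast; ring]
    omega
  · intro d hd
    have a1 := hsub d (n - d) (by omega)
    have a2 := hdual' 0 d (by omega)
    rw [show d + (n - d) = n by omega] at a1
    simp only [zero_add, Nat.cast_zero, h0] at a2
    omega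

theorem windows_of_not_kissFun_b_b {Q : ℤ → ℤ}
    (hQ : ∀ p, Q (p + 1) = Q p ∨ Q (p + 1) = Q p + 1)
    (h : ¬ KissFun Set.univ (bFun Q) Set.univ (bFun Q)) (i j : ℤ) (k : ℕ) :
    Q (i + k) - Q i ≤ Q (j + k) - Q j + 1 := by
  by_contra hc
  exact h (kissFun_of_rise i j k (Q i - Q j + 1) hQ hQ (fun _ _ => ⟨trivial, trivial, rfl, rfl⟩)
    (Or.inl (by omega)) (Or.inl (by omega)))

/-- The base point `d` minimizes the periodic deviation `f`. If `f (d + k)` exceeded `f d` by `n` or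
more, balance would make `f` nondecreasing under every shift by `k`; but `n` such shifts lead from
`d` back to the value `f d`. -/
theorem exists_linearB_of_windows {n : ℕ} {c : ℤ} {Q : ℤ → ℤ} (hn : 0 < n)
    (hQ : ∀ p, Q (p + 1) = Q p ∨ Q (p + 1) = Q p + 1) (hper : ∀ p, Q (p + n) = Q p + c)
    (h : ∀ (i j : ℤ) (k : ℕ), Q (i + k) - Q i ≤ Q (j + k) - Q j + 1) :
    ∃ d, LinearB n c (fun p => Q (p + d) - Q d) := by
  set f : ℤ → ℤ := fun p => n * Q p - p * c with hf
  have fper : ∀ p, f (p + n) = f p := by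
    intro p
    simp only [hf, hper]
    ring
  have hn' : (0 : ℤ) < n := by exact_mod_cast hn
  have fmod : ∀ p, f (p % n) = f p := by
    intro p
    have := eq_of_periodic fper (p % n) (p / n)
    rw [Int.emod_add_mul_ediv] at this
    exact this.symm
  obtain ⟨d, -, hd⟩ := Finset.exists_min_image (Finset.range n) (fun k : ℕ => f k)
    ⟨0, Finset.mem_range.2 hn⟩
  have hmin : ∀ p, f d ≤ f p := by
    intro p
    rw [← fmod p]
    have h1 := Int.emod_nonneg p hn'.ne'
    have h2 := Int.emod_lt_of_pos p hn'
    have := hd (p % n).toNat (Finset.mem_range.2 (by omega))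
    rwa [Int.toNat_of_nonneg h1] at this
  have hmax : ∀ k : ℕ, f (d + k) ≤ f d + n - 1 := by
    intro k
    by_contra hc
    have mono : ∀ i, f i ≤ f (i + k) := by
      intro i
      have := h d i k
      simp only [hf] at hc ⊢
      nlinarith
    have chain : ∀ j : ℕ, f (d + k) ≤ f (d + k + j * k) := by
      intro j
      induction j with
      | zero => simp
      | succ j ih =>
        refine ih.trans ((mono _).trans (le_of_eq ?_))
        congr 1; push_cast; ring
    have := chain (n - 1)
    have e : (d : ℤ) + k + (n - 1 : ℕ) * k = d + n * k := by
      rw [Nat.cast_sub (by omega)]; push_cast; ring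
    rw [e, eq_of_periodic fper] at this
    omega
  refine ⟨d, hn, ?_, ?_, ?_⟩
  · intro p
    have := hQ (p + d)
    rw [show p + 1 + (d : ℤ) = p + d + 1 by ring]
    omega
  · intro p
    have := hmin (p + d)
    simp only [hf] at this
    linarith
  · intro p
    have h1 := Int.emod_nonneg p hn'.ne'
    have := hmax (p % n).toNat
    rw [Int.toNat_of_nonneg h1] at this
    have e := eq_of_periodic fper (d + p % n) (p / n)
    rw [add_assoc, Int.emod_add_mul_ediv, add_comm (d : ℤ) p] at e
    rw [← e] at this
    simp only [hf] at this
    linarith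

/-! ### Uniqueness and existence of linear height functions. -/

/-- Changing `Q p` by one changes the deviation by `n`, while the bounds leave a range of length `n
- 1`. -/
theorem LinearB.unique {n : ℕ} {c : ℤ} {Q Q' : ℤ → ℤ} (h : LinearB n c Q) (h' : LinearB n c Q')
    (p : ℤ) : Q p = Q' p := by
  have a1 := h.lower p
  have a2 := h.upper p
  have b1 := h'.lower p
  have b2 := h'.upper p
  have hn : (0 : ℤ) < n := by exact_mod_cast h.pos
  by_contra hne
  rcases lt_or_gt_of_ne hne with hlt | hlt <;> nlinarith

theorem LinearL.unique {n : ℕ} {c : ℤ} {Q Q' : ℤ → ℤ} (h : LinearL n c Q) (h' : LinearL n c Q')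
    {p : ℤ} (h0 : 0 ≤ p) (h1 : p ≤ n) : Q p = Q' p := by
  have hn : (0 : ℤ) < n := by exact_mod_cast h.pos
  rcases h0.eq_or_lt with rfl | h0
  · rw [h.zero, h'.zero]
  have a1 := h.one_le h0 h1
  have a2 := h.le h0.le h1
  have b1 := h'.one_le h0 h1
  have b2 := h'.le h0.le h1
  by_contra hne
  rcases lt_or_gt_of_ne hne with hlt | hlt <;> nlinarith

theorem exists_linearB {n : ℕ} {c : ℤ} (hn : 0 < n) (h0 : 0 ≤ c) (h1 : c ≤ n) :
    ∃ Q, LinearB n c Q ∧ Q 0 = 0 := by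
  have hn' : (0 : ℤ) < n := by exact_mod_cast hn
  have key : ∀ p : ℤ, 0 ≤ n * -((-(p * c)) / n) - p * c ∧ n * -((-(p * c)) / n) - p * c ≤ n - 1 := by
    intro p
    have a1 := Int.emod_add_mul_ediv (-(p * c)) n
    have a2 := Int.emod_nonneg (-(p * c)) hn'.ne'
    have a3 := Int.emod_lt_of_pos (-(p * c)) hn'
    constructor <;> linarith
  -- This is `⌈p * c / n⌉`, written with the integer division that rounds down.
  refine ⟨fun p => -((-(p * c)) / n), ⟨hn, fun p => ?_, fun p => (key p).1, fun p => (key p).2⟩,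
    by simp⟩
  obtain ⟨a1, a2⟩ := key p
  obtain ⟨b1, b2⟩ := key (p + 1)
  set x := -((-(p * c)) / n)
  set y := -((-((p + 1) * c)) / n)
  have c1 : y < x + 2 := by
    by_contra hc
    have : x + 2 ≤ y := by omega
    nlinarith
  have c2 : x < y + 1 := by
    by_contra hc
    have : y + 1 ≤ x := by omega
    nlinarith
  omega

theorem exists_linearL {n : ℕ} {c : ℤ} (hn : 0 < n) (h0 : -1 ≤ c) (h1 : c < n)
    (hco : IsCoprime (n : ℤ) c) : ∃ Q, LinearL n c Q := by
  have hn' : (0 : ℤ) < n := by exact_mod_cast hn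
  have key : ∀ p : ℤ, 1 ≤ p → p < n → 1 ≤ n * (p * c / n + 1) - p * c ∧
      n * (p * c / n + 1) - p * c ≤ n - 1 := by
    intro p hp1 hp2
    have a1 := Int.emod_add_mul_ediv (p * c) n
    have a2 := Int.emod_nonneg (p * c) hn'.ne'
    have a3 := Int.emod_lt_of_pos (p * c) hn'
    -- By coprimality the line meets no lattice point strictly between its ends, so rounding down
    -- and adding one gives the lowest point strictly above it.
    have a4 : p * c % n ≠ 0 := by
      intro h
      have := Int.le_of_dvd (by omega) (hco.dvd_of_dvd_mul_right (Int.dvd_of_emod_eq_zero h))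
      omega
    constructor
    · linarith
    · have : 1 ≤ p * c % n := by omega
      linarith
  -- Constant outside `[0, n]`, because the step condition is imposed on all integers.
  set Q : ℤ → ℤ := fun p => if p ≤ 0 then 0 else if n ≤ p then c + 1 else p * c / n + 1 with hQ
  have q0 : ∀ p, p ≤ 0 → Q p = 0 := fun p hp => by simp only [hQ, if_pos hp]
  have q1 : ∀ p : ℤ, n ≤ p → Q p = c + 1 := fun p hp => by
    simp only [hQ, if_neg (by omega : ¬ p ≤ 0), if_pos hp]
  have q2 : ∀ p : ℤ, 1 ≤ p → p < n → Q p = p * c / n + 1 := fun p hp hp' => by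
    simp only [hQ, if_neg (by omega : ¬ p ≤ 0), if_neg (by omega : ¬ (n : ℤ) ≤ p)]
  have b0 : ∀ p : ℤ, 0 ≤ p → p ≤ n → 0 ≤ n * Q p - p * c ∧ n * Q p - p * c ≤ n ∧
      (p < n → n * Q p - p * c ≤ n - 1) ∧ (1 ≤ p → 1 ≤ n * Q p - p * c) := by
    intro p hp0 hp1
    rcases hp0.eq_or_lt with rfl | hp0
    · rw [q0 0 le_rfl]; simp; omega
    rcases hp1.eq_or_lt with rfl | hp1
    · rw [q1 _ le_rfl]
      refine ⟨?_, ?_, ?_, ?_⟩ <;> intros <;> nlinarith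
    · have := key p (by omega) hp1
      rw [q2 p (by omega) hp1]
      refine ⟨?_, ?_, ?_, ?_⟩ <;> intros <;> omega
  refine ⟨Q, hn, fun p => ?_, q0 0 le_rfl, q1 _ le_rfl, fun p hp hp' => (b0 p (by omega) hp'.le).2.2.2 hp,
    fun p hp hp' => (b0 p (by omega) hp'.le).2.2.1 hp'⟩
  by_cases hp : p < 0
  · left; rw [q0 p (by omega), q0 (p + 1) (by omega)]
  by_cases hp' : n ≤ p
  · left; rw [q1 p hp', q1 (p + 1) (by omega)]
  obtain ⟨a1, a2, a3, a4⟩ := b0 p (by omega) (by omega)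
  obtain ⟨c1, c2, c3, c4⟩ := b0 (p + 1) (by omega) (by omega)
  have a3 := a3 (by omega)
  have c4 := c4 (by omega)
  have d1 : Q (p + 1) < Q p + 2 := by
    by_contra hc
    have : Q p + 2 ≤ Q (p + 1) := by omega
    nlinarith
  have d2 : Q p < Q (p + 1) + 1 := by
    by_contra hc
    have : Q (p + 1) + 1 ≤ Q p := by omega
    nlinarith
  omega

/-! Height functions of words. -/

/-- The number of letters `b` among the first `p` letters. -/
def height (u : List Bool) (p : ℤ) : ℤ := (u.take p.toNat).count true

theorem height_step_of_lt {u : List Bool} {p : ℕ} (hp : p < u.length) :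
    height u (p + 1) = height u p + if u[p] then 1 else 0 := by
  rw [height, height, show ((p : ℤ) + 1).toNat = p + 1 by omega, Int.toNat_natCast,
    List.take_add_one, List.getElem?_eq_getElem hp, List.count_append]
  cases u[p] <;> simp

theorem height_step (u : List Bool) (p : ℤ) :
    height u (p + 1) = height u p ∨ height u (p + 1) = height u p + 1 := by
  rcases lt_or_ge p 0 with hp | hp
  · left; simp [height, show (p + 1).toNat = 0 by omega, show p.toNat = 0 by omega]
  lift p to ℕ using hp
  rcases lt_or_ge p u.length with h | h
  · rw [height_step_of_lt h]
    split_ifs <;> simp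
  · left
    rw [height, height, List.take_of_length_le (by omega), List.take_of_length_le (by simpa)]

theorem up_height {u : List Bool} (p : ℕ) (hp : p < u.length) : u[p] = up (height u) p := by
  rw [up, height_step_of_lt hp]
  cases u[p] <;> simp

theorem height_zero (u : List Bool) : height u 0 = 0 := by simp [height]

theorem height_length (u : List Bool) : height u u.length = u.count true := by simp [height]

theorem models_l (u : List Bool) : Models (.route (route false false u))
    (Set.Icc (-1) u.length) (lFun u.length (height u)) :=
  models_route up_height

/-- The word whose height function is `Q`. -/
def wordOf (Q : ℤ → ℤ) (n : ℕ) : List Bool := (List.range n).map fun k : ℕ => up Q (k : ℤ)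

theorem wordOf_length (Q : ℤ → ℤ) (n : ℕ) : (wordOf Q n).length = n := by simp [wordOf]

theorem wordOf_getElem (Q : ℤ → ℤ) (n p : ℕ) (hp : p < (wordOf Q n).length) :
    (wordOf Q n)[p] = up Q p := by simp [wordOf]

theorem count_false_add_count_true (u : List Bool) : u.count false + u.count true = u.length := by
  induction u with
  | nil => rfl
  | cons x u ih => cases x <;> simp <;> omega

theorem count_wordOf {Q : ℤ → ℤ} (hQ : ∀ p, Q (p + 1) = Q p ∨ Q (p + 1) = Q p + 1) (n : ℕ) :
    ((wordOf Q n).count true : ℤ) = Q n - Q 0 := by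
  induction n with
  | zero => simp [wordOf]
  | succ n ih =>
    have e : wordOf Q (n + 1) = wordOf Q n ++ [up Q n] := by simp [wordOf, List.range_succ]
    rw [e, List.count_append, Nat.cast_add, ih, up]
    rcases hQ n with h | h
    · have : ¬ Q (n + 1) = Q n + 1 := by omega
      simp [h]
    · simp [h]; ring

theorem count_false_wordOf {Q : ℤ → ℤ} (hQ : ∀ p, Q (p + 1) = Q p ∨ Q (p + 1) = Q p + 1) (n : ℕ) :
    ((wordOf Q n).count false : ℤ) = n - (Q n - Q 0) := by
  have h1 := count_wordOf hQ n
  have h2 := count_false_add_count_true (wordOf Q n)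
  rw [wordOf_length] at h2
  omega

theorem wordOf_height (u : List Bool) : wordOf (height u) u.length = u := by
  refine List.ext_getElem (wordOf_length _ _) fun p h1 h2 => ?_
  rw [wordOf_getElem, up_height p h2]

theorem wordOf_congr {Q Q' : ℤ → ℤ} {n : ℕ} (h : ∀ p : ℤ, 0 ≤ p → p ≤ n → Q p = Q' p) :
    wordOf Q n = wordOf Q' n := by
  refine List.map_congr_left fun k hk => ?_
  have := List.mem_range.1 hk
  rw [up, up, h k (by omega) (by omega), h (k + 1) (by omega) (by omega)]

theorem models_wordOf (Q : ℤ → ℤ) (n : ℕ) : Models (.route (route false false (wordOf Q n)))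
    (Set.Icc (-1) n) (lFun n Q) := by
  have := models_route (x := false) (y := false) (u := wordOf Q n) (h := up Q)
    (fun p hp => wordOf_getElem Q n p hp)
  rwa [wordOf_length] at this

/-- The height function of the infinite periodic word with period `u`. -/
def bandHeight (u : List Bool) (p : ℤ) : ℤ :=
  p / u.length * u.count true + height u (p % u.length)

theorem bandHeight_add_length {u : List Bool} (hu : u ≠ []) (p : ℤ) :
    bandHeight u (p + u.length) = bandHeight u p + u.count true := by
  have : (u.length : ℤ) ≠ 0 := by simpa using hu
  rw [bandHeight, bandHeight, Int.add_emod_right, Int.add_ediv_of_dvd_right (dvd_refl _),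
    Int.ediv_self this]
  ring

theorem bandHeight_succ {u : List Bool} (hu : u ≠ []) (p : ℤ) :
    bandHeight u (p + 1) = bandHeight u p +
      (height u (p % u.length + 1) - height u (p % u.length)) := by
  have hpos : (0 : ℤ) < u.length := by
    have := List.length_pos_iff.2 hu
    exact_mod_cast this
  have h1 := Int.emod_nonneg p hpos.ne'
  have h2 := Int.emod_lt_of_pos p hpos
  have h3 := Int.emod_add_mul_ediv p u.length
  rcases lt_or_ge (p % u.length + 1) (u.length : ℤ) with h | h
  · have e1 : (p + 1) / u.length = p / u.length ∧ (p + 1) % u.length = p % u.length + 1 := by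
      rw [Int.ediv_emod_unique hpos]
      exact ⟨by linarith, by omega, h⟩
    rw [bandHeight, bandHeight, e1.1, e1.2]
    ring
  · have e1 : (p + 1) / u.length = p / u.length + 1 ∧ (p + 1) % u.length = 0 := by
      rw [Int.ediv_emod_unique hpos]
      exact ⟨by linarith, le_rfl, hpos⟩
    have e2 : p % u.length + 1 = u.length := by omega
    rw [bandHeight, bandHeight, e1.1, e1.2, e2, height_length, height_zero]
    ring

theorem bandHeight_step {u : List Bool} (hu : u ≠ []) (p : ℤ) :
    bandHeight u (p + 1) = bandHeight u p ∨ bandHeight u (p + 1) = bandHeight u p + 1 := by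
  rw [bandHeight_succ hu]
  have := height_step u (p % u.length)
  omega

theorem up_bandHeight {u : List Bool} (p : ℕ) (hp : p < u.length) :
    u[p] = up (bandHeight u) p := by
  have hu : u ≠ [] := by rintro rfl; simp at hp
  rw [up_height p hp, up, up, bandHeight_succ hu, decide_eq_decide]
  rw [Int.emod_eq_of_lt (by omega) (by omega)]
  omega

theorem ne_nil_of_isBand {u : List Bool} (hb : doubleKronecker.IsBand (word u)) : u ≠ [] := by
  rintro rfl
  exact hb.1.1 rfl

theorem models_bandHeight {u : List Bool} (hb : doubleKronecker.IsBand (word u)) :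
    Models (.band ⟦⟨word u, hb⟩⟧) Set.univ (bFun (bandHeight u)) := by
  have hu := ne_nil_of_isBand hb
  refine models_band hb (fun p => ?_) up_bandHeight
  rw [up, up, bandHeight_add_length hu, add_right_comm, bandHeight_add_length hu, decide_eq_decide]
  omega

/-! The bands. -/

/-- The translate of `Q` along the vector `(m, d)` parallel to the line satisfies the same bounds,
so uniqueness applies. -/
theorem LinearB.add_period {n : ℕ} {c : ℤ} {Q : ℤ → ℤ} (h : LinearB n c Q) {m d : ℤ}
    (hd : n * d = m * c) (p : ℤ) : Q (p + m) = Q p + d := by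
  have : LinearB n c (fun p => Q (p + m) - d) := by
    refine ⟨h.pos, fun p => ?_, fun p => ?_, fun p => ?_⟩
    · have := h.step (p + m)
      rw [show p + 1 + m = p + m + 1 by ring]
      omega
    · have := h.lower (p + m)
      linarith
    · have := h.upper (p + m)
      linarith
  have := this.unique h p
  linarith

theorem exists_bnd (b c : ℕ) (h : Nat.Coprime b c) : ∃ (Q : ℤ → ℤ)
    (_ : doubleKronecker.IsBand (word (wordOf Q (b + c)))), LinearB (b + c) c Q := by
  have hpos : 0 < b + c := by
    rcases Nat.eq_zero_or_pos (b + c) with h0 | h0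
    · obtain ⟨rfl, rfl⟩ : b = 0 ∧ c = 0 := by omega
      simp at h
    · exact h0
  obtain ⟨Q, hQ, hQ0⟩ := exists_linearB (n := b + c) (c := c) hpos (by omega) (by push_cast; omega)
  have e : Q (b + c : ℕ) = c := by
    have := hQ.add_period (m := (b + c : ℕ)) (d := c) rfl 0
    rwa [zero_add, hQ0, zero_add] at this
  refine ⟨Q, isBand_word ?_, hQ⟩
  have h1 := count_wordOf hQ.step (b + c)
  have h2 := count_false_wordOf hQ.step (b + c)
  rw [e, hQ0] at h1 h2
  have e1 : (wordOf Q (b + c)).count true = c := by omega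
  have e2 : (wordOf Q (b + c)).count false = b := by push_cast at h2; omega
  rwa [e1, e2]

/-- Supplies the default value of `bnd` at pairs that are not coprime. -/
theorem isBand_b : doubleKronecker.IsBand (word [true]) := isBand_word (by decide)

open Classical in
/-- The band of slope `(b, c)`. -/
noncomputable def bnd (b c : ℕ) : doubleKronecker.Band :=
  if h : Nat.Coprime b c then ⟦⟨_, (exists_bnd b c h).choose_spec.choose⟩⟧ else ⟦⟨_, isBand_b⟩⟧

theorem bnd_spec {b c : ℕ} (h : Nat.Coprime b c) : ∃ (Q : ℤ → ℤ)
    (hb : doubleKronecker.IsBand (word (wordOf Q (b + c)))), LinearB (b + c) c Q ∧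
      bnd b c = ⟦⟨word (wordOf Q (b + c)), hb⟩⟧ ∧
      Models (.band (bnd b c)) Set.univ (bFun Q) := by
  have e : bnd b c = ⟦⟨_, (exists_bnd b c h).choose_spec.choose⟩⟧ := by rw [bnd, dif_pos h]
  have hQ := (exists_bnd b c h).choose_spec.choose_spec
  refine ⟨_, (exists_bnd b c h).choose_spec.choose, hQ, e, ?_⟩
  rw [e]
  refine models_band _ (fun p => ?_) (wordOf_getElem _ _)
  rw [wordOf_length, up, up, add_right_comm, hQ.add_period (d := c) rfl, hQ.add_period (d := c) rfl,
    decide_eq_decide]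
  omega

theorem indicator_band {u : List Bool} (hb : doubleKronecker.IsBand (word u)) :
    Band.indicator doubleKronecker ⟦⟨word u, hb⟩⟧ =
      doubleKronecker.flow 0 (u.count false) (u.count true) 0 := arrowCount_word u

theorem indicator_bnd {b c : ℕ} (h : Nat.Coprime b c) :
    Band.indicator doubleKronecker (bnd b c) = doubleKronecker.flow 0 b c 0 := by
  obtain ⟨Q, hb, hQ, e, -⟩ := bnd_spec h
  have h0 := hQ.add_period (m := (b + c : ℕ)) (d := c) rfl 0
  rw [zero_add] at h0
  rw [e, indicator_band, count_wordOf hQ.step, count_false_wordOf hQ.step, h0]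
  congr 1 <;> push_cast <;> ring

theorem bnd_injective {b c b' c' : ℕ} (h : Nat.Coprime b c) (h' : Nat.Coprime b' c')
    (e : bnd b c = bnd b' c') : b = b' ∧ c = c' := by
  have := indicator_bnd h
  rw [e, indicator_bnd h'] at this
  have h2 := congrFun this e2
  have h3 := congrFun this e3
  simp only [doubleKronecker.flow, Nat.cast_inj] at h2 h3
  exact ⟨h2.symm, h3.symm⟩

theorem selfCompatible_bnd {b c : ℕ} (h : Nat.Coprime b c) :
    doubleKronecker.SelfCompatibleBand (bnd b c) := by
  obtain ⟨Q, hb, hQ, e, hm⟩ := bnd_spec h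
  have := not_kissFun_b_b hQ hQ (by ring)
  rw [← hm.topBottom_iff hm] at this
  exact ⟨this, this⟩

theorem eq_of_coprime_of_mul_eq {b c b' c' : ℕ} (h : Nat.Coprime b c) (h' : Nat.Coprime b' c')
    (e : b * c' = c * b') : b = b' ∧ c = c' := by
  have d1 : b ∣ b' := h.dvd_of_dvd_mul_left (Dvd.intro _ e)
  have d2 : b' ∣ b := h'.dvd_of_dvd_mul_right ⟨c, by rw [e, mul_comm]⟩
  have d3 : c ∣ c' := h.symm.dvd_of_dvd_mul_left ⟨b', e⟩
  have d4 : c' ∣ c := h'.symm.dvd_of_dvd_mul_right ⟨b, by rw [← e, mul_comm]⟩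
  exact ⟨Nat.dvd_antisymm d1 d2, Nat.dvd_antisymm d3 d4⟩

theorem eq_of_compatible_bnd {b c b' c' : ℕ} (h : Nat.Coprime b c) (h' : Nat.Coprime b' c')
    (hc : doubleKronecker.Compatible (.band (bnd b c)) (.band (bnd b' c'))) :
    b = b' ∧ c = c' := by
  obtain ⟨Q, hb, hQ, e, hm⟩ := bnd_spec h
  obtain ⟨Q', hb', hQ', e', hm'⟩ := bnd_spec h'
  rw [Compatible, hm.topBottom_iff hm', hm'.topBottom_iff hm] at hc
  apply eq_of_coprime_of_mul_eq h h'
  zify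
  rcases lt_trichotomy ((b : ℤ) * c') (c * b') with hlt | heq | hlt
  · refine (hc.1 (kissFun_b_b hQ hQ' ?_)).elim
    push_cast; linarith
  · exact heq
  · refine (hc.2 (kissFun_b_b hQ' hQ ?_)).elim
    push_cast; linarith

theorem eq_flatten_replicate_of_periodic {u : List Bool} {h : ℤ → Bool} {m g : ℕ}
    (hu : ∀ p (hp : p < u.length), u[p] = h p) (hm : ∀ p, h (p + m) = h p)
    (hl : u.length = g * m) : u = (List.replicate g (u.take m)).flatten := by
  rcases Nat.eq_zero_or_pos g with rfl | hg
  · have : u = [] := by simpa using hl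
    simp [this]
  have hmu : m ≤ u.length := by rw [hl]; exact Nat.le_mul_of_pos_left _ hg
  have htl : (u.take m).length = m := by simp [hmu]
  have hl2 : (List.replicate g (u.take m)).flatten.length = u.length := by
    rw [List.length_flatten, List.map_replicate, List.sum_replicate, htl, hl, smul_eq_mul]
  refine List.ext_getElem? fun q => ?_
  rcases lt_or_ge q u.length with hq | hq
  · have hm0 : 0 < m := by
      rcases Nat.eq_zero_or_pos m with h0 | h0
      · rw [h0] at hl; omega
      · exact h0
    have hq' : q % m < m := Nat.mod_lt _ hm0
    rw [flatten_replicate_getElem? _ _ _ (by rw [htl, ← hl]; exact hq), htl,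
      List.getElem?_take_of_lt hq', List.getElem?_eq_getElem hq,
      List.getElem?_eq_getElem (hq'.trans_le hmu), hu, hu]
    have := eq_of_periodic hm ((q % m : ℕ) : ℤ) ((q / m : ℕ) : ℤ)
    rw [← Nat.cast_mul, ← Nat.cast_add, Nat.mod_add_div] at this
    rw [this]
  · rw [List.getElem?_eq_none hq, List.getElem?_eq_none (by rw [hl2]; exact hq)]

/-- Balance makes the height function linear after a shift. A common factor of the two letter counts
would give it a shorter period and make `u` a proper power. With coprime counts, uniqueness of
linear height functions identifies `u` with a rotation of the standard word. -/
theorem band_eq_of_windows {u : List Bool} (hb : doubleKronecker.IsBand (word u))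
    (h : ∀ (i j : ℤ) (k : ℕ), bandHeight u (i + k) - bandHeight u i ≤
      bandHeight u (j + k) - bandHeight u j + 1) :
    Nat.Coprime (u.count false) (u.count true) ∧
      (⟦⟨word u, hb⟩⟧ : doubleKronecker.Band) = bnd (u.count false) (u.count true) := by
  have hu := ne_nil_of_isBand hb
  have hpos : 0 < u.length := List.length_pos_iff.2 hu
  have hlen := count_false_add_count_true u
  obtain ⟨d, hd⟩ := exists_linearB_of_windows hpos (bandHeight_step hu)
    (bandHeight_add_length hu) h
  have hper : ∀ p, up (bandHeight u) (p + u.length) = up (bandHeight u) p := by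
    intro p
    rw [up, up, bandHeight_add_length hu, add_right_comm, bandHeight_add_length hu,
      decide_eq_decide]
    omega
  have hco : Nat.Coprime (u.count false) (u.count true) := by
    rw [Nat.Coprime]
    by_contra hg
    obtain ⟨b1, hb1⟩ := Nat.gcd_dvd_left (u.count false) (u.count true)
    obtain ⟨c1, hc1⟩ := Nat.gcd_dvd_right (u.count false) (u.count true)
    set g := Nat.gcd (u.count false) (u.count true)
    have hg0 : g ≠ 0 := by
      intro h0
      rw [h0] at hb1 hc1
      omega
    have hl : u.length = g * (b1 + c1) := by rw [← hlen, mul_add, ← hb1, ← hc1]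
    have hp := hd.add_period (m := (b1 + c1 : ℕ)) (d := c1) (by
      rw [hl, hc1]; push_cast; ring)
    refine not_power_of_isBand hb (u.take (b1 + c1)) g (by omega)
      (eq_flatten_replicate_of_periodic up_bandHeight (fun p => ?_) hl)
    have e1 := hp (p - d)
    have e2 := hp (p - d + 1)
    rw [up, up, decide_eq_decide]
    rw [show p - d + (b1 + c1 : ℕ) + d = p + (b1 + c1 : ℕ) by ring,
      show p - d + d = p by ring] at e1
    rw [show p - d + 1 + (b1 + c1 : ℕ) + d = p + (b1 + c1 : ℕ) + 1 by ring,
      show p - d + 1 + d = p + 1 by ring] at e2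
    omega
  refine ⟨hco, ?_⟩
  obtain ⟨Q, hb', hQ, e, -⟩ := bnd_spec hco
  rw [e]
  refine band_eq_of_isRotated hb hb' ⟨(d % u.length).toNat, ?_⟩
  refine List.ext_getElem (by rw [List.length_rotate, wordOf_length, hlen]) fun k h1 h2 => ?_
  rw [wordOf_getElem, List.getElem_rotate, up_bandHeight]
  rw [hlen] at hQ
  have hpos' : (0 : ℤ) < u.length := by exact_mod_cast hpos
  have e0 : (((k + (d % u.length).toNat) % u.length : ℕ) : ℤ) = (k + d) % u.length := by
    push_cast
    rw [Int.toNat_of_nonneg (Int.emod_nonneg _ hpos'.ne'), Int.add_emod_emod]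
  have e1 := eq_of_periodic hper ((k + d) % u.length) ((k + d) / u.length)
  rw [Int.emod_add_mul_ediv] at e1
  rw [e0, ← e1, up, up, hQ.unique hd, hQ.unique hd, decide_eq_decide,
    show (k : ℤ) + 1 + d = k + d + 1 by ring]
  omega

theorem exists_eq_bnd_of_selfCompatible {X : doubleKronecker.Band}
    (h : doubleKronecker.SelfCompatibleBand X) : ∃ b c : ℕ, Nat.Coprime b c ∧ X = bnd b c := by
  obtain ⟨u, hb, rfl⟩ := band_cases X
  have hm := models_bandHeight hb
  have h1 := h.1
  rw [hm.topBottom_iff hm] at h1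
  have := band_eq_of_windows hb
    (windows_of_not_kissFun_b_b (bandHeight_step (ne_nil_of_isBand hb)) h1)
  exact ⟨_, _, this⟩

/-- No comparison of words is needed: the mirror image is self-compatible, hence one of the bands
`bnd`, and its indicator vector tells which. -/
theorem mirrorBand_bnd {b c : ℕ} (h : Nat.Coprime b c) : mirrorBand (bnd b c) = bnd c b := by
  have : doubleKronecker.SelfCompatibleBand (mirrorBand (bnd b c)) :=
    compatible_mirrorTrail (selfCompatible_bnd h)
  obtain ⟨b', c', h', e⟩ := exists_eq_bnd_of_selfCompatible this
  have h2 := indicator_mirrorBand (bnd b c) e2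
  have h3 := indicator_mirrorBand (bnd b c) e3
  rw [e, indicator_bnd h', indicator_bnd h] at h2 h3
  simp only [doubleKronecker.flow, mirrorArrow, Nat.cast_inj] at h2 h3
  rw [e, h2, h3]

/-! Kisses with the routes of length two. -/

theorem exists_getElem?_of_pair_infix {α : Type} {x y : α} {w : List α} (h : [x, y] <:+: w) :
    ∃ q, w[q]? = some x ∧ w[q + 1]? = some y := by
  obtain ⟨s, t, rfl⟩ := h
  exact ⟨s.length, by simp, by simp⟩

theorem eq_of_turn : ∀ {a b : DKArrow}, doubleKronecker.tail a = doubleKronecker.head e1 →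
    Forward (a, false) = true → doubleKronecker.Step (a, false) (b, true) → a = f2 ∧ b = e2 := by
  decide

/-- The route `e₁f₁⁻¹` has room only for a lazy bottom at the first vertex, and a forward word has a
top there only as `f₂⁻¹e₂`. -/
theorem wordTopBottom_capL_iff {u : List (SArrow DKArrow)} (hu : IsForward u)
    (hu' : u.IsChain doubleKronecker.Step) :
    doubleKronecker.WordTopBottom u [(e1, true), (f1, false)] ↔
      [(f2, false), (e2, true)] <:+: u := by
  constructor
  · rintro ⟨σ, a, b, c, d, h1, h2, h3⟩
    have h4 := h2.length_le
    have : σ = [] := by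
      rw [← List.length_eq_zero_iff]
      simp only [List.length_cons, List.length_append, List.length_nil] at h4
      omega
    subst this
    have h5 := h2.eq_of_length (by simp)
    simp only [List.nil_append, List.cons.injEq, Prod.mk.injEq, and_true] at h5
    rw [h5.1] at h3
    have ha := hu _ (h1.subset (List.mem_cons_self ..))
    have hc := List.isChain_pair.1 (hu'.infix h1)
    obtain ⟨rfl, rfl⟩ := eq_of_turn h3 ha hc
    exact h1
  · intro h
    exact ⟨[], f2, e2, e1, f1, h, List.infix_rfl, rfl⟩

theorem fst_a_snd_a : ∀ {x : Letter}, x.fst = (f2, false) → x.snd = (e2, true) → x = .a := by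
  decide

theorem snd_ne : ∀ {x : Letter}, x.snd ≠ (f2, false) := by decide

theorem turn_infix_spell_iff {C : List Letter} :
    [(f2, false), (e2, true)] <:+: spell C ↔ Letter.a ∈ C := by
  constructor
  · intro h
    obtain ⟨q, h1, h2⟩ := exists_getElem?_of_pair_infix h
    obtain ⟨k, rfl | rfl⟩ := Nat.even_or_odd' q
    · rw [spell_getElem?_even] at h1
      rw [spell_getElem?_odd] at h2
      obtain ⟨x, hx, hx1⟩ := Option.map_eq_some_iff.1 h1
      rw [hx, Option.map_some, Option.some.injEq] at h2
      rw [← fst_a_snd_a hx1 h2]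
      exact List.mem_of_getElem? hx
    · rw [spell_getElem?_odd] at h1
      obtain ⟨x, hx, hx1⟩ := Option.map_eq_some_iff.1 h1
      exact (snd_ne hx1).elim
  · intro h
    obtain ⟨s, t, rfl⟩ := List.append_of_mem h
    refine ⟨spell s, spell t, ?_⟩
    rw [spell_append]
    simp [spell, Letter.fst, Letter.snd]

theorem repWords_capL : RepWords (.route capL) {[(e1, true), (f1, false)]} :=
  repWords_route ⟨_, isRoute_capL⟩ (by simp only [IsForward]; decide)

theorem repWords_capR : RepWords (.route capR) {[(f4, false), (e4, true)]} :=
  repWords_route ⟨_, isRoute_capR⟩ (by simp only [IsForward]; decide)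

theorem not_topBottom_capL (t : doubleKronecker.Trail) :
    ¬ doubleKronecker.TopBottom (.route capL) t := by
  rintro ⟨σ, a, b, c, d, h1, -, -⟩
  rw [repWords_capL.2] at h1
  obtain ⟨w, rfl, h | h⟩ := h1
  all_goals
    have h4 := h.length_le
    have : σ = [] := by
      rw [← List.length_eq_zero_iff]
      simp only [invWalk, List.map_cons, List.map_nil, List.reverse_cons, List.reverse_nil,
        List.length_cons, List.length_append, List.length_nil] at h4
      omega
    subst this
    have h5 := h.eq_of_length (by simp [invWalk])
    simp [invWalk] at h5

theorem topBottom_route_capL (x y : Bool) (u : List Bool) :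
    doubleKronecker.TopBottom (.route (route x y u)) (.route capL) ↔ false ∈ u := by
  rw [route, topBottom_iff (repWords_route _ (isForward_spell _)) repWords_capL]
  simp only [Set.mem_singleton_iff, exists_eq_left]
  rw [wordTopBottom_capL_iff (isForward_spell _) (isChain_spell (isChain_routeCode _ _ _)), turn_infix_spell_iff]
  cases x <;> cases y <;> simp [routeCode, ab]

theorem topBottom_band_capL {u : List Bool} (hb : doubleKronecker.IsBand (word u)) :
    doubleKronecker.TopBottom (.band ⟦⟨word u, hb⟩⟧) (.route capL) ↔ false ∈ u := by
  rw [topBottom_iff (repWords_band _ (isForward_spell _)) repWords_capL]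
  simp only [Set.mem_singleton_iff, exists_eq_left, Set.mem_ofPred_eq]
  constructor
  · rintro ⟨_, ⟨n, rfl⟩, h⟩
    rw [← word_replicate, word, wordTopBottom_capL_iff (isForward_spell _)
      (isChain_spell (isChain_map_ab _)),
      turn_infix_spell_iff] at h
    obtain ⟨x, hx, hxa⟩ := List.mem_map.1 h
    obtain ⟨l, hl, hxl⟩ := List.mem_flatten.1 hx
    rw [List.eq_of_mem_replicate hl] at hxl
    cases x
    · exact hxl
    · simp [ab] at hxa
  · intro h
    refine ⟨_, ⟨1, rfl⟩, ?_⟩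
    rw [← word_replicate, word, wordTopBottom_capL_iff (isForward_spell _)
      (isChain_spell (isChain_map_ab _)), turn_infix_spell_iff]
    exact List.mem_map.2 ⟨false, by simpa using h, rfl⟩

theorem compatible_route_capL (x y : Bool) (u : List Bool) :
    doubleKronecker.Compatible (.route capL) (.route (route x y u)) ↔ false ∉ u := by
  rw [Compatible, topBottom_route_capL]
  simp [not_topBottom_capL]

theorem not_topBottom_capR_capL :
    ¬ doubleKronecker.TopBottom (.route capR) (.route capL) := by
  rw [topBottom_iff repWords_capR repWords_capL]
  simp only [Set.mem_singleton_iff, exists_eq_left]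
  rw [wordTopBottom_capL_iff (by simp only [IsForward]; decide) (by decide)]
  decide

theorem compatible_capL_capR : doubleKronecker.Compatible (.route capL) (.route capR) :=
  ⟨not_topBottom_capL _, not_topBottom_capR_capL⟩

/-! The routes from the left fringe to itself. -/

/-- The indices of the routes at the left fringe. -/
def LeftIndex (b c : ℤ) : Prop := (b = 0 ∧ c = -1) ∨ (1 ≤ b ∧ -1 ≤ c ∧ IsCoprime b c)

open Classical in
/-- The route at the left fringe with index `(b, c)`. -/
noncomputable def leftRoute (b c : ℤ) : doubleKronecker.Route :=
  if b = 0 then capL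
  else if h : ∃ Q, LinearL (b + c).toNat c Q then route false false (wordOf h.choose (b + c).toNat)
  else route false false []

theorem leftRoute_cap : leftRoute 0 (-1) = capL := by simp [leftRoute]

/-- The inner word would have length 0, which `LinearL` excludes, so the default branch of the
definition gives the intended route. -/
theorem leftRoute_one : leftRoute 1 (-1) = route false false [] := by
  rw [leftRoute, if_neg one_ne_zero, dif_neg]
  rintro ⟨Q, h⟩
  exact absurd h.pos (by decide)

theorem leftRoute_eq {n : ℕ} {c : ℤ} {Q : ℤ → ℤ} (h : LinearL n c Q) (hc : c ≠ n) :
    leftRoute (n - c) c = route false false (wordOf Q n) := by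
  have e : ((n : ℤ) - c + c).toNat = n := by omega
  rw [leftRoute, if_neg (by omega), dif_pos ⟨Q, by rwa [e]⟩]
  congr 1
  have key : ∀ m, m = n → ∀ h' : ∃ Q, LinearL m c Q, wordOf h'.choose m = wordOf Q n := by
    rintro _ rfl h'
    exact wordOf_congr fun p h0 h1 => h'.choose_spec.unique h h0 h1
  exact key _ e _

theorem leftRoute_cases {b c : ℤ} (h : LeftIndex b c) :
    (b = 0 ∧ c = -1) ∨ (b = 1 ∧ c = -1) ∨ ∃ (n : ℕ) (Q : ℤ → ℤ), (n : ℤ) = b + c ∧ 1 ≤ b ∧ -1 ≤ c ∧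
      IsCoprime (n : ℤ) c ∧ LinearL n c Q ∧ leftRoute b c = route false false (wordOf Q n) := by
  rcases h with h | ⟨h1, h2, h3⟩
  · exact Or.inl h
  · refine Or.inr ?_
    by_cases h0 : b + c = 0
    · left; omega
    · right
      obtain ⟨n, hn⟩ := Int.eq_ofNat_of_zero_le (a := b + c) (by omega)
      replace hn := hn.symm
      have hco : IsCoprime (n : ℤ) c := by
        rw [hn]
        simpa using h3.add_mul_left_left 1
      obtain ⟨Q, hQ⟩ := exists_linearL (n := n) (c := c) (by omega) h2 (by omega) hco
      refine ⟨n, Q, hn, h1, h2, hco, hQ, ?_⟩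
      rw [← leftRoute_eq hQ (by omega)]
      congr 1
      omega

theorem models_leftRoute_one (Q : ℤ → ℤ) : Models (.route (leftRoute 1 (-1))) (Set.Icc (-1) 0)
    (lFun 0 Q) := by
  have := models_wordOf Q 0
  rwa [wordOf, List.range_zero, List.map_nil, ← leftRoute_one] at this

theorem lFun_val_nonneg (n : ℕ) (Q : ℤ → ℤ) (p : ℤ) : 0 ≤ (lFun n Q p).val := by
  generalize lFun n Q p = x
  cases x <;> decide

theorem val_lFun_zero {Q : ℤ → ℤ} (p : ℤ) : (lFun 0 Q p).val = 0 :=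
  lFun_val_eq_zero_iff.2 (by simpa using lt_or_ge p 0)

theorem not_kissFun_of_val_eq_zero {D E : Set ℤ} {f g : ℤ → Letter} (hg : ∀ p, 0 ≤ (g p).val)
    (hf : ∀ p, (f p).val = 0) : ¬ KissFun D f E g := by
  rintro ⟨i, j, m, -, h, -⟩
  rw [hf] at h
  exact absurd (hg j) (by omega)

/-- The generic case is `kissFun_l_l` together with `not_kissFun_l_l`. The cap and the route without
inner passages are treated apart; neither can be the upper trail of a kiss with a left route. -/
theorem topBottom_leftRoute_iff {b c b' c' : ℤ} (h : LeftIndex b c) (h' : LeftIndex b' c') :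
    doubleKronecker.TopBottom (.route (leftRoute b' c')) (.route (leftRoute b c)) ↔
      2 ≤ b * c' - c * b' := by
  rcases leftRoute_cases h' with ⟨rfl, rfl⟩ | ⟨rfl, rfl⟩ | ⟨n', Q', hn', hb', hc', hco', hQ', e'⟩
  · rw [leftRoute_cap]
    have : 0 ≤ b := by rcases h with h | h <;> omega
    simp only [not_topBottom_capL, false_iff]
    omega
  · have : 0 ≤ b + c ∨ (b = 0 ∧ c = -1) := by rcases h with h | h <;> omega
    have hk : ¬ doubleKronecker.TopBottom (.route (leftRoute 1 (-1))) (.route (leftRoute b c)) := by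
      rcases leftRoute_cases h with ⟨rfl, rfl⟩ | ⟨rfl, rfl⟩ | ⟨n, Q, hn, hb, hc, hco, hQ, e⟩
      · rw [leftRoute_cap, leftRoute_one, topBottom_route_capL]
        exact List.not_mem_nil
      · rw [(models_leftRoute_one fun _ => 0).topBottom_iff (models_leftRoute_one fun _ => 0)]
        exact not_kissFun_of_val_eq_zero (fun p => lFun_val_nonneg _ _ _) val_lFun_zero
      · rw [e, (models_leftRoute_one fun _ => 0).topBottom_iff (models_wordOf Q n)]
        exact not_kissFun_of_val_eq_zero (fun p => lFun_val_nonneg _ _ _) val_lFun_zero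
    simp only [hk, false_iff]
    omega
  rw [e']
  have hm' := models_wordOf Q' n'
  rcases leftRoute_cases h with ⟨rfl, rfl⟩ | ⟨rfl, rfl⟩ | ⟨n, Q, hn, hb, hc, hco, hQ, e⟩
  -- Against the cap the determinant is `b'`, and the upper route contains `b' - 1` letters `a`.
  · rw [leftRoute_cap, topBottom_route_capL, ← List.count_pos_iff]
    have := count_false_wordOf hQ'.step n'
    rw [hQ'.last, hQ'.zero] at this
    omega
  -- Here the determinant is `b' + c' = n'`, and a kiss consists of two consecutive inner passages
  -- above the two adjacent fringe passages.
  · rw [hm'.topBottom_iff (models_leftRoute_one fun _ => 0)]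
    have hD := hQ'.pos
    constructor
    · rintro ⟨i, j, m, h1, h2, h3, h4⟩
      have a0 := h1 0 (by omega)
      have a1 := h1 (m + 1) le_rfl
      simp only [Set.mem_Icc] at a0 a1
      have b0 := lFun_val_nonneg 0 (fun _ => 0) j
      have b1 := lFun_val_nonneg 0 (fun _ => 0) (j + m + 1)
      have c0 := (lFun_val_eq_zero_iff (n := n') (Q := Q') (p := i)).not.1 (by omega)
      have c1 := (lFun_val_eq_zero_iff (n := n') (Q := Q') (p := i + m + 1)).not.1 (by omega)
      push Not at c0 c1
      push_cast at a1
      omega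
    · intro hd
      refine ⟨0, -1, 0, fun k hk => ⟨⟨by omega, by omega⟩, by omega, by omega⟩, ?_, by simp, ?_⟩
      · rw [lFun_val_eq_zero_iff.2 (by omega), lFun_interior le_rfl (by omega)]
        exact val_ab_pos _
      · rw [lFun_val_eq_zero_iff.2 (by simp), lFun_interior (by simp) (by push_cast; omega)]
        exact val_ab_pos _
  · rw [e, hm'.topBottom_iff (models_wordOf Q n)]
    have e0 : b * c' - c * b' = n * c' - c * n' := by rw [hn, hn']; ring
    rw [e0]
    exact ⟨fun hk => by
      by_contra hd
      exact not_kissFun_l_l hQ' hQ (by omega) hk, kissFun_l_l hQ' hQ hco hco'⟩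

theorem compatible_leftRoute_iff {b c b' c' : ℤ} (h : LeftIndex b c) (h' : LeftIndex b' c') :
    doubleKronecker.Compatible (.route (leftRoute b c)) (.route (leftRoute b' c')) ↔
      |b * c' - c * b'| ≤ 1 := by
  rw [Compatible, topBottom_leftRoute_iff h h', topBottom_leftRoute_iff h' h, abs_le]
  constructor
  · rintro ⟨h1, h2⟩
    constructor <;> linarith
  · rintro ⟨h1, h2⟩
    constructor <;> linarith

theorem not_straightRoute_leftRoute (b c : ℤ) :
    ¬ doubleKronecker.StraightRoute (leftRoute b c) := by
  rw [leftRoute]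
  split_ifs
  · exact not_straightRoute_capL
  · exact not_straightRoute_route _ _
  · exact not_straightRoute_route _ _

theorem indicator_route (u : List Bool) : Route.indicator doubleKronecker (route false false u) =
    doubleKronecker.flow 1 (u.count false + 1) (u.count true) 0 := by
  show arrowCount (spell (routeCode false false u)) = _
  rw [spell_routeCode, arrowCount_append, arrowCount_append, arrowCount_word]
  funext α
  cases α <;> simp [arrowCount, doubleKronecker.flow]
  ring

theorem indicator_leftRoute {b c : ℤ} (h : LeftIndex b c) :
    Route.indicator doubleKronecker (leftRoute b c) = doubleKronecker.flow 1 b (c + 1) 0 := by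
  rcases leftRoute_cases h with ⟨rfl, rfl⟩ | ⟨rfl, rfl⟩ | ⟨n, Q, hn, hb, hc, hco, hQ, e⟩
  · rw [leftRoute_cap]
    funext α
    cases α <;> rfl
  · rw [leftRoute_one, indicator_route]
    funext α
    cases α <;> rfl
  · rw [e, indicator_route, count_false_wordOf hQ.step, count_wordOf hQ.step, hQ.last, hQ.zero]
    congr 1 <;> omega

theorem leftRoute_injective {b c b' c' : ℤ} (h : LeftIndex b c) (h' : LeftIndex b' c')
    (e : leftRoute b c = leftRoute b' c') : b = b' ∧ c = c' := by
  have := indicator_leftRoute h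
  rw [e, indicator_leftRoute h'] at this
  have h2 := congrFun this e2
  have h3 := congrFun this e3
  simp only [doubleKronecker.flow] at h2 h3
  omega

theorem exists_leftIndex_of_compatible {u : List Bool}
    (h : doubleKronecker.SelfCompatibleRoute (route false false u)) :
    ∃ b c, LeftIndex b c ∧ route false false u = leftRoute b c := by
  rcases List.eq_nil_or_concat' u with rfl | ⟨v, x, hv⟩
  · exact ⟨1, -1, Or.inr ⟨le_rfl, le_rfl, isCoprime_one_left⟩, leftRoute_one.symm⟩
  have hpos : 0 < u.length := by rw [hv]; simp
  clear hv
  have h1 := h.1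
  rw [(models_l u).topBottom_iff (models_l u)] at h1
  obtain ⟨hL, hco⟩ := linearL_of_not_kissFun hpos (height_step u) (height_zero u) h1
  have hlen := count_false_add_count_true u
  rw [height_length] at hL hco
  refine ⟨u.length - (u.count true - 1), u.count true - 1, Or.inr ⟨by omega, by omega, ?_⟩, ?_⟩
  · simpa [sub_eq_add_neg] using hco.add_mul_left_left (-1)
  · rw [leftRoute_eq hL (by omega), wordOf_height]

/-- The turn at the middle vertex depends on how it was reached, so both possible preceding letters
are carried through the induction. -/
theorem wordG_word (u : List Bool) :
    (∀ v, doubleKronecker.wordG v ((e2, true) :: (word u ++ [(f2, false), (f1, false)])) =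
      ![(u.count false : ℤ), u.count true - u.count false - 1, -u.count true] v) ∧
    (∀ v, doubleKronecker.wordG v ((f3, false) :: (word u ++ [(f2, false), (f1, false)])) =
      ![(u.count false : ℤ), u.count true - u.count false, -u.count true] v) := by
  induction u with
  | nil => constructor <;> decide
  | cons x u ih =>
    rw [word_cons]
    cases x
    · simp only [ab, Letter.fst, Letter.snd, Bool.false_eq_true, if_false, List.cons_append,
        List.nil_append, wordG, ih.1]
      constructor <;> intro v <;> fin_cases v <;> simp [turn, finish, doubleKronecker] <;> ring
    · simp only [ab, Letter.fst, Letter.snd, if_true, List.cons_append,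
        List.nil_append, wordG, ih.2]
      constructor <;> intro v <;> fin_cases v <;> simp [turn, finish, doubleKronecker] <;> ring

theorem g_route (u : List Bool) : Route.g doubleKronecker (route false false u) =
    ![(u.count false : ℤ), u.count true - u.count false - 1, -u.count true] := by
  funext v
  rw [← (wordG_word u).1 v]
  show doubleKronecker.wordG v (spell (routeCode false false u)) = _
  rw [spell_routeCode]
  simp [wordG, turn]

theorem g_leftRoute {b c : ℤ} (h : LeftIndex b c) :
    Route.g doubleKronecker (leftRoute b c) = ![b - 1, c + 1 - b, -c - 1] := by
  rcases leftRoute_cases h with ⟨rfl, rfl⟩ | ⟨rfl, rfl⟩ | ⟨n, Q, hn, hb, hc, hco, hQ, e⟩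
  · rw [leftRoute_cap]
    funext v
    fin_cases v <;> rfl
  · rw [leftRoute_one, g_route]
    funext v
    fin_cases v <;> rfl
  · rw [e, g_route, count_false_wordOf hQ.step, count_wordOf hQ.step, hQ.last, hQ.zero, hn]
    funext v
    fin_cases v <;> simp <;> ring

/-! Kisses between the two fringes. -/

/-- The first two passages of the right route are laid over the last two of the left route: `startR`
is above every passage of the latter, and `endL` is below every passage of the former. -/
theorem kissFun_right_left {n n' : ℕ} {h h' : ℤ → Bool} :
    KissFun (Set.Icc (-1) n') (routeFun true true n' h') (Set.Icc (-1) n)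
      (routeFun false false n h) := by
  have e1 : routeFun true true n' h' (-1) = .startR := by simp [routeFun]
  have e2 : routeFun false false n h n = .endL := by simp [routeFun]
  refine ⟨-1, n - 1, 0, fun k hk => ⟨⟨by omega, by omega⟩, by omega, by omega⟩, ?_, by simp, ?_⟩
  · rw [e1, routeFun]
    split_ifs <;> first | contradiction | decide | (cases h (n - 1) <;> decide)
  · rw [show (n : ℤ) - 1 + (0 : ℕ) + 1 = n by simp, e2, show (-1 : ℤ) + (0 : ℕ) + 1 = 0 by simp,
      routeFun]
    split_ifs <;> first | contradiction | decide | (cases h' 0 <;> decide)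

/-- The first two and the last two passages kiss, since the inner passages lie strictly between
those of the left and of the right fringe. -/
theorem not_selfCompatible_of_ne_nil {x : Bool} {u : List Bool} (hu : u ≠ []) :
    ¬ doubleKronecker.SelfCompatibleRoute (route x (!x) u) := by
  have hpos := List.length_pos_iff.2 hu
  intro hc
  have hc := hc.1
  have hm := models_route (x := x) (y := !x) (u := u) up_height
  rw [hm.topBottom_iff hm] at hc
  refine hc ?_
  set n := u.length
  have f1 : routeFun x (!x) n (up (height u)) (-1) = if x then .startR else .startL := by
    simp [routeFun]
  have f2 : routeFun x (!x) n (up (height u)) n = if x then .endL else .endR := by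
    cases x <;> simp [routeFun]
  have f3 : routeFun x (!x) n (up (height u)) 0 = ab (up (height u) 0) := by
    simp [routeFun, hpos]
  have f4 : routeFun x (!x) n (up (height u)) (n - 1) = ab (up (height u) (n - 1)) := by
    rw [routeFun, if_neg (by omega), if_pos (by omega)]
  have key : ∀ y : Bool, 0 < (ab y).val ∧ (ab y).val < 3 := by decide
  cases x
  · refine ⟨n - 1, -1, 0, fun k hk => ⟨⟨by omega, by omega⟩, by omega, by omega⟩, ?_, by simp, ?_⟩
    · rw [f1, f4]
      exact (key _).1
    · rw [show (n : ℤ) - 1 + (0 : ℕ) + 1 = n by simp, show (-1 : ℤ) + (0 : ℕ) + 1 = 0 by simp,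
        f2, f3]
      exact (key _).2
  · refine ⟨-1, n - 1, 0, fun k hk => ⟨⟨by omega, by omega⟩, by omega, by omega⟩, ?_, by simp, ?_⟩
    · rw [f1, f4]
      exact (key _).2
    · rw [show (n : ℤ) - 1 + (0 : ℕ) + 1 = n by simp, show (-1 : ℤ) + (0 : ℕ) + 1 = 0 by simp,
        f2, f3]
      exact (key _).1

theorem exists_leftRoute_of_selfCompatible {p : doubleKronecker.Route}
    (hp : doubleKronecker.SelfCompatibleRoute p) (hs : ¬ doubleKronecker.StraightRoute p) :
    ∃ b c, LeftIndex b c ∧ (p = leftRoute b c ∨ p = mirrorRoute (leftRoute b c)) := by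
  rcases route_cases p with rfl | rfl | ⟨x, y, u, rfl⟩
  · exact ⟨0, -1, Or.inl ⟨rfl, rfl⟩, Or.inl leftRoute_cap.symm⟩
  · exact ⟨0, -1, Or.inl ⟨rfl, rfl⟩, Or.inr (by rw [leftRoute_cap, mirrorRoute_capL])⟩
  · by_cases hxy : x = y
    · subst hxy
      cases x
      · obtain ⟨b, c, h, e⟩ := exists_leftIndex_of_compatible hp
        exact ⟨b, c, h, Or.inl e⟩
      · have hp' : doubleKronecker.SelfCompatibleRoute (mirrorRoute (route true true u)) :=
          compatible_mirrorTrail hp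
        rw [mirrorRoute_route] at hp'
        obtain ⟨b, c, h, e⟩ := exists_leftIndex_of_compatible hp'
        refine ⟨b, c, h, Or.inr ?_⟩
        rw [← e, mirrorRoute_route]
        simp [Function.comp_def]
    · obtain rfl : y = !x := by cases x <;> cases y <;> simp_all
      by_cases hu : u = []
      · subst hu
        exact (hs (straightRoute_route_nil x)).elim
      · exact (not_selfCompatible_of_ne_nil hu hp).elim

theorem exists_route_of_leftIndex {b c : ℤ} (h : LeftIndex b c) (hb : b ≠ 0) :
    ∃ u : List Bool, leftRoute b c = route false false u ∧ (u.count true : ℤ) = c + 1 := by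
  rcases leftRoute_cases h with ⟨rfl, rfl⟩ | ⟨rfl, rfl⟩ | ⟨n, Q, hn, hb, hc, hco, hQ, e⟩
  · exact (hb rfl).elim
  · exact ⟨[], leftRoute_one, by simp⟩
  · refine ⟨_, e, ?_⟩
    rw [count_wordOf hQ.step, hQ.last, hQ.zero, sub_zero]

/-- The cap kisses exactly the routes containing `a`. The mirror symmetry exchanges `a` and `b`, and
the left route has `c + 1` letters `b`. -/
theorem compatible_cap_mirrorRoute_iff {b c : ℤ} (h : LeftIndex b c) :
    doubleKronecker.Compatible (.route capL) (.route (mirrorRoute (leftRoute b c))) ↔ c = -1 := by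
  by_cases hb : b = 0
  · obtain ⟨rfl, rfl⟩ : b = 0 ∧ c = -1 := by rcases h with h | h <;> omega
    rw [leftRoute_cap, mirrorRoute_capL]
    simp [compatible_capL_capR]
  · obtain ⟨u, e, hu⟩ := exists_route_of_leftIndex h hb
    have hu' : false ∉ u.map not ↔ u.count true = 0 := by
      rw [List.count_eq_zero]
      simp
    rw [e, mirrorRoute_route, compatible_route_capL, hu']
    omega

theorem compatible_mirrorRoute_comm {p q : doubleKronecker.Route} :
    doubleKronecker.Compatible (.route p) (.route (mirrorRoute q)) ↔
      doubleKronecker.Compatible (.route q) (.route (mirrorRoute p)) := by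
  have := compatible_mirrorTrail_iff (s := .route p) (t := .route (mirrorRoute q))
  simp only [mirrorTrail, mirrorRoute_mirrorRoute] at this
  rw [← this]
  exact ⟨compatible_symm, compatible_symm⟩

theorem compatible_leftRoute_mirrorRoute_iff {b c b' c' : ℤ} (h : LeftIndex b c)
    (h' : LeftIndex b' c') :
    doubleKronecker.Compatible (.route (leftRoute b c)) (.route (mirrorRoute (leftRoute b' c'))) ↔
      (b = 0 ∧ c' = -1) ∨ (b' = 0 ∧ c = -1) := by
  by_cases hb : b = 0
  · obtain ⟨rfl, rfl⟩ : b = 0 ∧ c = -1 := by rcases h with h | h <;> omega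
    rw [leftRoute_cap, compatible_cap_mirrorRoute_iff h']
    rcases h' with h' | h' <;> omega
  by_cases hb' : b' = 0
  · obtain ⟨rfl, rfl⟩ : b' = 0 ∧ c' = -1 := by rcases h' with h' | h' <;> omega
    rw [compatible_mirrorRoute_comm, leftRoute_cap, compatible_cap_mirrorRoute_iff h]
    omega
  · obtain ⟨u, e, -⟩ := exists_route_of_leftIndex h hb
    obtain ⟨u', e', -⟩ := exists_route_of_leftIndex h' hb'
    simp only [hb, hb', false_and, or_self, iff_false]
    intro hc
    have hc := hc.2
    rw [e, e', mirrorRoute_route] at hc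
    have hm := models_route (x := false) (y := false) (u := u) up_height
    have hm' := models_route (x := true) (y := true) (u := u'.map not) up_height
    rw [Bool.not_false, hm'.topBottom_iff hm] at hc
    exact hc kissFun_right_left

/-! Compatibility of routes and bands. -/

/-- The routes at the left fringe, with the index of `e₁f₁⁻¹` changed to `(0, 1)`. -/
noncomputable def lRoute (b c : ℤ) : doubleKronecker.Route :=
  if (b, c) = (0, 1) then leftRoute 0 (-1) else leftRoute b c

/-- The routes at the right fringe. -/
noncomputable def rRoute (b c : ℤ) : doubleKronecker.Route := mirrorRoute (lRoute c b)

theorem lRoute_zero_one : lRoute 0 1 = leftRoute 0 (-1) := if_pos rfl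

theorem lRoute_of_one_le {b c : ℤ} (hb : 1 ≤ b) : lRoute b c = leftRoute b c := by
  rw [lRoute, if_neg]
  simp only [Prod.mk.injEq]
  omega

theorem coprime_cases {b c : ℕ} (h : Nat.Coprime b c) :
    (b = 0 ∧ c = 1) ∨ (1 ≤ b ∧ LeftIndex b c) := by
  rcases Nat.eq_zero_or_pos b with rfl | hb
  · left
    exact ⟨rfl, by simpa using h⟩
  · exact Or.inr ⟨hb, Or.inr ⟨by omega, by omega, Nat.isCoprime_iff_coprime.2 h⟩⟩

theorem height_eq_of_forall {u : List Bool} (h : false ∉ u) {p : ℤ} (h0 : 0 ≤ p)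
    (h1 : p ≤ u.length) : height u p = p := by
  rw [height, List.count_eq_length.2, List.length_take]
  · omega
  · intro x hx
    cases x
    · exact (h (List.mem_of_mem_take hx)).elim
    · rfl

theorem eq_bnd_of_not_mem {u : List Bool} (hb : doubleKronecker.IsBand (word u)) (h : false ∉ u) :
    (⟦⟨word u, hb⟩⟧ : doubleKronecker.Band) = bnd 0 1 := by
  have hpos : (0 : ℤ) < u.length := by exact_mod_cast List.length_pos_iff.2 (ne_nil_of_isBand hb)
  have h0 : u.count false = 0 := List.count_eq_zero.2 h
  have h1 := count_false_add_count_true u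
  have hQ : ∀ p, bandHeight u p = p := by
    intro p
    rw [bandHeight, height_eq_of_forall h (Int.emod_nonneg _ hpos.ne')
      (Int.emod_lt_of_pos _ hpos).le, show u.count true = u.length by omega]
    linarith [Int.emod_add_mul_ediv p u.length, mul_comm (p / (u.length : ℤ)) u.length]
  obtain ⟨hco, e⟩ := band_eq_of_windows hb (fun i j k => by rw [hQ, hQ, hQ, hQ]; omega)
  rw [h0] at hco e
  rw [Nat.coprime_zero_left] at hco
  rw [e, hco]

/-- Two adjacent fringe passages lie below any two consecutive letters of a band. -/
theorem kissFun_to_empty {Q' Q : ℤ → ℤ} :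
    KissFun Set.univ (bFun Q') (Set.Icc (-1) (0 : ℕ)) (lFun 0 Q) := by
  refine ⟨0, -1, 0, fun k hk => ⟨trivial, by omega, ?_⟩, ?_, by simp, ?_⟩
  · push_cast
    omega
  · rw [val_lFun_zero]
    exact val_ab_pos _
  · rw [val_lFun_zero]
    exact val_ab_pos _

/-- Windows of length `n` all have the same height, so they can be split off until the remaining
length is below `n`. -/
theorem windows_of_periodic {n : ℕ} {c : ℤ} {Q Q' : ℤ → ℤ} (hn : 0 < n)
    (h1 : ∀ d, Q' (d + n) - Q' d = c)
    (h2 : ∀ (d : ℤ) (k : ℕ), k ≤ n → Q k - 1 ≤ Q' (d + k) - Q' d ∧ Q' (d + k) - Q' d ≤ Q k)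
    (i j : ℤ) (k : ℕ) : Q' (i + k) - Q' i ≤ Q' (j + k) - Q' j + 1 := by
  induction k using Nat.strong_induction_on with
  | _ k ih =>
    rcases Nat.lt_or_ge k n with hk | hk
    · linarith [h2 i k hk.le, h2 j k hk.le]
    · have := ih (k - n) (by omega)
      have e1 := h1 (i + (k - n : ℕ))
      have e2 := h1 (j + (k - n : ℕ))
      rw [show i + (k - n : ℕ) + n = i + k by omega] at e1
      rw [show j + (k - n : ℕ) + n = j + k by omega] at e2
      linarith

theorem add_mul_of_add {Q : ℤ → ℤ} {n c : ℤ} (h : ∀ d, Q (d + n) - Q d = c) (k : ℕ) :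
    Q (n * k) - Q 0 = c * k := by
  induction k with
  | zero => simp
  | succ k ih =>
    have := h (n * k)
    push_cast
    rw [mul_add, mul_one, mul_add]
    linarith

/-- By `windows_of_compatible` the route prescribes all window heights of the band up to one unit,
so the band is balanced and thus some `bnd`; it remains to compare slopes. -/
theorem exists_eq_of_compatible_leftRoute {b c : ℤ} (h : LeftIndex b c) {X : doubleKronecker.Band}
    (hX : doubleKronecker.Compatible (.route (leftRoute b c)) (.band X)) :
    ∃ b' c' : ℕ, Nat.Coprime b' c' ∧ leftRoute b c = lRoute b' c' ∧ X = bnd b' c' := by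
  obtain ⟨u, hb, rfl⟩ := band_cases X
  have hm' := models_bandHeight hb
  have hu := ne_nil_of_isBand hb
  rcases leftRoute_cases h with ⟨rfl, rfl⟩ | ⟨rfl, rfl⟩ | ⟨n, Q, hn, hb1, hc1, hco, hQ, e⟩
  · refine ⟨0, 1, by simp, lRoute_zero_one.symm, eq_bnd_of_not_mem hb ?_⟩
    have := hX.2
    rwa [leftRoute_cap, topBottom_band_capL] at this
  · have := hX.2
    rw [hm'.topBottom_iff (models_leftRoute_one fun _ => 0)] at this
    exact (this kissFun_to_empty).elim
  · have hm := models_wordOf Q n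
    rw [← e] at hm
    have k1 := hX.1
    have k2 := hX.2
    rw [hm.topBottom_iff hm'] at k1
    rw [hm'.topBottom_iff hm] at k2
    have hw := windows_of_compatible hQ.step (bandHeight_step hu) hQ.zero k2 k1
    have hper : ∀ d, bandHeight u (d + n) - bandHeight u d = c := by
      intro d
      have := (hw d).2
      rw [hQ.last] at this
      omega
    obtain ⟨hco', e'⟩ := band_eq_of_windows hb
      (windows_of_periodic hQ.pos hper fun d => (hw d).1)
    have hlen := count_false_add_count_true u
    -- The height gained over `n * u.length` letters is computed once with the period `n` and once
    -- with the period of the band.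
    have f1 := add_mul_of_add hper u.length
    have f2 := add_mul_of_add (Q := bandHeight u) (n := u.length) (c := u.count true)
      (fun d => by rw [bandHeight_add_length hu]; ring) n
    rw [mul_comm, f2] at f1
    have hpos := List.length_pos_iff.2 hu
    have hn0 := hQ.pos
    rcases eq_or_lt_of_le hc1 with rfl | hc0
    · have : (0 : ℤ) ≤ u.count true * n := by positivity
      omega
    · lift c to ℕ using (by omega)
      lift b to ℕ using (by omega)
      have hbc : Nat.Coprime b c := by
        rcases h with h | h
        · omega
        · exact Nat.isCoprime_iff_coprime.1 h.2.2
      obtain ⟨h1, h2⟩ := eq_of_coprime_of_mul_eq hbc hco' (by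
        have : u.count true * n = c * u.length := by exact_mod_cast f1
        have hn' : n = b + c := by exact_mod_cast hn
        rw [← hlen, hn'] at this
        linarith)
      refine ⟨b, c, hbc, (lRoute_of_one_le hb1).symm, ?_⟩
      rw [e', ← h1, ← h2]

theorem compatible_lRoute_bnd {b c : ℕ} (h : Nat.Coprime b c) :
    doubleKronecker.Compatible (.route (lRoute b c)) (.band (bnd b c)) := by
  rcases coprime_cases h with ⟨rfl, rfl⟩ | ⟨hb, hL⟩
  · obtain ⟨Q, hb, hQ, e, -⟩ := bnd_spec h
    rw [Nat.cast_zero, Nat.cast_one, lRoute_zero_one, leftRoute_cap, e]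
    refine ⟨not_topBottom_capL _, ?_⟩
    rw [topBottom_band_capL, ← List.count_eq_zero]
    have h0 := hQ.add_period (m := (0 + 1 : ℕ)) (d := 1) (by simp) 0
    rw [zero_add] at h0
    have := count_false_wordOf hQ.step (0 + 1)
    rw [h0] at this
    omega
  · rw [lRoute_of_one_le (by omega)]
    obtain ⟨Q', hb', hQ', e', hm'⟩ := bnd_spec h
    rcases leftRoute_cases hL with h0 | h0 | ⟨n, Q, hn, hb1, hc1, hco, hQ, e⟩
    · omega
    · omega
    · have hm := models_wordOf Q n
      rw [← e] at hm
      rw [Compatible, hm.topBottom_iff hm', hm'.topBottom_iff hm]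
      refine ⟨not_kissFun_l_b hQ hQ' ?_, not_kissFun_b_l hQ' hQ ?_⟩
      · rw [hn]
        push_cast
        ring
      · rw [hn]
        push_cast
        ring

/-! The self-compatible bending routes. -/

theorem lRoute_of_lIndex {b c : ℤ} (h : doubleKronecker.LIndex b c) :
    ∃ b' c', LeftIndex b' c' ∧ lRoute b c = leftRoute b' c' ∧
      (b = 0 ∧ c = 1 ∧ b' = 0 ∧ c' = -1 ∨ 1 ≤ b ∧ b' = b ∧ c' = c) := by
  rcases eq_or_ne b 0 with rfl | hb
  · have : c = 1 := by
      rcases h with ⟨-, h1, h2⟩ | h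
      · rw [Int.gcd_zero_left] at h2
        omega
      · omega
    subst this
    exact ⟨0, -1, Or.inl ⟨rfl, rfl⟩, lRoute_zero_one, Or.inl ⟨rfl, rfl, rfl, rfl⟩⟩
  · have hb1 : 1 ≤ b := by rcases h with h | h <;> omega
    refine ⟨b, c, Or.inr ⟨hb1, ?_⟩, lRoute_of_one_le hb1, Or.inr ⟨hb1, rfl, rfl⟩⟩
    rcases h with ⟨-, h1, h2⟩ | ⟨-, rfl⟩
    · exact ⟨by omega, Int.isCoprime_iff_gcd_eq_one.2 h2⟩
    · exact ⟨le_rfl, isCoprime_one_right.neg_right⟩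

theorem exists_lIndex_of_leftIndex {b c : ℤ} (h : LeftIndex b c) :
    ∃ b' c', doubleKronecker.LIndex b' c' ∧ leftRoute b c = lRoute b' c' := by
  rcases h with ⟨rfl, rfl⟩ | ⟨h1, h2, h3⟩
  · exact ⟨0, 1, Or.inl ⟨le_rfl, by decide, by decide⟩, lRoute_zero_one.symm⟩
  · refine ⟨b, c, ?_, (lRoute_of_one_le h1).symm⟩
    rcases eq_or_lt_of_le h2 with rfl | h2
    · exact Or.inr ⟨h1, rfl⟩
    · exact Or.inl ⟨by omega, by omega, Int.isCoprime_iff_gcd_eq_one.1 h3⟩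

theorem lIndex_swap {b c : ℤ} : doubleKronecker.LIndex c b ↔ doubleKronecker.RIndex b c := by
  rw [doubleKronecker.LIndex, doubleKronecker.RIndex, Int.gcd_comm]
  tauto

theorem lIndex_of_coprime {b c : ℕ} (h : Nat.Coprime b c) : doubleKronecker.LIndex b c :=
  Or.inl ⟨by omega, by omega, by simpa using h⟩

theorem selfCompatible_leftRoute {b c : ℤ} (h : LeftIndex b c) :
    doubleKronecker.SelfCompatibleRoute (leftRoute b c) :=
  (compatible_leftRoute_iff h h).2 (by rw [mul_comm c b, sub_self]; simp)

theorem selfCompatible_mirrorRoute {p : doubleKronecker.Route}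
    (h : doubleKronecker.SelfCompatibleRoute p) :
    doubleKronecker.SelfCompatibleRoute (mirrorRoute p) := compatible_mirrorTrail h

theorem selfCompatible_lRoute {b c : ℤ} (h : doubleKronecker.LIndex b c) :
    doubleKronecker.SelfCompatibleRoute (lRoute b c) := by
  obtain ⟨b', c', h', e, -⟩ := lRoute_of_lIndex h
  exact e ▸ selfCompatible_leftRoute h'

theorem not_straightRoute_lRoute (b c : ℤ) : ¬ doubleKronecker.StraightRoute (lRoute b c) := by
  rw [lRoute]
  split_ifs <;> exact not_straightRoute_leftRoute _ _

theorem not_straightRoute_rRoute (b c : ℤ) : ¬ doubleKronecker.StraightRoute (rRoute b c) :=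
  straightRoute_mirrorRoute_iff.not.2 (not_straightRoute_lRoute c b)

theorem selfCompatible_bending_eq :
    {p : doubleKronecker.Route |
        doubleKronecker.SelfCompatibleRoute p ∧ ¬ doubleKronecker.StraightRoute p} =
      {p | ∃ b c : ℤ, doubleKronecker.LIndex b c ∧ p = lRoute b c} ∪
        {p | ∃ b c : ℤ, doubleKronecker.RIndex b c ∧ p = rRoute b c} := by
  ext p
  simp only [Set.mem_ofPred_eq, Set.mem_union]
  constructor
  · rintro ⟨h1, h2⟩
    obtain ⟨b, c, h, rfl | rfl⟩ := exists_leftRoute_of_selfCompatible h1 h2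
    · left
      exact exists_lIndex_of_leftIndex h
    · right
      obtain ⟨b', c', h', e⟩ := exists_lIndex_of_leftIndex h
      exact ⟨c', b', lIndex_swap.1 h', by rw [e, rRoute]⟩
  · rintro (⟨b, c, h, rfl⟩ | ⟨b, c, h, rfl⟩)
    · exact ⟨selfCompatible_lRoute h, not_straightRoute_lRoute b c⟩
    · exact ⟨selfCompatible_mirrorRoute (selfCompatible_lRoute (lIndex_swap.2 h)),
        not_straightRoute_rRoute b c⟩

theorem indicator_lRoute {b c : ℤ} (h : doubleKronecker.LIndex b c) :
    Route.indicator doubleKronecker (lRoute b c) =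
      if (b, c) = (0, 1) then doubleKronecker.flow 1 0 0 0
      else doubleKronecker.flow 1 b (c + 1) 0 := by
  obtain ⟨b', c', h', e, ⟨rfl, rfl, rfl, rfl⟩ | ⟨hb, rfl, rfl⟩⟩ := lRoute_of_lIndex h
  · rw [e, if_pos rfl, indicator_leftRoute h']
    rfl
  · rw [e, if_neg (by simp only [Prod.mk.injEq]; omega), indicator_leftRoute h']

theorem indicator_rRoute {b c : ℤ} (h : doubleKronecker.RIndex b c) :
    Route.indicator doubleKronecker (rRoute b c) =
      if (b, c) = (1, 0) then doubleKronecker.flow 0 0 0 1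
      else doubleKronecker.flow 0 (b + 1) c 1 := by
  funext α
  rw [rRoute, indicator_mirrorRoute, indicator_lRoute (lIndex_swap.2 h)]
  by_cases hbc : (b, c) = (1, 0)
  · obtain ⟨rfl, rfl⟩ := Prod.mk.inj hbc
    cases α <;> rfl
  · rw [if_neg hbc, if_neg (by simp only [Prod.mk.injEq] at hbc ⊢; omega)]
    cases α <;> rfl

/-! Trails compatible with a band. -/

theorem compatible_rRoute_bnd {b c : ℕ} (h : Nat.Coprime b c) :
    doubleKronecker.Compatible (.route (rRoute b c)) (.band (bnd b c)) := by
  have := compatible_mirrorTrail (compatible_lRoute_bnd h.symm)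
  rwa [mirrorTrail, mirrorTrail, mirrorBand_bnd h.symm] at this

theorem eq_of_compatible_band {p : doubleKronecker.Route} {X : doubleKronecker.Band}
    (hp : doubleKronecker.SelfCompatibleRoute p) (hs : ¬ doubleKronecker.StraightRoute p)
    (h : doubleKronecker.Compatible (.route p) (.band X)) :
    ∃ b c : ℕ, Nat.Coprime b c ∧ X = bnd b c ∧ (p = lRoute b c ∨ p = rRoute b c) := by
  obtain ⟨b, c, hbc, rfl | rfl⟩ := exists_leftRoute_of_selfCompatible hp hs
  · obtain ⟨b', c', h', e, rfl⟩ := exists_eq_of_compatible_leftRoute hbc h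
    exact ⟨b', c', h', rfl, Or.inl e⟩
  · have h2 := compatible_mirrorTrail h
    rw [mirrorTrail, mirrorTrail, mirrorRoute_mirrorRoute] at h2
    obtain ⟨b', c', h', e, eX⟩ := exists_eq_of_compatible_leftRoute hbc h2
    refine ⟨c', b', h'.symm, ?_, Or.inr ?_⟩
    · rw [← mirrorBand_mirrorBand X, eX, mirrorBand_bnd h']
    · rw [e, rRoute]

theorem eq_of_compatible_bnd_route {p : doubleKronecker.Route} {b c : ℕ} (h : Nat.Coprime b c)
    (hp : doubleKronecker.SelfCompatibleRoute p) (hs : ¬ doubleKronecker.StraightRoute p)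
    (hc : doubleKronecker.Compatible (.route p) (.band (bnd b c))) :
    p = lRoute b c ∨ p = rRoute b c := by
  obtain ⟨b', c', h', e, hp'⟩ := eq_of_compatible_band hp hs hc
  obtain ⟨rfl, rfl⟩ := bnd_injective h h' e
  exact hp'

theorem not_compatible_lRoute_rRoute {b c : ℕ} (h : Nat.Coprime b c) :
    ¬ doubleKronecker.Compatible (.route (lRoute b c)) (.route (rRoute b c)) := by
  obtain ⟨b1, c1, h1, e1, h1'⟩ := lRoute_of_lIndex (lIndex_of_coprime h)
  obtain ⟨b2, c2, h2, e2, h2'⟩ := lRoute_of_lIndex (lIndex_of_coprime h.symm)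
  rw [rRoute, e1, e2, compatible_leftRoute_mirrorRoute_iff h1 h2]
  omega

theorem lRoute_ne_rRoute {b c : ℕ} (h : Nat.Coprime b c) : lRoute b c ≠ rRoute b c := by
  intro e
  apply not_compatible_lRoute_rRoute h
  rw [← e]
  exact selfCompatible_lRoute (lIndex_of_coprime h)

theorem isReducedBundle_pair {p : doubleKronecker.Route} {X : doubleKronecker.Band}
    (hp : doubleKronecker.SelfCompatibleRoute p) (hs : ¬ doubleKronecker.StraightRoute p)
    (hX : doubleKronecker.SelfCompatibleBand X)
    (h : doubleKronecker.Compatible (.route p) (.band X)) :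
    doubleKronecker.IsReducedBundle {.route p, .band X} := by
  refine ⟨?_, ?_⟩
  · rintro s (rfl | rfl) t (rfl | rfl)
    · exact hp
    · exact h
    · exact compatible_symm h
    · exact hX
  · rintro s (rfl | rfl)
    · exact hs
    · exact id

/-- No other band is compatible with the given one, and of its two compatible bending routes at most
one fits into a bundle. -/
theorem subset_pair_of_isReducedBundle {K : Set doubleKronecker.Trail}
    (hK : doubleKronecker.IsReducedBundle K) {b c : ℕ} (h : Nat.Coprime b c)
    (hX : .band (bnd b c) ∈ K) :
    K ⊆ {.route (lRoute b c), .band (bnd b c)} ∨ K ⊆ {.route (rRoute b c), .band (bnd b c)} := by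
  have key : ∀ t ∈ K, t = .route (lRoute b c) ∨ t = .route (rRoute b c) ∨
      t = .band (bnd b c) := by
    intro t ht
    cases t with
    | route p =>
      rcases eq_of_compatible_bnd_route h (hK.1 _ ht _ ht) (hK.2 _ ht) (hK.1 _ ht _ hX)
        with rfl | rfl <;> simp
    | band Y =>
      obtain ⟨b', c', h', rfl⟩ := exists_eq_bnd_of_selfCompatible (hK.1 _ ht _ ht)
      obtain ⟨rfl, rfl⟩ := eq_of_compatible_bnd h' h (hK.1 _ ht _ hX)
      simp
  by_cases hl : .route (lRoute b c) ∈ K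
  · left
    intro t ht
    rcases key t ht with rfl | rfl | rfl
    · simp
    · exact (not_compatible_lRoute_rRoute h (hK.1 _ hl _ ht)).elim
    · simp
  · right
    intro t ht
    rcases key t ht with rfl | rfl | rfl
    · exact (hl ht).elim
    · simp
    · simp

theorem isReducedBundle_l {b c : ℕ} (h : Nat.Coprime b c) :
    doubleKronecker.IsReducedBundle {.route (lRoute b c), .band (bnd b c)} :=
  isReducedBundle_pair (selfCompatible_lRoute (lIndex_of_coprime h)) (not_straightRoute_lRoute b c)
    (selfCompatible_bnd h) (compatible_lRoute_bnd h)

theorem isReducedBundle_r {b c : ℕ} (h : Nat.Coprime b c) :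
    doubleKronecker.IsReducedBundle {.route (rRoute b c), .band (bnd b c)} :=
  isReducedBundle_pair
    (selfCompatible_mirrorRoute (selfCompatible_lRoute (lIndex_of_coprime h.symm)))
    (not_straightRoute_rRoute b c) (selfCompatible_bnd h) (compatible_rRoute_bnd h)

theorem maximalReducedBundle_eq :
    {K : Set doubleKronecker.Trail |
        doubleKronecker.IsMaximalReducedBundle K ∧ ∃ X : doubleKronecker.Band, .band X ∈ K} =
      {K | ∃ b c : ℕ, Nat.Coprime b c ∧ K = {.route (lRoute b c), .band (bnd b c)}} ∪
        {K | ∃ b c : ℕ, Nat.Coprime b c ∧ K = {.route (rRoute b c), .band (bnd b c)}} := by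
  ext K
  simp only [Set.mem_ofPred_eq, Set.mem_union]
  constructor
  · rintro ⟨hK, X, hX⟩
    obtain ⟨b, c, h, rfl⟩ := exists_eq_bnd_of_selfCompatible (hK.prop.1 _ hX _ hX)
    rcases subset_pair_of_isReducedBundle hK.prop h hX with hs | hs
    · exact Or.inl ⟨b, c, h, hK.eq_of_subset (isReducedBundle_l h) hs⟩
    · exact Or.inr ⟨b, c, h, hK.eq_of_subset (isReducedBundle_r h) hs⟩
  · rintro (⟨b, c, h, rfl⟩ | ⟨b, c, h, rfl⟩)
    · refine ⟨⟨isReducedBundle_l h, fun K' hK' hs => ?_⟩, bnd b c, by simp⟩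
      rcases subset_pair_of_isReducedBundle hK' h (hs (by simp)) with h1 | h1
      · exact h1
      · have := h1 (hs (Set.mem_insert _ _))
        simp [lRoute_ne_rRoute h] at this
    · refine ⟨⟨isReducedBundle_r h, fun K' hK' hs => ?_⟩, bnd b c, by simp⟩
      rcases subset_pair_of_isReducedBundle hK' h (hs (by simp)) with h1 | h1
      · have := h1 (hs (Set.mem_insert _ _))
        simp [(lRoute_ne_rRoute h).symm] at this
      · exact h1

/-! Band-stable cliques. -/

theorem isClique_straight_union {K : Set doubleKronecker.Route} (hK : doubleKronecker.IsClique K) :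
    doubleKronecker.IsClique ({p | doubleKronecker.StraightRoute p} ∪ K) := by
  rintro p (hp | hp) q (hq | hq)
  · exact compatible_of_straightRoute hp _
  · exact compatible_of_straightRoute hp _
  · exact compatible_symm (compatible_of_straightRoute hq _)
  · exact hK p hp q hq

theorem isClique_singleton {p : doubleKronecker.Route}
    (hp : doubleKronecker.SelfCompatibleRoute p) : doubleKronecker.IsClique {p} := by
  rintro _ rfl _ rfl
  exact hp

theorem isClique_pair {p q : doubleKronecker.Route}
    (hp : doubleKronecker.SelfCompatibleRoute p) (hq : doubleKronecker.SelfCompatibleRoute q)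
    (h : doubleKronecker.Compatible (.route p) (.route q)) : doubleKronecker.IsClique {p, q} := by
  rintro _ (rfl | rfl) _ (rfl | rfl)
  · exact hp
  · exact h
  · exact compatible_symm h
  · exact hq

theorem bandCompatible_straight_union {K : Set doubleKronecker.Route} {X : doubleKronecker.Band} :
    doubleKronecker.BandCompatible ({p | doubleKronecker.StraightRoute p} ∪ K) X ↔
      doubleKronecker.BandCompatible K X :=
  ⟨fun h p hp => h p (Or.inr hp), fun h p hp =>
    hp.elim (fun hp => compatible_of_straightRoute hp _) (h p)⟩

/-- Adding straight routes keeps a clique and does not change which bands are compatible with it. -/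
theorem straight_subset_of_isBandStable {K : Set doubleKronecker.Route}
    (hK : doubleKronecker.IsBandStable K) : {p | doubleKronecker.StraightRoute p} ⊆ K := by
  by_contra hs
  obtain ⟨X, h1, h2⟩ := hK.2 _ (isClique_straight_union hK.1)
    ⟨Set.subset_union_right, fun h => hs (Set.subset_union_left.trans h)⟩
  exact h2 (bandCompatible_straight_union.2 h1)

/-- Used to show that a single bending route never makes a maximal clique. A Bézout solution `(-v,
u)` has determinant 1 with `(b, c)`, and adding a large multiple of `(b, c)` moves it into the index
set. -/
theorem exists_neighbour {b c : ℤ} (h : LeftIndex b c) (hc : 0 ≤ c ∨ b = 0) :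
    ∃ b' c', LeftIndex b' c' ∧ b * c' - c * b' = 1 := by
  rcases h with ⟨rfl, rfl⟩ | ⟨h1, h2, u, v, huv⟩
  · exact ⟨1, -1, Or.inr ⟨le_rfl, le_rfl, isCoprime_one_left⟩, by norm_num⟩
  · have hc0 : 0 ≤ c := by omega
    have key : ∀ k : ℤ, 1 ≤ k * b - v → -1 ≤ k * c + u →
        ∃ b' c', LeftIndex b' c' ∧ b * c' - c * b' = 1 := fun k h1 h2 =>
      ⟨k * b - v, k * c + u, Or.inr ⟨h1, h2, -c, b, by linarith⟩, by linarith⟩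
    rcases eq_or_lt_of_le hc0 with rfl | hc1
    · have hu : u * b = 1 := by linarith
      have : 0 < u := by
        by_contra hn
        nlinarith
      refine key (|v| + 1) ?_ (by omega)
      nlinarith [le_abs_self v, abs_nonneg v]
    · refine key (|v| + |u| + 1) ?_ ?_
      · nlinarith [le_abs_self v, abs_nonneg v, abs_nonneg u]
      · nlinarith [neg_abs_le u, abs_nonneg v, abs_nonneg u]

theorem exists_compatible_ne {b c : ℕ} (h : Nat.Coprime b c) :
    ∃ q, doubleKronecker.SelfCompatibleRoute q ∧ ¬ doubleKronecker.StraightRoute q ∧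
      q ≠ lRoute b c ∧ doubleKronecker.Compatible (.route (lRoute b c)) (.route q) := by
  obtain ⟨b1, c1, h1, e1, h1'⟩ := lRoute_of_lIndex (lIndex_of_coprime h)
  obtain ⟨b2, c2, h2, hd⟩ := exists_neighbour h1 (by omega)
  refine ⟨leftRoute b2 c2, selfCompatible_leftRoute h2, not_straightRoute_leftRoute _ _, ?_, ?_⟩
  · rw [e1]
    intro e
    obtain ⟨rfl, rfl⟩ := leftRoute_injective h2 h1 e
    rw [mul_comm, sub_self] at hd
    omega
  · rw [e1, compatible_leftRoute_iff h1 h2, hd, abs_one]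

/-- The band of the same slope is the witness for every extension: an added bending route compatible
with it would have to be `q`, which kisses `p`. -/
theorem isBandStable_singleton {b c : ℕ} {p q : doubleKronecker.Route}
    (hpq : ∀ x, doubleKronecker.SelfCompatibleRoute x → ¬ doubleKronecker.StraightRoute x →
      doubleKronecker.Compatible (.route x) (.band (bnd b c)) → x = p ∨ x = q)
    (hp : doubleKronecker.SelfCompatibleRoute p)
    (hX : doubleKronecker.Compatible (.route p) (.band (bnd b c)))
    (hc : ¬ doubleKronecker.Compatible (.route p) (.route q)) :
    doubleKronecker.IsBandStable ({p | doubleKronecker.StraightRoute p} ∪ {p}) := by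
  refine ⟨isClique_straight_union (isClique_singleton hp), fun K' hK' hss => ⟨bnd b c, ?_, ?_⟩⟩
  · rw [bandCompatible_straight_union]
    rintro _ rfl
    exact hX
  · intro hK
    obtain ⟨x, hx, hx'⟩ := Set.exists_of_ssubset hss
    simp only [Set.mem_union, Set.mem_ofPred_eq, Set.mem_singleton_iff, not_or] at hx'
    rcases hpq x (hK' x hx x hx) hx'.1 (hK x hx) with rfl | rfl
    · exact hx'.2 rfl
    · exact hc (hK' _ (hss.1 (Or.inr rfl)) _ hx)

theorem not_isMaximalClique_of_compatible {p q : doubleKronecker.Route}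
    (hp : doubleKronecker.SelfCompatibleRoute p) (hq : doubleKronecker.SelfCompatibleRoute q)
    (hs : ¬ doubleKronecker.StraightRoute q) (hne : q ≠ p)
    (h : doubleKronecker.Compatible (.route p) (.route q)) :
    ¬ doubleKronecker.IsMaximalClique ({p | doubleKronecker.StraightRoute p} ∪ {p}) := by
  intro hm
  have := hm.le_of_ge (isClique_straight_union (isClique_pair hp hq h))
    (Set.union_subset_union_right _ (by simp)) (Or.inr (Set.mem_insert_of_mem _ rfl))
  simp [hs, hne] at this

theorem isBandStable_l {b c : ℕ} (h : Nat.Coprime b c) :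
    doubleKronecker.IsBandStable ({p | doubleKronecker.StraightRoute p} ∪ {lRoute b c}) :=
  isBandStable_singleton (fun _ => eq_of_compatible_bnd_route h)
    (selfCompatible_lRoute (lIndex_of_coprime h)) (compatible_lRoute_bnd h)
    (not_compatible_lRoute_rRoute h)

theorem isBandStable_r {b c : ℕ} (h : Nat.Coprime b c) :
    doubleKronecker.IsBandStable ({p | doubleKronecker.StraightRoute p} ∪ {rRoute b c}) :=
  isBandStable_singleton (fun _ hx hs hc => (eq_of_compatible_bnd_route h hx hs hc).symm)
    (selfCompatible_mirrorRoute (selfCompatible_lRoute (lIndex_of_coprime h.symm)))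
    (compatible_rRoute_bnd h) (fun hc => not_compatible_lRoute_rRoute h (compatible_symm hc))

theorem not_isMaximalClique_l {b c : ℕ} (h : Nat.Coprime b c) :
    ¬ doubleKronecker.IsMaximalClique ({p | doubleKronecker.StraightRoute p} ∪ {lRoute b c}) := by
  obtain ⟨q, h1, h2, h3, h4⟩ := exists_compatible_ne h
  exact not_isMaximalClique_of_compatible (selfCompatible_lRoute (lIndex_of_coprime h)) h1 h2 h3 h4

theorem not_isMaximalClique_r {b c : ℕ} (h : Nat.Coprime b c) :
    ¬ doubleKronecker.IsMaximalClique ({p | doubleKronecker.StraightRoute p} ∪ {rRoute b c}) := by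
  obtain ⟨q, h1, h2, h3, h4⟩ := exists_compatible_ne h.symm
  refine not_isMaximalClique_of_compatible (q := mirrorRoute q)
    (selfCompatible_mirrorRoute (selfCompatible_lRoute (lIndex_of_coprime h.symm)))
    (selfCompatible_mirrorRoute h1) (straightRoute_mirrorRoute_iff.not.2 h2) ?_
    (compatible_mirrorTrail h4)
  intro e
  apply h3
  rw [← mirrorRoute_mirrorRoute q, e, rRoute, mirrorRoute_mirrorRoute]

theorem isClique_straight :
    doubleKronecker.IsClique {p | doubleKronecker.StraightRoute p} :=
  fun _ hp _ _ => compatible_of_straightRoute hp _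

/-- A bending route compatible with all bands would belong to both pairs of slopes `(1, 0)` and `(0,
1)`; the indicator vectors show these pairs to be disjoint. -/
theorem isBandStable_straight :
    doubleKronecker.IsBandStable {p | doubleKronecker.StraightRoute p} := by
  refine ⟨isClique_straight, fun K' hK' hss => ?_⟩
  by_contra! hX
  obtain ⟨x, hx, hx'⟩ := Set.exists_of_ssubset hss
  have key : ∀ b c : ℕ, doubleKronecker.Compatible (.route x) (.band (bnd b c)) := fun b c =>
    hX (bnd b c) (fun p hp => compatible_of_straightRoute hp _) x hx
  have hself := hK' x hx x hx
  have h10 := eq_of_compatible_bnd_route (b := 1) (c := 0) (by decide) hself hx' (key 1 0)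
  have h01 := eq_of_compatible_bnd_route (b := 0) (c := 1) (by decide) hself hx' (key 0 1)
  push_cast at h10 h01
  have i1 := indicator_lRoute (b := 1) (c := 0) (Or.inl (by decide))
  have i2 := indicator_rRoute (b := 1) (c := 0) (Or.inl (by decide))
  have i3 := indicator_lRoute (b := 0) (c := 1) (Or.inl (by decide))
  have i4 := indicator_rRoute (b := 0) (c := 1) (Or.inl (by decide))
  rcases h10 with e | e <;> rcases h01 with e' | e' <;>
    have h := congrArg (Route.indicator doubleKronecker) (e.symm.trans e')
  · have := congrFun (i1.symm.trans (h.trans i3)) DKArrow.e2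
    simp [doubleKronecker.flow] at this
  · have := congrFun (i1.symm.trans (h.trans i4)) DKArrow.e1
    simp [doubleKronecker.flow] at this
  · have := congrFun (i2.symm.trans (h.trans i3)) DKArrow.e1
    simp [doubleKronecker.flow] at this
  · have := congrFun (i2.symm.trans (h.trans i4)) DKArrow.e2
    simp [doubleKronecker.flow] at this

theorem not_isMaximalClique_straight :
    ¬ doubleKronecker.IsMaximalClique {p | doubleKronecker.StraightRoute p} := by
  intro hm
  have := hm.le_of_ge (isClique_straight_union (isClique_singleton (p := lRoute (0 : ℕ) (1 : ℕ))
    (selfCompatible_lRoute (lIndex_of_coprime (by decide))))) Set.subset_union_left (Or.inr rfl)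
  exact not_straightRoute_lRoute _ _ this

/-- If `K` has a bending route and is not maximal, stability for some larger clique supplies a
`K`-compatible band. Every bending route of `K` is then one of the two of that slope, and they
cannot both occur. -/
theorem isBandStable_cases {K : Set doubleKronecker.Route}
    (hK : doubleKronecker.IsBandStable K) (hm : ¬ doubleKronecker.IsMaximalClique K) :
    (∃ b c : ℕ, Nat.Coprime b c ∧ K = {p | doubleKronecker.StraightRoute p} ∪ {lRoute b c}) ∨
      (∃ b c : ℕ, Nat.Coprime b c ∧ K = {p | doubleKronecker.StraightRoute p} ∪ {rRoute b c}) ∨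
      K = {p | doubleKronecker.StraightRoute p} := by
  have hS := straight_subset_of_isBandStable hK
  by_cases hKS : K ⊆ {p | doubleKronecker.StraightRoute p}
  · exact Or.inr (Or.inr (hKS.antisymm hS))
  obtain ⟨x, hx, hxs⟩ := Set.not_subset.1 hKS
  obtain ⟨K', hK', hss⟩ : ∃ K', doubleKronecker.IsClique K' ∧ K ⊂ K' := by
    by_contra! hn
    refine hm ⟨hK.1, fun K' hK' hle => ?_⟩
    by_contra hgt
    exact hn K' hK' ⟨hle, hgt⟩
  obtain ⟨X, hX, -⟩ := hK.2 K' hK' hss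
  obtain ⟨b, c, h, rfl, hp⟩ := eq_of_compatible_band (hK.1 x hx x hx) hxs (hX x hx)
  have key : ∀ y ∈ K, ¬ doubleKronecker.StraightRoute y → y = x := by
    intro y hy hys
    have hc := hK.1 x hx y hy
    have hc' := hK.1 y hy x hx
    have hlr := not_compatible_lRoute_rRoute h
    rcases eq_of_compatible_bnd_route h (hK.1 y hy y hy) hys (hX y hy) with rfl | rfl <;>
      rcases hp with rfl | rfl <;> first | rfl | contradiction
  have hK2 : K = {p | doubleKronecker.StraightRoute p} ∪ {x} := by
    refine Set.Subset.antisymm (fun y hy => ?_) (Set.union_subset hS (Set.singleton_subset_iff.2 hx))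
    by_cases hys : doubleKronecker.StraightRoute y
    · exact Or.inl hys
    · exact Or.inr (key y hy hys)
  rcases hp with rfl | rfl
  · exact Or.inl ⟨b, c, h, hK2⟩
  · exact Or.inr (Or.inl ⟨b, c, h, hK2⟩)

theorem bandStable_eq :
    {K : Set doubleKronecker.Route |
        doubleKronecker.IsBandStable K ∧ ¬ doubleKronecker.IsMaximalClique K} =
      {K | ∃ b c : ℕ, Nat.Coprime b c ∧
          K = {p | doubleKronecker.StraightRoute p} ∪ {lRoute b c}} ∪
        {K | ∃ b c : ℕ, Nat.Coprime b c ∧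
          K = {p | doubleKronecker.StraightRoute p} ∪ {rRoute b c}} ∪
        {{p | doubleKronecker.StraightRoute p}} := by
  ext K
  simp only [Set.mem_ofPred_eq, Set.mem_union, Set.mem_singleton_iff, or_assoc]
  constructor
  · rintro ⟨hK, hm⟩
    exact isBandStable_cases hK hm
  · rintro (⟨b, c, h, rfl⟩ | ⟨b, c, h, rfl⟩ | rfl)
    · exact ⟨isBandStable_l h, not_isMaximalClique_l h⟩
    · exact ⟨isBandStable_r h, not_isMaximalClique_r h⟩
    · exact ⟨isBandStable_straight, not_isMaximalClique_straight⟩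

theorem bendingPart_straight_union {p : doubleKronecker.Route}
    (hp : ¬ doubleKronecker.StraightRoute p) :
    doubleKronecker.bendingPart ({p | doubleKronecker.StraightRoute p} ∪ {p}) = {p} := by
  ext q
  simp only [bendingPart, Set.mem_union, Set.mem_ofPred_eq, Set.mem_singleton_iff]
  constructor
  · rintro ⟨h1 | h1, h2⟩
    · exact (h2 h1).elim
    · exact h1
  · rintro rfl
    exact ⟨Or.inr rfl, hp⟩

theorem bendingPart_straight :
    doubleKronecker.bendingPart {p | doubleKronecker.StraightRoute p} = ∅ := by
  ext q
  simp [bendingPart]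

theorem bendingPart_bandStable_eq :
    {K : Set doubleKronecker.Route | ∃ K' : Set doubleKronecker.Route,
        doubleKronecker.IsBandStable K' ∧ ¬ doubleKronecker.IsMaximalClique K' ∧
          K = doubleKronecker.bendingPart K'} =
      {K | ∃ b c : ℕ, Nat.Coprime b c ∧ K = {lRoute b c}} ∪
        {K | ∃ b c : ℕ, Nat.Coprime b c ∧ K = {rRoute b c}} ∪ {∅} := by
  ext K
  simp only [Set.mem_ofPred_eq, Set.mem_union, Set.mem_singleton_iff, or_assoc]
  constructor
  · rintro ⟨K', hK', hm, rfl⟩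
    rcases isBandStable_cases hK' hm with ⟨b, c, h, rfl⟩ | ⟨b, c, h, rfl⟩ | rfl
    · exact Or.inl ⟨b, c, h, bendingPart_straight_union (not_straightRoute_lRoute b c)⟩
    · exact Or.inr (Or.inl ⟨b, c, h, bendingPart_straight_union (not_straightRoute_rRoute b c)⟩)
    · exact Or.inr (Or.inr bendingPart_straight)
  · rintro (⟨b, c, h, rfl⟩ | ⟨b, c, h, rfl⟩ | rfl)
    · exact ⟨_, isBandStable_l h, not_isMaximalClique_l h,
        (bendingPart_straight_union (not_straightRoute_lRoute b c)).symm⟩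
    · exact ⟨_, isBandStable_r h, not_isMaximalClique_r h,
        (bendingPart_straight_union (not_straightRoute_rRoute b c)).symm⟩
    · exact ⟨_, isBandStable_straight, not_isMaximalClique_straight, bendingPart_straight.symm⟩

/-! Generalities on cliques and g-cones. -/

theorem exists_isMaximalClique {K : Set doubleKronecker.Route} (hK : doubleKronecker.IsClique K) :
    ∃ M, K ⊆ M ∧ doubleKronecker.IsMaximalClique M := by
  refine zorn_subset_nonempty {K | doubleKronecker.IsClique K}
    (fun c hc hch hne => ⟨⋃₀ c, ?_, fun s hs => Set.subset_sUnion_of_mem hs⟩) K hK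
  rintro p ⟨s, hs, hp⟩ q ⟨t, ht, hq⟩
  rcases hch.total hs ht with h | h
  · exact hc ht p (h hp) q hq
  · exact hc hs p hp q (h hq)

theorem gCone_mono {K M : Set doubleKronecker.Route} (h : K ⊆ M) :
    doubleKronecker.gCone K ⊆ doubleKronecker.gCone M := by
  rintro z ⟨s, a, h1, h2, h3⟩
  exact ⟨s, a, fun p hp => ⟨h (h1 p hp).1, (h1 p hp).2⟩, h2, h3⟩

theorem zero_mem_gCone (K : Set doubleKronecker.Route) : 0 ∈ doubleKronecker.gCone K :=
  ⟨∅, 0, by simp, by simp, by simp⟩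

theorem add_mem_gCone {K : Set doubleKronecker.Route} {y z : Fin 3 → ℝ}
    (hy : y ∈ doubleKronecker.gCone K) (hz : z ∈ doubleKronecker.gCone K) :
    y + z ∈ doubleKronecker.gCone K := by
  classical
  obtain ⟨s, a, h1, h2, rfl⟩ := hy
  obtain ⟨t, b, h3, h4, rfl⟩ := hz
  refine ⟨s ∪ t, fun p => (if p ∈ s then a p else 0) + (if p ∈ t then b p else 0), ?_, ?_, ?_⟩
  · intro p hp
    rcases Finset.mem_union.1 hp with hp | hp
    · exact h1 p hp
    · exact h3 p hp
  · intro p hp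
    have k1 : 0 ≤ if p ∈ s then a p else 0 := by
      split_ifs with h
      · exact h2 p h
      · exact le_rfl
    have k2 : 0 ≤ if p ∈ t then b p else 0 := by
      split_ifs with h
      · exact h4 p h
      · exact le_rfl
    exact add_nonneg k1 k2
  · simp only [add_smul, ite_smul, zero_smul, Finset.sum_add_distrib, Finset.sum_ite_mem,
      Finset.union_inter_cancel_left, Finset.union_inter_cancel_right]

/-- The g-vector of a route, as a real vector. -/
def gReal (p : doubleKronecker.Route) (v : Fin 3) : ℝ := Route.g doubleKronecker p v

theorem smul_gReal_mem_gCone {K : Set doubleKronecker.Route} {p : doubleKronecker.Route}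
    (hp : p ∈ K) (hs : ¬ doubleKronecker.StraightRoute p) {a : ℝ} (ha : 0 ≤ a) :
    a • gReal p ∈ doubleKronecker.gCone K :=
  ⟨{p}, fun _ => a, by simpa using ⟨hp, hs⟩, by simpa using ha, by simp; rfl⟩

theorem mem_gFan_of_clique {K : Set doubleKronecker.Route} (hK : doubleKronecker.IsClique K)
    {z : Fin 3 → ℝ} (hz : z ∈ doubleKronecker.gCone K) : z ∈ ⋃₀ doubleKronecker.gFan := by
  obtain ⟨M, hKM, hM⟩ := exists_isMaximalClique hK
  exact ⟨_, ⟨M, hM, rfl⟩, gCone_mono hKM hz⟩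

theorem mem_gFan_of_three {p q r : doubleKronecker.Route}
    (hp : doubleKronecker.SelfCompatibleRoute p) (hq : doubleKronecker.SelfCompatibleRoute q)
    (hr : doubleKronecker.SelfCompatibleRoute r)
    (hp' : ¬ doubleKronecker.StraightRoute p) (hq' : ¬ doubleKronecker.StraightRoute q)
    (hr' : ¬ doubleKronecker.StraightRoute r)
    (hpq : doubleKronecker.Compatible (.route p) (.route q))
    (hpr : doubleKronecker.Compatible (.route p) (.route r))
    (hqr : doubleKronecker.Compatible (.route q) (.route r)) {a b c : ℝ} (ha : 0 ≤ a)
    (hb : 0 ≤ b) (hc : 0 ≤ c) :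
    a • gReal p + b • gReal q + c • gReal r ∈ ⋃₀ doubleKronecker.gFan := by
  have hK : doubleKronecker.IsClique {p, q, r} := by
    rintro _ (rfl | rfl | rfl) _ (rfl | rfl | rfl)
    · exact hp
    · exact hpq
    · exact hpr
    · exact compatible_symm hpq
    · exact hq
    · exact hqr
    · exact compatible_symm hpr
    · exact compatible_symm hqr
    · exact hr
  exact mem_gFan_of_clique hK (add_mem_gCone (add_mem_gCone
    (smul_gReal_mem_gCone (by simp) hp' ha) (smul_gReal_mem_gCone (by simp) hq' hb))
    (smul_gReal_mem_gCone (by simp) hr' hc))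

/-! Coordinates. -/

/-- The vector with the given coordinates: a route with index `(b, c)` at the left fringe has
coordinates `b`, `c`, `1`. -/
def pt (β γ A : ℝ) : Fin 3 → ℝ := ![β - A, γ - β + A, -A - γ]

theorem exists_pt (z : Fin 3 → ℝ) : ∃ β γ A, z = pt β γ A := by
  refine ⟨-z 1 - z 2, z 0 + z 1, -(z 0 + z 1 + z 2), ?_⟩
  funext v
  fin_cases v <;> simp [pt] <;> ring

theorem pt_injective {β γ A β' γ' A' : ℝ} (h : pt β γ A = pt β' γ' A') :
    β = β' ∧ γ = γ' ∧ A = A' := by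
  have h0 := congrFun h 0
  have h1 := congrFun h 1
  have h2 := congrFun h 2
  simp only [pt, Matrix.cons_val] at h0 h1 h2
  refine ⟨?_, ?_, ?_⟩ <;> linarith

theorem pt_add (β γ A β' γ' A' : ℝ) : pt β γ A + pt β' γ' A' = pt (β + β') (γ + γ') (A + A') := by
  funext v
  fin_cases v <;> simp [pt] <;> ring

theorem smul_pt (a β γ A : ℝ) : a • pt β γ A = pt (a * β) (a * γ) (a * A) := by
  funext v
  fin_cases v <;> simp [pt] <;> ring

theorem sum_pt {ι : Type} (s : Finset ι) (f g h : ι → ℝ) :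
    ∑ i ∈ s, pt (f i) (g i) (h i) = pt (∑ i ∈ s, f i) (∑ i ∈ s, g i) (∑ i ∈ s, h i) := by
  classical
  induction s using Finset.induction_on with
  | empty =>
    funext v
    fin_cases v <;> simp [pt]
  | insert i s hi ih => rw [Finset.sum_insert hi, ih, pt_add, Finset.sum_insert hi,
      Finset.sum_insert hi, Finset.sum_insert hi]

theorem gReal_leftRoute {b c : ℤ} (h : LeftIndex b c) : gReal (leftRoute b c) = pt b c 1 := by
  funext v
  rw [gReal, g_leftRoute h]
  fin_cases v <;> simp [pt] <;> ring

theorem gReal_mirrorRoute (p : doubleKronecker.Route) (v : Fin 3) :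
    gReal (mirrorRoute p) v = -gReal p v.rev := by
  rw [gReal, g_mirrorRoute, gReal, Int.cast_neg]

theorem pt_rev (β γ A : ℝ) (v : Fin 3) : -pt β γ A v.rev = pt γ β (-A) v := by
  fin_cases v <;> simp [pt]
  ring

theorem gReal_mirrorRoute_leftRoute {b c : ℤ} (h : LeftIndex b c) :
    gReal (mirrorRoute (leftRoute b c)) = pt c b (-1) := by
  funext v
  rw [gReal_mirrorRoute, gReal_leftRoute h, pt_rev]

/-- The mirror symmetry on vectors. -/
def mirrorVec (z : Fin 3 → ℝ) (v : Fin 3) : ℝ := -z v.rev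

theorem mirrorVec_pt (β γ A : ℝ) : mirrorVec (pt β γ A) = pt γ β (-A) := by
  funext v
  exact pt_rev _ _ _ v

theorem isClique_mirror {K : Set doubleKronecker.Route} (h : doubleKronecker.IsClique K) :
    doubleKronecker.IsClique (mirrorRoute '' K) := by
  rintro _ ⟨p, hp, rfl⟩ _ ⟨q, hq, rfl⟩
  exact compatible_mirrorTrail (h p hp q hq)

theorem mirrorRoute_injective : Function.Injective mirrorRoute :=
  Function.LeftInverse.injective mirrorRoute_mirrorRoute

theorem mirrorVec_mem_gCone {K : Set doubleKronecker.Route} {z : Fin 3 → ℝ}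
    (h : z ∈ doubleKronecker.gCone K) : mirrorVec z ∈ doubleKronecker.gCone (mirrorRoute '' K) := by
  classical
  obtain ⟨s, a, h1, h2, rfl⟩ := h
  refine ⟨s.image mirrorRoute, fun p => a (mirrorRoute p), ?_, ?_, ?_⟩
  · intro p hp
    obtain ⟨q, hq, rfl⟩ := Finset.mem_image.1 hp
    exact ⟨⟨q, (h1 q hq).1, rfl⟩, straightRoute_mirrorRoute_iff.not.2 (h1 q hq).2⟩
  · intro p hp
    obtain ⟨q, hq, rfl⟩ := Finset.mem_image.1 hp
    show 0 ≤ a (mirrorRoute (mirrorRoute q))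
    rw [mirrorRoute_mirrorRoute]
    exact h2 q hq
  · rw [Finset.sum_image fun p _ q _ h => mirrorRoute_injective h]
    funext v
    simp only [mirrorVec, Finset.sum_apply, Pi.smul_apply, smul_eq_mul, mirrorRoute_mirrorRoute,
      g_mirrorRoute, ← Finset.sum_neg_distrib]
    refine Finset.sum_congr rfl fun p _ => ?_
    push_cast
    ring

theorem mirrorVec_mem_gFan {z : Fin 3 → ℝ} (h : z ∈ ⋃₀ doubleKronecker.gFan) :
    mirrorVec z ∈ ⋃₀ doubleKronecker.gFan := by
  obtain ⟨_, ⟨K, hK, rfl⟩, hz⟩ := h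
  exact mem_gFan_of_clique (isClique_mirror hK.prop) (mirrorVec_mem_gCone hz)

/-! The cones of the fan. -/

theorem pt_mem_gFan_left {b c b' c' b'' c'' : ℤ} (h : LeftIndex b c) (h' : LeftIndex b' c')
    (h'' : LeftIndex b'' c'') (d : |b * c' - c * b'| ≤ 1) (d' : |b * c'' - c * b''| ≤ 1)
    (d'' : |b' * c'' - c' * b''| ≤ 1) {x y z : ℝ} (hx : 0 ≤ x) (hy : 0 ≤ y) (hz : 0 ≤ z) :
    pt (x * b + y * b' + z * b'') (x * c + y * c' + z * c'') (x + y + z) ∈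
      ⋃₀ doubleKronecker.gFan := by
  have := mem_gFan_of_three (selfCompatible_leftRoute h) (selfCompatible_leftRoute h')
    (selfCompatible_leftRoute h'') (not_straightRoute_leftRoute _ _)
    (not_straightRoute_leftRoute _ _) (not_straightRoute_leftRoute _ _)
    ((compatible_leftRoute_iff h h').2 d) ((compatible_leftRoute_iff h h'').2 d')
    ((compatible_leftRoute_iff h' h'').2 d'') hx hy hz
  rw [gReal_leftRoute h, gReal_leftRoute h', gReal_leftRoute h'', smul_pt, smul_pt, smul_pt,
    pt_add, pt_add] at this
  simpa using this

theorem leftIndex_zero : LeftIndex 0 (-1) := Or.inl ⟨rfl, rfl⟩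

theorem leftIndex_neg_one {b : ℤ} (hb : 0 ≤ b) : LeftIndex b (-1) := by
  rcases eq_or_lt_of_le hb with rfl | hb
  · exact leftIndex_zero
  · exact Or.inr ⟨hb, le_rfl, isCoprime_one_right.neg_right⟩

theorem leftIndex_one {c : ℤ} (hc : -1 ≤ c) : LeftIndex 1 c :=
  Or.inr ⟨le_rfl, hc, isCoprime_one_left⟩

/-- The clique consists of the left routes of indices `(b, -1)` and `(b + 1, -1)` and the right cap,
whose coordinates are `(-1, 0, -1)`. -/
theorem pt_mem_gFan_mixed {b : ℤ} (hb : 0 ≤ b) {x y z : ℝ} (hx : 0 ≤ x) (hy : 0 ≤ y)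
    (hz : 0 ≤ z) : pt (x * b + y * (b + 1) - z) (-x - y) (x + y - z) ∈
      ⋃₀ doubleKronecker.gFan := by
  have h := leftIndex_neg_one hb
  have h' : LeftIndex (b + 1) (-1) := leftIndex_neg_one (by omega)
  have hm := leftIndex_zero
  have := mem_gFan_of_three (selfCompatible_leftRoute h) (selfCompatible_leftRoute h')
    (selfCompatible_mirrorRoute (selfCompatible_leftRoute hm)) (not_straightRoute_leftRoute _ _)
    (not_straightRoute_leftRoute _ _)
    (straightRoute_mirrorRoute_iff.not.2 (not_straightRoute_leftRoute _ _))
    ((compatible_leftRoute_iff h h').2 (by ring_nf; simp))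
    ((compatible_leftRoute_mirrorRoute_iff h hm).2 (by simp))
    ((compatible_leftRoute_mirrorRoute_iff h' hm).2 (by simp)) hx hy hz
  rw [gReal_leftRoute h, gReal_leftRoute h', gReal_mirrorRoute_leftRoute hm, smul_pt, smul_pt,
    smul_pt, pt_add, pt_add] at this
  push_cast at this
  convert this using 1
  congr 1 <;> ring

/-- Division with remainder; it picks the two consecutive routes of a fan of cones between which a
vector lies. The last clause yields lower bounds on `k`. -/
theorem exists_int_combination {u v : ℝ} (hv : 0 < v) : ∃ (k : ℤ) (y : ℝ), 0 ≤ y ∧ y < v ∧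
    u = k * v + y ∧ (k : ℝ) * v ≤ u ∧ ∀ j : ℤ, j * v ≤ u → j ≤ k := by
  refine ⟨⌊u / v⌋, u - ⌊u / v⌋ * v, ?_, ?_, by ring, ?_, fun j hj => ?_⟩
  · have := (le_div_iff₀ hv).1 (Int.floor_le (u / v))
    linarith
  · have := (div_lt_iff₀ hv).1 (Int.lt_floor_add_one (u / v))
    linarith
  · exact (le_div_iff₀ hv).1 (Int.floor_le (u / v))
  · exact Int.le_floor.2 ((le_div_iff₀ hv).2 hj)

theorem pt_mem_gFan_of_neg {β γ A : ℝ} (hγ : γ < 0) (h1 : A + γ ≤ 0) (h2 : 0 ≤ β - γ - A) :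
    pt β γ A ∈ ⋃₀ doubleKronecker.gFan := by
  obtain ⟨k, y, hy0, hy1, e, -, hk⟩ := exists_int_combination (u := β - γ - A) (v := -γ)
    (by linarith)
  have := pt_mem_gFan_mixed (b := k) (hk 0 (by simpa using h2)) (x := -γ - y) (y := y)
    (z := -γ - A) (by linarith) hy0 (by linarith)
  convert this using 1
  congr 1 <;> linarith

/-- The part of the complement of the fan related to the left fringe. -/
def LeftGap (β γ A : ℝ) : Prop :=
  0 ≤ A ∧ ((β = 0 ∧ 0 < γ + A) ∨
    ∃ b c : ℕ, Nat.Coprime b c ∧ 1 ≤ b ∧ ∃ t : ℝ, A < t ∧ β = t * b ∧ γ = t * c)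

/-- The cap takes the weight `A - β`, and the rest lies between the routes `(1, k)` and `(1, k +
1)`. -/
theorem pt_mem_gFan_of_le {β γ A : ℝ} (hβ : 0 < β) (h1 : β ≤ A) (h2 : 0 < γ + A) :
    pt β γ A ∈ ⋃₀ doubleKronecker.gFan := by
  obtain ⟨k, y, hy0, hy1, e, -, hk⟩ := exists_int_combination (u := γ + A - β) (v := β) hβ
  have hk1 : -1 ≤ k := hk (-1) (by push_cast; linarith)
  have := pt_mem_gFan_left leftIndex_zero (leftIndex_one hk1) (leftIndex_one (c := k + 1)
    (by omega)) (by simp) (by simp) (by ring_nf; simp) (x := A - β) (y := β - y) (z := y)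
    (by linarith) (by linarith) hy0
  convert this using 1
  congr 1 <;> push_cast <;> linarith

/-- The route `(1, 0)` takes the weight `A + γ`, and the rest lies between the routes `(k, -1)` and
`(k + 1, -1)`. -/
theorem pt_mem_gFan_of_neg_of_lt {β γ A : ℝ} (hγ : γ < 0) (h1 : A < β) (h2 : 0 ≤ A + γ) :
    pt β γ A ∈ ⋃₀ doubleKronecker.gFan := by
  obtain ⟨k, y, hy0, hy1, e, -, hk⟩ := exists_int_combination (u := β - A - γ) (v := -γ)
    (by linarith)
  have hk1 : 1 ≤ k := hk 1 (by push_cast; linarith)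
  have := pt_mem_gFan_left (leftIndex_one (c := 0) (by omega)) (leftIndex_neg_one (b := k)
    (by omega)) (leftIndex_neg_one (b := k + 1) (by omega)) (by simp) (by simp) (by ring_nf; simp)
    (x := A + γ) (y := -γ - y) (z := y) h2 (by linarith) hy0
  convert this using 1
  congr 1 <;> push_cast <;> linarith

theorem leftGap_or_of_ray {b c : ℤ} (hb : 1 ≤ b) (hc : 0 ≤ c) (h : IsCoprime b c) {t A : ℝ}
    (hA : 0 ≤ A) (ht : A ≤ t) :
    pt (t * b) (t * c) A ∈ ⋃₀ doubleKronecker.gFan ∨ LeftGap (t * b) (t * c) A := by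
  rcases eq_or_lt_of_le ht with rfl | ht
  · left
    have hL : LeftIndex b c := Or.inr ⟨hb, by omega, h⟩
    have := pt_mem_gFan_left hL hL hL (by ring_nf; simp) (by ring_nf; simp) (by ring_nf; simp)
      (x := A) (y := 0) (z := 0) hA le_rfl le_rfl
    simpa using this
  · right
    lift b to ℕ using (by omega)
    lift c to ℕ using hc
    exact ⟨hA, Or.inr ⟨b, c, Nat.isCoprime_iff_coprime.1 h, by omega, t, ht, by simp⟩⟩

/-- The two basis vectors and their sum have pairwise determinants `±1`, so they index a clique.
Total weight `A` forces the weights `A - y`, `A - x` and `x + y - A`. -/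
theorem pt_mem_gFan_of_basis {b c b' c' : ℤ} (hb : 1 ≤ b) (hc : 0 ≤ c) (hb' : 1 ≤ b')
    (hc' : 0 ≤ c') (hd : b * c' - c * b' = 1 ∨ b * c' - c * b' = -1) {x y A : ℝ} (hx : x ≤ A)
    (hy : y ≤ A) (hA : A ≤ x + y) :
    pt (x * b + y * b') (x * c + y * c') A ∈ ⋃₀ doubleKronecker.gFan := by
  have co : ∀ {b c : ℤ} (u v : ℤ), b * u - c * v = 1 → IsCoprime b c := fun u v h =>
    ⟨u, -v, by linarith⟩
  have h1 : LeftIndex b c := Or.inr ⟨hb, by omega, by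
    rcases hd with hd | hd
    · exact co c' b' hd
    · exact co (-c') (-b') (by linarith)⟩
  have h2 : LeftIndex b' c' := Or.inr ⟨hb', by omega, by
    rcases hd with hd | hd
    · exact co (-c) (-b) (by linarith)
    · exact co c b (by linarith)⟩
  have h3 : LeftIndex (b + b') (c + c') := Or.inr ⟨by omega, by omega, by
    rcases hd with hd | hd
    · exact co c' b' (by linarith)
    · exact co (-c') (-b') (by linarith)⟩
  have e1 : b * (c + c') - c * (b + b') = b * c' - c * b' := by ring
  have e2 : b' * (c + c') - c' * (b + b') = -(b * c' - c * b') := by ring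
  have hd' : |b * c' - c * b'| ≤ 1 := by rcases hd with h | h <;> rw [h] <;> simp
  have := pt_mem_gFan_left h1 h2 h3 hd' (by rwa [e1]) (by rwa [e2, abs_neg]) (x := A - y)
    (y := A - x) (z := x + y - A) (by linarith) (by linarith) (by linarith)
  convert this using 1
  congr 1 <;> push_cast <;> ring

/-- For `y > 0`, adding `(k + 1)` times the first basis vector to the second lowers the coefficient
`x` to `x - (k + 1) * y`, which lies in `[A - y, A)`, and the previous lemma applies. For `y = 0`
the vector is on a ray of the gap. -/
theorem pt_mem_gFan_of_jump {b c b' c' : ℤ} (hb : 1 ≤ b) (hc : 0 ≤ c) (hb' : 1 ≤ b')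
    (hc' : 0 ≤ c') (hd : b * c' - c * b' = 1 ∨ b * c' - c * b' = -1) {x y A : ℝ} (hx : A < x)
    (hy0 : 0 ≤ y) (hy : y ≤ A) (hA : 0 < A) :
    pt (x * b + y * b') (x * c + y * c') A ∈ ⋃₀ doubleKronecker.gFan ∨
      LeftGap (x * b + y * b') (x * c + y * c') A := by
  rcases eq_or_lt_of_le hy0 with rfl | hy0
  · have h := leftGap_or_of_ray hb hc (t := x) (A := A) (by
      rcases hd with hd | hd
      · exact ⟨c', -b', by linarith⟩
      · exact ⟨-c', b', by linarith⟩) hA.le hx.le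
    simpa using h
  · left
    obtain ⟨k, ρ, h0, h1, e, -, hk⟩ := exists_int_combination (u := x - A) hy0
    have hk0 : 0 ≤ k := hk 0 (by push_cast; linarith)
    have hkb : 0 ≤ k * b := mul_nonneg hk0 (by omega)
    have hkc : 0 ≤ k * c := mul_nonneg hk0 hc
    have := pt_mem_gFan_of_basis (b' := b' + (k + 1) * b) (c' := c' + (k + 1) * c) hb hc
      (by linarith) (by linarith) (by
        rw [show b * (c' + (k + 1) * c) - c * (b' + (k + 1) * b) = b * c' - c * b' by ring]
        exact hd) (x := x - (k + 1) * y) (y := y) (A := A) (by linarith) hy (by linarith)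
    convert this using 1
    congr 1 <;> push_cast <;> ring

/-- Euclid's algorithm on the coefficients: while both exceed `A`, the smaller is subtracted from
the larger and the basis adjusted. Each step lowers `x + y` by more than `A`, which the bound `n *
A` counts. -/
theorem mem_gFan_or_leftGap_of_basis (n : ℕ) : ∀ {b c b' c' : ℤ} (_ : 1 ≤ b) (_ : 0 ≤ c)
    (_ : 1 ≤ b') (_ : 0 ≤ c') (_ : b * c' - c * b' = 1 ∨ b * c' - c * b' = -1) {x y A : ℝ}
    (_ : 0 ≤ x) (_ : 0 ≤ y) (_ : 0 < A) (_ : A ≤ x + y) (_ : x + y ≤ n * A),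
    pt (x * b + y * b') (x * c + y * c') A ∈ ⋃₀ doubleKronecker.gFan ∨
      LeftGap (x * b + y * b') (x * c + y * c') A := by
  induction n with
  | zero =>
    intro b c b' c' _ _ _ _ _ x y A _ _ hA h1 h2
    norm_num at h2
    linarith
  | succ n ih =>
    intro b c b' c' hb hc hb' hc' hd x y A hx hy hA h1 h2
    push_cast at h2
    have hd2 : b' * c - c' * b = 1 ∨ b' * c - c' * b = -1 := by
      rcases hd with hd | hd
      · right; linarith
      · left; linarith
    rcases le_or_gt x A with hxA | hxA <;> rcases le_or_gt y A with hyA | hyA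
    · exact Or.inl (pt_mem_gFan_of_basis hb hc hb' hc' hd hxA hyA h1)
    · have := pt_mem_gFan_of_jump hb' hc' hb hc hd2 hyA hx hxA hA
      rwa [add_comm (y * _), add_comm (y * _)] at this
    · exact pt_mem_gFan_of_jump hb hc hb' hc' hd hxA hy hyA hA
    · rcases le_total x y with hxy | hxy
      · have := ih (b := b + b') (c := c + c') (b' := b') (c' := c') (by omega) (by omega) hb' hc'
          (by rwa [show (b + b') * c' - (c + c') * b' = b * c' - c * b' by ring]) (x := x)
          (y := y - x) (A := A) hx (by linarith) hA (by linarith) (by linarith)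
        push_cast at this
        rwa [show x * ((b : ℝ) + b') + (y - x) * b' = x * b + y * b' by ring,
          show x * ((c : ℝ) + c') + (y - x) * c' = x * c + y * c' by ring] at this
      · have := ih (b := b) (c := c) (b' := b + b') (c' := c + c') hb hc (by omega) (by omega)
          (by rwa [show b * (c + c') - c * (b + b') = b * c' - c * b' by ring]) (x := x - y)
          (y := y) (A := A) (by linarith) hy hA (by linarith) (by linarith)
        push_cast at this
        rwa [show (x - y) * (b : ℝ) + y * (b + b') = x * b + y * b' by ring,
          show (x - y) * (c : ℝ) + y * (c + c') = x * c + y * c' by ring] at this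

theorem mem_gFan_or_leftGap {β γ A : ℝ} (hA : 0 < A) (h1 : A ≤ β) (h2 : 0 ≤ γ) :
    pt β γ A ∈ ⋃₀ doubleKronecker.gFan ∨ LeftGap β γ A := by
  obtain ⟨k, y, hy0, hy1, e, -, hk⟩ := exists_int_combination (u := γ) (v := β) (by linarith)
  have hk0 : 0 ≤ k := hk 0 (by simpa using h2)
  obtain ⟨n, hn⟩ := exists_nat_ge (β / A)
  rw [div_le_iff₀ hA] at hn
  have := mem_gFan_or_leftGap_of_basis n (b := 1) (c := k) (b' := 1) (c' := k + 1) le_rfl hk0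
    le_rfl (by omega) (by left; ring) (x := β - y) (y := y) (A := A) (by linarith) hy0 hA
    (by linarith) (by linarith)
  push_cast at this
  rwa [show (β - y) * 1 + y * 1 = β by ring, show (β - y) * (k : ℝ) + y * (k + 1) = γ by
    rw [e]; ring] at this

/-- The complement of the fan in coordinates. -/
def Gap (β γ A : ℝ) : Prop :=
  LeftGap β γ A ∨ LeftGap γ β (-A) ∨ (A = 0 ∧ 0 ≤ β ∧ 0 ≤ γ ∧ (β, γ) ≠ (0, 0))

theorem Gap.mirror {β γ A : ℝ} (h : Gap β γ A) : Gap γ β (-A) := by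
  rcases h with h | h | ⟨rfl, h1, h2, h3⟩
  · right; left
    rwa [neg_neg]
  · exact Or.inl h
  · refine Or.inr (Or.inr ⟨neg_zero, h2, h1, fun h => h3 ?_⟩)
    rw [Prod.mk.injEq] at h ⊢
    exact h.symm

theorem mem_gFan_or_gap_of_nonneg {β γ A : ℝ} (hA : 0 ≤ A) :
    pt β γ A ∈ ⋃₀ doubleKronecker.gFan ∨ Gap β γ A := by
  -- Both subcases reduce to `pt_mem_gFan_of_neg`, one of them after the mirror symmetry; the sign
  -- of `γ + A - β` decides which.
  by_cases hβ : β < 0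
  · left
    by_cases h : 0 ≤ γ + A - β
    · have := mirrorVec_mem_gFan (pt_mem_gFan_of_neg (β := γ) (γ := β) (A := -A) hβ (by linarith)
        (by linarith))
      rwa [mirrorVec_pt, neg_neg] at this
    · exact pt_mem_gFan_of_neg (by linarith) (by linarith) (by linarith)
  push Not at hβ
  by_cases h1 : γ < 0 ∧ A + γ ≤ 0
  · left
    exact pt_mem_gFan_of_neg h1.1 h1.2 (by linarith)
  rcases eq_or_lt_of_le hA with rfl | hA
  · have hγ : 0 ≤ γ := by
      by_contra hn
      exact h1 ⟨by linarith, by linarith⟩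
    by_cases h0 : (β, γ) = (0, 0)
    · left
      obtain ⟨rfl, rfl⟩ := Prod.mk.inj h0
      have h := mem_gFan_of_clique isClique_straight (zero_mem_gCone _)
      have e : pt 0 0 0 = 0 := by
        funext v
        fin_cases v <;> simp [pt]
      rwa [e]
    · exact Or.inr (Or.inr (Or.inr ⟨rfl, hβ, hγ, h0⟩))
  have h2 : 0 < γ + A := by
    by_contra hn
    exact h1 ⟨by linarith, by linarith⟩
  rcases eq_or_lt_of_le hβ with rfl | hβ
  · exact Or.inr (Or.inl ⟨hA.le, Or.inl ⟨rfl, h2⟩⟩)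
  rcases le_or_gt β A with h3 | h3
  · exact Or.inl (pt_mem_gFan_of_le hβ h3 h2)
  rcases lt_or_ge γ 0 with h4 | h4
  · exact Or.inl (pt_mem_gFan_of_neg_of_lt h4 h3 (by linarith))
  · exact (mem_gFan_or_leftGap hA h3.le h4).imp id Or.inl

theorem mem_gFan_or_gap (β γ A : ℝ) : pt β γ A ∈ ⋃₀ doubleKronecker.gFan ∨ Gap β γ A := by
  rcases le_total 0 A with hA | hA
  · exact mem_gFan_or_gap_of_nonneg hA
  · rcases mem_gFan_or_gap_of_nonneg (β := γ) (γ := β) (neg_nonneg.2 hA) with h | h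
    · left
      have := mirrorVec_mem_gFan h
      rwa [mirrorVec_pt, neg_neg] at this
    · right
      have := h.mirror
      rwa [neg_neg] at this

/-! ### The cones of cliques avoid the gap. -/

/-- Positive `w i` bound `x` from above and negative ones from below; `h1` says that every lower
bound is at most every upper bound. -/
theorem exists_separator {ι : Type} (s : Finset ι) (u w : ι → ℝ)
    (h0 : ∀ i ∈ s, w i = 0 → 0 ≤ u i)
    (h1 : ∀ i ∈ s, ∀ j ∈ s, 0 < w i → w j < 0 → u i * w j ≤ u j * w i) :
    ∃ x : ℝ, ∀ i ∈ s, x * w i ≤ u i := by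
  classical
  by_cases hP : (s.filter fun i => 0 < w i).Nonempty
  · obtain ⟨i, hi, hmin⟩ := Finset.exists_min_image _ (fun i => u i / w i) hP
    rw [Finset.mem_filter] at hi
    refine ⟨u i / w i, fun j hj => ?_⟩
    rcases lt_trichotomy (w j) 0 with h | h | h
    · rw [div_mul_eq_mul_div, div_le_iff₀ hi.2]
      exact h1 i hi.1 j hj hi.2 h
    · rw [h, mul_zero]
      exact h0 j hj h
    · exact (le_div_iff₀ h).1 (hmin j (Finset.mem_filter.2 ⟨hj, h⟩))
  · have hP' : ∀ j ∈ s, w j ≤ 0 := by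
      intro j hj
      by_contra hn
      exact hP ⟨j, Finset.mem_filter.2 ⟨hj, not_le.1 hn⟩⟩
    refine ⟨∑ j ∈ s, |u j / w j|, fun j hj => ?_⟩
    rcases eq_or_lt_of_le (hP' j hj) with h | h
    · rw [h, mul_zero]
      exact h0 j hj h
    · rw [← div_le_iff_of_neg h]
      exact (le_abs_self _).trans
        (Finset.single_le_sum (f := fun j => |u j / w j|) (fun _ _ => abs_nonneg _) hj)

/-- There is a line through `(b₀, c₀)` with all points `(b i, c i)` on one side: with `w i = b₀ * c
i - c₀ * b i`, some `x` satisfies `b i + x * w i ≤ b₀` for all `i`. Summing with the weights `a i`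
kills the term in `w`, as the total is parallel to `(b₀, c₀)`, and leaves `t * b₀ ≤ b₀ * ∑ a i`. A
primitive point on the ray itself has `b i ∣ b₀`. For points on opposite sides of the ray the
condition of `exists_separator` reads `b j * c i - c j * b i ≤ w i - w j`, where the left side is at
most 1 and the right side at least 2. -/
theorem le_sum_of_ray {ι : Type} (s : Finset ι) {a : ι → ℝ} {b c : ι → ℤ} {b₀ c₀ : ℕ} {t : ℝ}
    (ha : ∀ i ∈ s, 0 < a i) (hL : ∀ i ∈ s, LeftIndex (b i) (c i))
    (hd : ∀ i ∈ s, ∀ j ∈ s, |b i * c j - c i * b j| ≤ 1) (hb₀ : 1 ≤ b₀)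
    (hb : ∑ i ∈ s, a i * b i = t * b₀) (hc : ∑ i ∈ s, a i * c i = t * c₀) :
    t ≤ ∑ i ∈ s, a i := by
  have hpos : (0 : ℝ) < b₀ := by exact_mod_cast hb₀
  obtain ⟨x, hx⟩ := exists_separator s (fun i => (b₀ - b i : ℝ)) (fun i => b₀ * c i - c₀ * b i)
    (fun i hi h => by
      have h' : (b₀ : ℤ) * c i = c₀ * b i := by
        have : (b₀ : ℝ) * c i = c₀ * b i := by linarith
        exact_mod_cast this
      rcases hL i hi with ⟨h1, -⟩ | ⟨h1, -, h2⟩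
      · rw [h1]
        simp
      · have hdvd : b i ∣ b₀ := h2.dvd_of_dvd_mul_right (Dvd.intro_left _ h'.symm)
        have : b i ≤ b₀ := Int.le_of_dvd (by omega) hdvd
        have : (b i : ℝ) ≤ b₀ := by exact_mod_cast this
        linarith)
    (fun i hi j hj h1 h2 => by
      have k1 : (0 : ℤ) < b₀ * c i - c₀ * b i := by exact_mod_cast h1
      have k2 : (b₀ : ℤ) * c j - c₀ * b j < 0 := by exact_mod_cast h2
      have k3 := (abs_le.1 (hd j hj i hi)).2
      have k4 : ((b j * c i - c j * b i : ℤ) : ℝ) ≤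
          ((b₀ * c i - c₀ * b i - (b₀ * c j - c₀ * b j) : ℤ) : ℝ) := by
        exact_mod_cast (by omega)
      push_cast at k4
      have := mul_le_mul_of_nonneg_left k4 hpos.le
      linarith)
  have h1 : ∑ i ∈ s, a i * (x * (b₀ * c i - c₀ * b i)) ≤ ∑ i ∈ s, a i * (b₀ - b i) :=
    Finset.sum_le_sum fun i hi => mul_le_mul_of_nonneg_left (hx i hi) (ha i hi).le
  have h2 : ∑ i ∈ s, a i * (x * (b₀ * c i - c₀ * b i)) =
      x * (b₀ * ∑ i ∈ s, a i * c i - c₀ * ∑ i ∈ s, a i * b i) := by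
    rw [Finset.mul_sum, Finset.mul_sum, ← Finset.sum_sub_distrib, Finset.mul_sum]
    exact Finset.sum_congr rfl fun i _ => by ring
  have h3 : ∑ i ∈ s, a i * ((b₀ : ℝ) - b i) = b₀ * ∑ i ∈ s, a i - ∑ i ∈ s, a i * b i := by
    rw [Finset.mul_sum, ← Finset.sum_sub_distrib]
    exact Finset.sum_congr rfl fun i _ => by ring
  rw [h2, h3, hb, hc] at h1
  have h4 : (b₀ : ℝ) * t ≤ b₀ * ∑ i ∈ s, a i := by linarith
  exact le_of_mul_le_mul_left h4 hpos

theorem exists_positive_combination {K : Set doubleKronecker.Route} {β γ A : ℝ}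
    (h : pt β γ A ∈ doubleKronecker.gCone K) :
    ∃ (s : Finset doubleKronecker.Route) (a : doubleKronecker.Route → ℝ),
      (∀ p ∈ s, p ∈ K ∧ ¬ doubleKronecker.StraightRoute p ∧ 0 < a p) ∧
      pt β γ A = ∑ p ∈ s, a p • gReal p := by
  classical
  obtain ⟨s, a, h1, h2, h3⟩ := h
  refine ⟨s.filter fun p => 0 < a p, a, fun p hp => ?_, ?_⟩
  · rw [Finset.mem_filter] at hp
    exact ⟨(h1 p hp.1).1, (h1 p hp.1).2, hp.2⟩
  · rw [h3, Finset.sum_filter_of_ne]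
    · rfl
    · intro p hp hne
      refine lt_of_le_of_ne (h2 p hp) fun h0 => hne ?_
      rw [← h0, zero_smul]

theorem eq_sum_of_combination {s : Finset doubleKronecker.Route} {a B C H : doubleKronecker.Route → ℝ}
    {β γ A : ℝ} (hs : ∀ p ∈ s, gReal p = pt (B p) (C p) (H p))
    (h : pt β γ A = ∑ p ∈ s, a p • gReal p) :
    β = ∑ p ∈ s, a p * B p ∧ γ = ∑ p ∈ s, a p * C p ∧ A = ∑ p ∈ s, a p * H p := by
  apply pt_injective
  rw [h, ← sum_pt]
  refine Finset.sum_congr rfl fun p hp => ?_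
  rw [hs p hp, smul_pt]

theorem not_gap_zero : ¬ Gap 0 0 0 := by
  have key : ¬ LeftGap 0 0 0 := by
    rintro ⟨-, ⟨-, h⟩ | ⟨b, c, -, hb, t, ht, h, -⟩⟩
    · simp at h
    · have : (0 : ℝ) < b := by exact_mod_cast hb
      have := mul_pos ht this
      linarith
  rintro (h | h | h)
  · exact key h
  · exact key (by simpa using h)
  · exact h.2.2.2 rfl

theorem not_gap_of_left {s : Finset doubleKronecker.Route} {a : doubleKronecker.Route → ℝ}
    {β γ A : ℝ} (hs : doubleKronecker.IsClique s) (ha : ∀ p ∈ s, 0 < a p)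
    (hL : ∀ p ∈ s, ∃ b c, LeftIndex b c ∧ p = leftRoute b c)
    (h : pt β γ A = ∑ p ∈ s, a p • gReal p) : ¬ Gap β γ A := by
  choose! b c hbc e using hL
  obtain ⟨hβ, hγ, hA⟩ := eq_sum_of_combination (a := a) (B := fun p => b p) (C := fun p => c p)
    (H := fun _ => 1) (fun p hp => by
      conv_lhs => rw [e p hp]
      exact gReal_leftRoute (hbc p hp)) h
  simp only [mul_one] at hA
  have hA0 : 0 ≤ A := by
    rw [hA]
    exact Finset.sum_nonneg fun p hp => (ha p hp).le
  -- Each left route contributes its positive weight to `A`, so `A = 0` leaves only the zero vector.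
  have hzero : A = 0 → ¬ Gap β γ A := by
    intro h0
    have hs0 : s = ∅ := by
      by_contra hne
      have := Finset.sum_pos ha (Finset.nonempty_iff_ne_empty.2 hne)
      linarith
    subst hs0
    simp only [Finset.sum_empty] at hβ hγ hA
    rw [hβ, hγ, hA]
    exact not_gap_zero
  intro hG
  rcases hG with ⟨-, ⟨h0, h1⟩ | ⟨b₀, c₀, -, hb₀, t, ht, h1, h2⟩⟩ | hG | hG
  · have hb0 : ∀ p ∈ s, (0 : ℝ) ≤ a p * b p := fun p hp => by
      have : 0 ≤ b p := by rcases hbc p hp with h | h <;> omega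
      have : (0 : ℝ) ≤ b p := by exact_mod_cast this
      exact mul_nonneg (ha p hp).le this
    rw [hβ, Finset.sum_eq_zero_iff_of_nonneg hb0] at h0
    have : γ = -A := by
      rw [hγ, hA, ← Finset.sum_neg_distrib]
      refine Finset.sum_congr rfl fun p hp => ?_
      have hb : (b p : ℝ) = 0 := (mul_eq_zero.1 (h0 p hp)).resolve_left (ha p hp).ne'
      have hb : b p = 0 := by exact_mod_cast hb
      have hc : c p = -1 := by rcases hbc p hp with h | h <;> omega
      rw [hc]
      push_cast
      ring
    linarith
  · have := le_sum_of_ray s ha hbc (fun p hp q hq => by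
      rw [← compatible_leftRoute_iff (hbc p hp) (hbc q hq), ← e p hp, ← e q hq]
      exact hs p hp q hq) hb₀ (hβ ▸ h1) (hγ ▸ h2)
    linarith
  · exact hzero (by linarith [hG.1]) (Or.inr (Or.inl hG))
  · exact hzero hG.1 (Or.inr (Or.inr hG))

theorem sum_neg_of_nonpos {s : Finset doubleKronecker.Route} {a f : doubleKronecker.Route → ℝ}
    (ha : ∀ p ∈ s, 0 < a p) (hf : ∀ p ∈ s, f p ≤ 0) {q : doubleKronecker.Route} (hq : q ∈ s)
    (hq' : f q < 0) : ∑ p ∈ s, a p * f p < 0 := by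
  have := Finset.sum_lt_sum (f := fun p => a p * f p) (g := fun _ => (0 : ℝ)) (s := s)
    (fun p hp => mul_nonpos_of_nonneg_of_nonpos (ha p hp).le (hf p hp))
    ⟨q, hq, mul_neg_of_pos_of_neg (ha q hq) hq'⟩
  simpa using this

theorem not_gap_of_neg {β γ A : ℝ} (h : γ < 0 ∧ A + γ < 0 ∨ β < 0 ∧ β - A < 0) :
    ¬ Gap β γ A := by
  have key : ∀ {β γ A : ℝ}, LeftGap β γ A → ¬ (γ < 0 ∧ A + γ < 0 ∨ β < 0 ∧ β - A < 0) := by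
    rintro β γ A ⟨hA, ⟨h1, h2⟩ | ⟨b, c, -, -, t, ht, rfl, rfl⟩⟩
    · rintro (h | h) <;> linarith
    · have h1 : 0 ≤ t * b := mul_nonneg (hA.trans ht.le) (Nat.cast_nonneg b)
      have h2 : 0 ≤ t * c := mul_nonneg (hA.trans ht.le) (Nat.cast_nonneg c)
      rintro (h | h) <;> linarith
  rintro (hG | hG | ⟨rfl, h1, h2, -⟩)
  · exact key hG h
  · refine key hG ?_
    rcases h with h | h
    · right
      exact ⟨h.1, by linarith⟩
    · left
      exact ⟨h.1, by linarith⟩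
  · rcases h with h | h <;> linarith

/-- When both fringes occur, either the only right route is the cap and all left routes have last
index `-1`, or the same holds with the sides exchanged. In the first case `C` and `H + C` are
nonpositive on every generator, the former negative on left routes and the latter on the right cap;
the second case concerns `B` and `B - H`. The gap excludes both sign patterns by `not_gap_of_neg`.
-/
theorem not_gap_of_mixed {s : Finset doubleKronecker.Route} {a : doubleKronecker.Route → ℝ}
    {β γ A : ℝ} (hs : doubleKronecker.IsClique s) (ha : ∀ p ∈ s, 0 < a p)
    (hL : ∀ p ∈ s, ∃ b c, LeftIndex b c ∧ (p = leftRoute b c ∨ p = mirrorRoute (leftRoute b c)))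
    {b c b' c' : ℤ} (hp : LeftIndex b c) (hq : LeftIndex b' c') (hps : leftRoute b c ∈ s)
    (hqs : mirrorRoute (leftRoute b' c') ∈ s)
    (h : pt β γ A = ∑ p ∈ s, a p • gReal p) : ¬ Gap β γ A := by
  have key : ∀ {b c b' c' : ℤ}, LeftIndex b c → LeftIndex b' c' → leftRoute b c ∈ s →
      mirrorRoute (leftRoute b' c') ∈ s → (b = 0 ∧ c' = -1) ∨ (b' = 0 ∧ c = -1) := by
    intro b c b' c' h h' hm hm'
    rw [← compatible_leftRoute_mirrorRoute_iff h h']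
    exact hs _ hm _ hm'
  have hz : ∀ {b c : ℤ}, LeftIndex b c → b = 0 → c = -1 := by
    intro b c h h0
    rcases h with h | h <;> omega
  choose B C H hBCH using fun p => exists_pt (gReal p)
  obtain ⟨hβ, hγ, hA⟩ := eq_sum_of_combination (fun p _ => hBCH p) h
  have coord : ∀ {p : doubleKronecker.Route} {x y z : ℝ}, gReal p = pt x y z →
      B p = x ∧ C p = y ∧ H p = z := by
    intro p x y z hxyz
    exact pt_injective ((hBCH p).symm.trans hxyz)
  apply not_gap_of_neg
  by_cases hcase : ∃ b c, LeftIndex b c ∧ leftRoute b c ∈ s ∧ b ≠ 0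
  · left
    obtain ⟨b₁, c₁, h₁, hm₁, hb₁⟩ := hcase
    have hright : ∀ {b c : ℤ}, LeftIndex b c → mirrorRoute (leftRoute b c) ∈ s →
        b = 0 ∧ c = -1 := by
      intro b c h' hm'
      have h0 : b = 0 := by
        rcases key h₁ h' hm₁ hm' with k | k
        · exact (hb₁ k.1).elim
        · exact k.1
      exact ⟨h0, hz h' h0⟩
    have hleft : ∀ {b c : ℤ}, LeftIndex b c → leftRoute b c ∈ s → c = -1 := by
      intro b c h' hm'
      rcases key h' hq hm' hqs with k | k
      · exact hz h' k.1
      · exact k.2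
    have hall : ∀ p ∈ s, C p ≤ 0 ∧ H p + C p ≤ 0 := by
      intro p hp
      obtain ⟨b, c, hbc, rfl | rfl⟩ := hL p hp
      · obtain ⟨-, e2, e3⟩ := coord (gReal_leftRoute hbc)
        rw [e2, e3, hleft hbc hp]
        norm_num
      · obtain ⟨-, e2, e3⟩ := coord (gReal_mirrorRoute_leftRoute hbc)
        rw [e2, e3, (hright hbc hp).1]
        norm_num
    refine ⟨?_, ?_⟩
    · rw [hγ]
      refine sum_neg_of_nonpos ha (fun p hp => (hall p hp).1) hps ?_
      rw [(coord (gReal_leftRoute hp)).2.1, hleft hp hps]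
      norm_num
    · rw [hA, hγ, ← Finset.sum_add_distrib]
      simp only [← mul_add]
      refine sum_neg_of_nonpos ha (fun p hp => (hall p hp).2) hqs ?_
      obtain ⟨-, e2, e3⟩ := coord (gReal_mirrorRoute_leftRoute hq)
      rw [e2, e3, (hright hq hqs).1]
      norm_num
  · right
    push Not at hcase
    have hleft : ∀ {b c : ℤ}, LeftIndex b c → leftRoute b c ∈ s → b = 0 ∧ c = -1 :=
      fun h' hm' => ⟨hcase _ _ h' hm', hz h' (hcase _ _ h' hm')⟩
    have hright : ∀ {b c : ℤ}, LeftIndex b c → mirrorRoute (leftRoute b c) ∈ s → c = -1 := by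
      intro b c h' hm'
      rcases key hp h' hps hm' with k | k
      · exact k.2
      · exact hz h' k.1
    have hall : ∀ p ∈ s, B p ≤ 0 ∧ B p - H p ≤ 0 := by
      intro p hp
      obtain ⟨b, c, hbc, rfl | rfl⟩ := hL p hp
      · obtain ⟨e1, -, e3⟩ := coord (gReal_leftRoute hbc)
        rw [e1, e3, (hleft hbc hp).1]
        norm_num
      · obtain ⟨e1, -, e3⟩ := coord (gReal_mirrorRoute_leftRoute hbc)
        rw [e1, e3, hright hbc hp]
        norm_num
    refine ⟨?_, ?_⟩
    · rw [hβ]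
      refine sum_neg_of_nonpos ha (fun p hp => (hall p hp).1) hqs ?_
      rw [(coord (gReal_mirrorRoute_leftRoute hq)).1, hright hq hqs]
      norm_num
    · rw [hA, hβ, ← Finset.sum_sub_distrib]
      simp only [← mul_sub]
      refine sum_neg_of_nonpos ha (fun p hp => (hall p hp).2) hps ?_
      obtain ⟨e1, -, e3⟩ := coord (gReal_leftRoute hp)
      rw [e1, e3, (hleft hp hps).1]
      norm_num

theorem not_gap_of_mem_gCone {K : Set doubleKronecker.Route} (hK : doubleKronecker.IsClique K)
    {β γ A : ℝ} (h : pt β γ A ∈ doubleKronecker.gCone K) : ¬ Gap β γ A := by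
  classical
  obtain ⟨s, a, hs, e⟩ := exists_positive_combination h
  have hs' : doubleKronecker.IsClique s := fun p hp q hq => hK p (hs p hp).1 q (hs q hq).1
  have ha : ∀ p ∈ s, 0 < a p := fun p hp => (hs p hp).2.2
  have hL : ∀ p ∈ s, ∃ b c, LeftIndex b c ∧
      (p = leftRoute b c ∨ p = mirrorRoute (leftRoute b c)) := fun p hp =>
    exists_leftRoute_of_selfCompatible (hs' p hp p hp) (hs p hp).2.1
  by_cases h1 : ∀ p ∈ s, ∃ b c, LeftIndex b c ∧ p = leftRoute b c
  · exact not_gap_of_left hs' ha h1 e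
  by_cases h2 : ∀ p ∈ s, ∃ b c, LeftIndex b c ∧ p = mirrorRoute (leftRoute b c)
  · intro hG
    refine not_gap_of_left (s := s.image mirrorRoute) (a := fun p => a (mirrorRoute p)) ?_ ?_ ?_ ?_
      hG.mirror
    · rw [Finset.coe_image]
      exact isClique_mirror hs'
    · intro p hp
      obtain ⟨q, hq, rfl⟩ := Finset.mem_image.1 hp
      show 0 < a (mirrorRoute (mirrorRoute q))
      rw [mirrorRoute_mirrorRoute]
      exact ha q hq
    · intro p hp
      obtain ⟨q, hq, rfl⟩ := Finset.mem_image.1 hp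
      obtain ⟨b, c, hbc, rfl⟩ := h2 q hq
      exact ⟨b, c, hbc, mirrorRoute_mirrorRoute _⟩
    · rw [Finset.sum_image fun p _ q _ h => mirrorRoute_injective h, ← mirrorVec_pt, e]
      funext v
      simp only [mirrorVec, Finset.sum_apply, Pi.smul_apply, smul_eq_mul, mirrorRoute_mirrorRoute,
        gReal_mirrorRoute, ← Finset.sum_neg_distrib, mul_neg]
  · push Not at h1 h2
    obtain ⟨q, hq, hq'⟩ := h1
    obtain ⟨p, hp, hp'⟩ := h2
    obtain ⟨b, c, hbc, rfl | rfl⟩ := hL p hp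
    · obtain ⟨b', c', hbc', rfl | rfl⟩ := hL q hq
      · exact (hq' _ _ hbc' rfl).elim
      · exact not_gap_of_mixed hs' ha hL hbc hbc' hp hq e
    · exact (hp' _ _ hbc rfl).elim

theorem pt_mem_compl_gFan_iff {β γ A : ℝ} :
    pt β γ A ∈ (⋃₀ doubleKronecker.gFan)ᶜ ↔ Gap β γ A := by
  constructor
  · intro h
    exact (mem_gFan_or_gap β γ A).resolve_left h
  · rintro hG ⟨_, ⟨K, hK, rfl⟩, hz⟩
    exact not_gap_of_mem_gCone hK.prop hz hG

theorem l_combination (b c x y : ℝ) :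
    x • ![b - 1, c + 1 - b, -c - 1] + y • ![b, c - b, -c] =
      pt ((x + y) * b) ((x + y) * c) x := by
  funext v
  fin_cases v <;> simp [pt] <;> ring

theorem r_combination (b c x y : ℝ) :
    x • ![b + 1, c - b - 1, 1 - c] + y • ![b, c - b, -c] =
      pt ((x + y) * b) ((x + y) * c) (-x) := by
  funext v
  fin_cases v <;> simp [pt] <;> ring

theorem cap_l_combination (x y : ℝ) :
    x • ![(-1 : ℝ), 0, 0] + y • ![0, 1, -1] = pt 0 (y - x) x := by
  funext v
  fin_cases v <;> simp [pt]
  ring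

theorem cap_r_combination (x y : ℝ) :
    x • ![(0 : ℝ), 0, 1] + y • ![1, -1, 0] = pt (y - x) 0 (-x) := by
  funext v
  fin_cases v <;> simp [pt]
  ring

/-- The parameters correspond by `A = x` and `t = x + y`, so `y > 0` becomes `A < t`; the
exceptional cone at `(0, 1)` is the part of the gap with `β = 0`. -/
theorem exists_mem_lCone_iff {β γ A : ℝ} :
    (∃ b c : ℕ, Nat.Coprime b c ∧ pt β γ A ∈ doubleKronecker.lCone b c) ↔ LeftGap β γ A := by
  constructor
  · rintro ⟨b, c, h, x, y, hx, hy, e⟩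
    by_cases hbc : (b, c) = (0, 1)
    · rw [if_pos hbc, cap_l_combination] at e
      obtain ⟨rfl, rfl, rfl⟩ := pt_injective e
      exact ⟨hx, Or.inl ⟨rfl, by linarith⟩⟩
    · rw [if_neg hbc, l_combination] at e
      obtain ⟨rfl, rfl, rfl⟩ := pt_injective e
      rcases coprime_cases h with ⟨rfl, rfl⟩ | ⟨hb, -⟩
      · exact (hbc rfl).elim
      · exact ⟨hx, Or.inr ⟨b, c, h, hb, A + y, by linarith, rfl, rfl⟩⟩
  · rintro ⟨hA, ⟨rfl, h⟩ | ⟨b, c, h, hb, t, ht, rfl, rfl⟩⟩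
    · refine ⟨0, 1, by decide, A, γ + A, hA, h, ?_⟩
      rw [if_pos rfl, cap_l_combination, add_sub_cancel_right]
    · refine ⟨b, c, h, A, t - A, hA, by linarith, ?_⟩
      rw [if_neg (by simp only [Prod.mk.injEq]; omega), l_combination, add_sub_cancel]

theorem exists_mem_rCone_iff {β γ A : ℝ} :
    (∃ b c : ℕ, Nat.Coprime b c ∧ pt β γ A ∈ doubleKronecker.rCone b c) ↔
      LeftGap γ β (-A) := by
  constructor
  · rintro ⟨b, c, h, x, y, hx, hy, e⟩
    by_cases hbc : (b, c) = (1, 0)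
    · rw [if_pos hbc, cap_r_combination] at e
      obtain ⟨rfl, rfl, rfl⟩ := pt_injective e
      exact ⟨by linarith, Or.inl ⟨rfl, by linarith⟩⟩
    · rw [if_neg hbc, r_combination] at e
      obtain ⟨rfl, rfl, rfl⟩ := pt_injective e
      rcases coprime_cases h.symm with ⟨rfl, rfl⟩ | ⟨hc, -⟩
      · exact (hbc rfl).elim
      · exact ⟨by linarith, Or.inr ⟨c, b, h.symm, hc, x + y, by linarith, rfl, rfl⟩⟩
  · rintro ⟨hA, ⟨rfl, h⟩ | ⟨c, b, h, hc, t, ht, rfl, rfl⟩⟩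
    · refine ⟨1, 0, by decide, -A, β + -A, hA, h, ?_⟩
      rw [if_pos rfl, cap_r_combination, add_sub_cancel_right, neg_neg]
    · refine ⟨b, c, h.symm, -A, t - -A, hA, by linarith, ?_⟩
      rw [if_neg (by simp only [Prod.mk.injEq]; omega), r_combination, add_sub_cancel, neg_neg]

theorem compl_gFan_eq :
    (⋃₀ doubleKronecker.gFan)ᶜ =
      {z | ∃ b c : ℕ, Nat.Coprime b c ∧ z ∈ doubleKronecker.lCone b c} ∪
        {z | ∃ b c : ℕ, Nat.Coprime b c ∧ z ∈ doubleKronecker.rCone b c} ∪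
        {z | ∃ x y : ℝ, 0 ≤ x ∧ 0 ≤ y ∧ (x, y) ≠ (0, 0) ∧ z = ![x, y - x, -y]} := by
  ext z
  obtain ⟨β, γ, A, rfl⟩ := exists_pt z
  rw [pt_mem_compl_gFan_iff, Set.mem_union, Set.mem_union, Set.mem_ofPred_eq, Set.mem_ofPred_eq,
    exists_mem_lCone_iff, exists_mem_rCone_iff, or_assoc, Gap]
  refine or_congr_right (or_congr_right ⟨?_, ?_⟩)
  · rintro ⟨rfl, h1, h2, h3⟩
    exact ⟨β, γ, h1, h2, h3, by simp [pt]⟩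
  · rintro ⟨x, y, h1, h2, h3, e⟩
    have e' : pt β γ A = pt x y 0 := by rw [e]; simp [pt]
    obtain ⟨rfl, rfl, rfl⟩ := pt_injective e'
    exact ⟨rfl, h1, h2, h3⟩

end DoubleKronecker

theorem mainTheorem12 :
    ∃ (B : ℕ → ℕ → doubleKronecker.Band) (l r : ℤ → ℤ → doubleKronecker.Route),
      -- the self-compatible bands
      ((∀ b c : ℕ, Nat.Coprime b c →
          FringedQuiver.Band.indicator doubleKronecker (B b c)
            = doubleKronecker.flow 0 b c 0) ∧
        {X : doubleKronecker.Band | doubleKronecker.SelfCompatibleBand X}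
          = {X | ∃ b c : ℕ, Nat.Coprime b c ∧ X = B b c}) ∧
      -- the self-compatible routes
      ((∀ b c : ℤ, doubleKronecker.LIndex b c →
          FringedQuiver.Route.indicator doubleKronecker (l b c)
            = if (b, c) = (0, 1) then doubleKronecker.flow 1 0 0 0
              else doubleKronecker.flow 1 b (c + 1) 0) ∧
        (∀ b c : ℤ, doubleKronecker.RIndex b c →
          FringedQuiver.Route.indicator doubleKronecker (r b c)
            = if (b, c) = (1, 0) then doubleKronecker.flow 0 0 0 1
              else doubleKronecker.flow 0 (b + 1) c 1) ∧
        {p : doubleKronecker.Route |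
            doubleKronecker.SelfCompatibleRoute p ∧ ¬ doubleKronecker.StraightRoute p}
          = {p | ∃ b c : ℤ, doubleKronecker.LIndex b c ∧ p = l b c} ∪
            {p | ∃ b c : ℤ, doubleKronecker.RIndex b c ∧ p = r b c} ∧
        ∀ p : doubleKronecker.Route, doubleKronecker.StraightRoute p →
          doubleKronecker.SelfCompatibleRoute p) ∧
      -- the maximal reduced bundles containing bands
      ({K : Set doubleKronecker.Trail |
          doubleKronecker.IsMaximalReducedBundle K ∧ ∃ X : doubleKronecker.Band, .band X ∈ K}
        = {K | ∃ b c : ℕ, Nat.Coprime b c ∧ K = {.route (l b c), .band (B b c)}} ∪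
          {K | ∃ b c : ℕ, Nat.Coprime b c ∧ K = {.route (r b c), .band (B b c)}}) ∧
      -- the band-stable cliques that are not maximal cliques
      ({K : Set doubleKronecker.Route |
          doubleKronecker.IsBandStable K ∧ ¬ doubleKronecker.IsMaximalClique K}
        = {K | ∃ b c : ℕ, Nat.Coprime b c ∧
              K = {p | doubleKronecker.StraightRoute p} ∪ {l b c}} ∪
          {K | ∃ b c : ℕ, Nat.Coprime b c ∧
              K = {p | doubleKronecker.StraightRoute p} ∪ {r b c}} ∪
          {{p | doubleKronecker.StraightRoute p}}) ∧
      -- the same list, up to straight routes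
      ({K : Set doubleKronecker.Route | ∃ K' : Set doubleKronecker.Route,
          doubleKronecker.IsBandStable K' ∧ ¬ doubleKronecker.IsMaximalClique K' ∧
            K = doubleKronecker.bendingPart K'}
        = {K | ∃ b c : ℕ, Nat.Coprime b c ∧ K = {l b c}} ∪
          {K | ∃ b c : ℕ, Nat.Coprime b c ∧ K = {r b c}} ∪ {∅}) ∧
      -- the complement of the g-vector fan
      (⋃₀ doubleKronecker.gFan)ᶜ
        = {z | ∃ b c : ℕ, Nat.Coprime b c ∧ z ∈ doubleKronecker.lCone b c} ∪
          {z | ∃ b c : ℕ, Nat.Coprime b c ∧ z ∈ doubleKronecker.rCone b c} ∪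
          {z | ∃ x y : ℝ, 0 ≤ x ∧ 0 ≤ y ∧ (x, y) ≠ (0, 0) ∧ z = ![x, y - x, -y]} := by
  open DoubleKronecker in
  exact ⟨bnd, lRoute, rRoute,
    ⟨fun _ _ h => indicator_bnd h, Set.Subset.antisymm (fun _ => exists_eq_bnd_of_selfCompatible)
      (by rintro _ ⟨b, c, h, rfl⟩; exact selfCompatible_bnd h)⟩,
    ⟨fun _ _ h => indicator_lRoute h, fun _ _ h => indicator_rRoute h, selfCompatible_bending_eq,
      fun _ h => compatible_of_straightRoute h _⟩,
    maximalReducedBundle_eq, bandStable_eq, bendingPart_bandStable_eq, compl_gFan_eq⟩
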